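/- Let $1\le n\le 200$ be an integer. For $0\le i\le n$ and $0\le a<b\le 1$ write $$M_i(a,b)=\frac1{b-a}\int_a^b\sum_{x=i}^n\binom nx p^x(1-p)^{n-x}\,dp .$$ For $0\le j\le n$ and real $\alpha$, call $(u_j,\dots,u_n)$ an $(\alpha,j)$-chain if $0<u_j<u_{j+1}<\dots<u_n\le 1$ and $M_i(u_{i-1},u_i)=1-\alpha$ for every $i=j+1,\dots,n$. (i) Let $0.0001<\alpha<0.27$ and $1\le j\le n$, and let $(u_j,\dots,u_n)$ be an $(\alpha,j)$-chain, where $u_n=1$ in the case $j=n$ (in which the chain is the single number $u_n$). Then there is a unique $u_{j-1}$ such that $0<u_{j-1}<u_j$ and $M_j(u_{j-1},u_j)=1-\alpha$. (ii) For a fixed value of $u_n\le 1$ (in particular for $u_n=1$) and $0\le j\le n-1$, the number $u_j$ in an $(\alpha,j)$-chain $(u_j,\dots,u_n)$ is a strictly decreasing function of $\alpha$ on the set of those $\alpha\in(0.0001,0.27)$ for which such a chain exists; for $u_n=1$ this set is, by (i), the whole interval $(0.0001,0.27)$. -/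

import Mathlib

/-- The binomial upper tail `P(X ≥ i ∣ p)` for `X ~ Bin(n, p)`, as a function of `p`. -/
noncomputable def upperTail (n i : ℕ) (p : ℝ) : ℝ :=
  ∑ x ∈ Finset.Icc i n, (n.choose x : ℝ) * p ^ x * (1 - p) ^ (n - x)

/-- The average over `p ∈ (a, b)` of the coverage `P(X ≥ i ∣ p)`. -/
noncomputable def avgCoverage (n i : ℕ) (a b : ℝ) : ℝ :=
  (1 / (b - a)) * ∫ p in a..b, upperTail n i p

/-- `0 < u j < u (j + 1) < ⋯ < u n ≤ 1`, and for every `i` with `j + 1 ≤ i ≤ n` the average of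
`P(X ≥ i ∣ p)` over `(u (i - 1), u i)` equals `1 - α`. -/
structure IsEndpointChain (n j : ℕ) (α : ℝ) (u : ℕ → ℝ) : Prop where
  pos : 0 < u j
  le_one : u n ≤ 1
  lt : ∀ i ∈ Finset.Icc (j + 1) n, u (i - 1) < u i
  avg_eq : ∀ i ∈ Finset.Icc (j + 1) n, avgCoverage n i (u (i - 1)) (u i) = 1 - α

/-! ### Binomial lower tails, their derivatives and antiderivatives -/

section

open Finset (range sum_congr sum_eq_zero sum_nonneg mem_range mul_sum sum_range_succ sum_range_succ' sum_range_add_sum_Ico)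

/-! Write G_j(p) = P(X < j). A chain is a sequence for which G_i has mean α over (u_{i-1}, u_i). For
1 ≤ j ≤ n, G_j decreases from 1 to 0, so its mean over an interval decreases when either end moves
to the right; this gives uniqueness in (i).

Existence in (i). A left neighbour of p = u_j exists as soon as G_j(p) < α and the mean of G_j over
(0, p) exceeds α (`exists_left`). The next link of the chain gives α < G_{j+1}(p), and the mean over
(0, p) is at least G_{j+1}(p) unless p is small, when it exceeds 0.27 (`lt_lowAvg_zero`). For G_j(p)
< α (`IsLevelChain.lowTail_lt`), suppose the contrary, choose a ≥ p with G_j(a) = α and b with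
G_{j+2}(b) = α (b = 1 if j + 1 = n). If G_{j+1} has mean at least α over (a, b), then its mean over
(u_j, u_{j+1}) is too large, because u_j ≤ a and u_{j+1} < b. That mean inequality propagates to the
right from a single point (`excess_nonneg_of_matched`), where it is checked numerically for all
pairs (j, n - j) with n - j ≥ 2; if j + 1 = n it is proved by hand (`lowTail_pred_mul_lt`).

Monotonicity in (ii). The induction goes two steps back at a time (`lt_of_two_steps`). With the
outer points w and v fixed, compare the mean of G_{j+1} over (x, v) with that of G_j over (w, x). If
their difference is decreasing at each of its zeros, then u_{j+2}' ≤ u_{j+2} at a higher level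
forces u_j' < u_j. With P = P(X = j) and τ = (ℓ - G_j(p)) / P, decrease at a zero p with common mean
ℓ reads τ (v - p) < (1 - τ)(p - w).

This first-order condition is proved by bounding p - w from below through an exponential majorant of
the density left of p (`left_excess_lt`), and by bounding v - p through a rescaled integral,
`rightDrop`, compared with C y² / (1 + K y). The second derivative of their difference is
nonnegative exactly on an interval, so the comparison only has to be checked at one or two values of
y. If the odds n - j times p / (1 - p) are at least j + 2, this is done analytically
(`first_order_of_large`). Otherwise it is checked on finitely many cells of p and ranges of τ. Only
points to the right of the chain at level 27 / 100 matter, since chains of lower level lie to its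
right; for j ≤ 33 that chain is enclosed numerically, and for j ≥ 34 the analytic case always
applies. The checks are exact computations with natural numbers on the grid of denominator
`gridDen`, written in primitives that the kernel evaluates directly. -/

/-- The binomial lower tail `P(X < j)` for `X ~ Bin(n, p)`. -/
noncomputable def lowTail (n j : ℕ) (p : ℝ) : ℝ :=
  ∑ x ∈ range j, (n.choose x : ℝ) * p ^ x * (1 - p) ^ (n - x)

/-- The binomial probability `P(X = j)` for `X ~ Bin(n, p)`. -/
noncomputable def bpmf (n j : ℕ) (p : ℝ) : ℝ := (n.choose j : ℝ) * p ^ j * (1 - p) ^ (n - j)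

/-- The negative of the derivative of `lowTail n j`. -/
noncomputable def tdens (n j : ℕ) (p : ℝ) : ℝ :=
  j * (n.choose j : ℝ) * p ^ (j - 1) * (1 - p) ^ (n - j)

/-- The antiderivative of `lowTail n j`. -/
noncomputable def lowInt (n j : ℕ) (p : ℝ) : ℝ :=
  (∑ i ∈ range j, (1 - lowTail (n + 1) (i + 1) p)) / (n + 1)

lemma lowTail_succ (n j : ℕ) (p : ℝ) : lowTail n (j + 1) p = lowTail n j p + bpmf n j p := by
  simp [lowTail, bpmf, sum_range_succ]

lemma mul_tdens (n j : ℕ) (p : ℝ) : p * tdens n j p = j * bpmf n j p := by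
  rcases j with _ | j
  · simp [tdens]
  · simp only [tdens, bpmf, Nat.add_sub_cancel]; ring

lemma one_sub_mul_tdens (n j : ℕ) (hj : j < n) (p : ℝ) :
    (1 - p) * tdens n (j + 1) p = (n - j) * bpmf n j p := by
  have h := Nat.choose_succ_right_eq n j
  have h' : (n.choose (j + 1) : ℝ) * (j + 1) = n.choose j * (n - j) := by
    rw [← Nat.cast_sub hj.le]; exact_mod_cast h
  obtain ⟨k, rfl⟩ : ∃ k, n = j + 1 + k := ⟨n - (j + 1), by omega⟩
  have e1 : j + 1 + k - (j + 1) = k := by omega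
  have e2 : j + 1 + k - j = k + 1 := by omega
  simp only [tdens, bpmf, Nat.add_sub_cancel, e1, e2]
  push_cast at h' ⊢
  calc _ = ((j + 1 + k).choose (j + 1) * (j + 1) : ℝ) * (p ^ j * ((1 - p) ^ k * (1 - p))) := by ring
    _ = _ := by rw [h']; ring

lemma hasDerivAt_bpmf (n j : ℕ) (p : ℝ) :
    HasDerivAt (bpmf n j) (tdens n j p - tdens n (j + 1) p) p := by
  have h := Nat.choose_succ_right_eq n j
  have h' : (n.choose (j + 1) : ℝ) * (j + 1) = n.choose j * ((n - j : ℕ) : ℝ) := by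
    exact_mod_cast h
  have h1 : HasDerivAt (fun p : ℝ => (1 - p) ^ (n - j))
      (((n - j : ℕ) : ℝ) * (1 - p) ^ (n - j - 1) * (-1)) p := by
    exact ((hasDerivAt_id p).const_sub 1).fun_pow (n - j)
  have h2 := ((hasDerivAt_pow j p).const_mul (n.choose j : ℝ)).mul h1
  refine HasDerivAt.congr_deriv h2 ?_
  simp only [tdens, Nat.add_sub_cancel]
  have e1 : n - (j + 1) = n - j - 1 := by omega
  rw [e1]
  push_cast
  have : ((j : ℝ) + 1) * (n.choose (j + 1)) = n.choose j * ((n - j : ℕ) : ℝ) := by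
    rw [← h']; ring
  rw [this]; ring

/-- The derivatives of the single probabilities telescope, and `tdens n 0` vanishes through its
factor `j`. -/
lemma hasDerivAt_lowTail (n j : ℕ) (hj : j ≤ n) (p : ℝ) :
    HasDerivAt (lowTail n j) (-tdens n j p) p := by
  induction j with
  | zero =>
    have : lowTail n 0 = fun _ => (0 : ℝ) := by funext p; simp [lowTail]
    rw [this]; simpa [tdens] using hasDerivAt_const p (0 : ℝ)
  | succ j ih =>
    have : lowTail n (j + 1) = fun p => lowTail n j p + bpmf n j p := by
      funext p; exact lowTail_succ n j p
    rw [this]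
    refine ((ih (by omega)).add (hasDerivAt_bpmf n j p)).congr_deriv ?_
    ring

/-- This is why `lowInt` is an antiderivative: the tails of Bin(n + 1, p) have the probabilities of
Bin(n, p) as derivatives, up to the factor n + 1. -/
lemma tdens_succ_succ (n i : ℕ) (p : ℝ) : tdens (n + 1) (i + 1) p = (n + 1) * bpmf n i p := by
  have h := Nat.add_one_mul_choose_eq n i
  have h' : ((n : ℝ) + 1) * n.choose i = (n + 1).choose (i + 1) * (i + 1) := by exact_mod_cast h
  simp only [tdens, bpmf, Nat.add_sub_cancel, Nat.add_sub_add_right]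
  push_cast
  calc _ = ((n + 1).choose (i + 1) * (i + 1) : ℝ) * (p ^ i * (1 - p) ^ (n - i)) := by ring
    _ = _ := by rw [← h']; ring

lemma hasDerivAt_lowInt (n j : ℕ) (hj : j ≤ n + 1) (p : ℝ) :
    HasDerivAt (lowInt n j) (lowTail n j p) p := by
  have h : HasDerivAt (fun p => ∑ i ∈ range j, (1 - lowTail (n + 1) (i + 1) p))
      (∑ i ∈ range j, (n + 1) * bpmf n i p) p := by
    refine HasDerivAt.fun_sum fun i hi => ?_
    have := (hasDerivAt_lowTail (n + 1) (i + 1) (by have := mem_range.1 hi; omega) p).const_sub 1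
    rw [tdens_succ_succ] at this
    simpa using this
  refine (h.div_const ((n : ℝ) + 1)).congr_deriv ?_
  rw [← mul_sum, mul_div_assoc, mul_comm]
  have : (n : ℝ) + 1 ≠ 0 := by positivity
  field_simp
  rfl

lemma continuous_lowTail (n j : ℕ) : Continuous (lowTail n j) := by
  unfold lowTail; fun_prop

lemma continuous_lowInt (n j : ℕ) : Continuous (lowInt n j) := by
  unfold lowInt lowTail; fun_prop

lemma lowTail_at_zero (n j : ℕ) (hj : 1 ≤ j) : lowTail n j 0 = 1 := by
  obtain ⟨j, rfl⟩ : ∃ k, j = k + 1 := ⟨j - 1, by omega⟩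
  simp [lowTail, sum_range_succ']

lemma lowTail_at_one (n j : ℕ) (hj : j ≤ n) : lowTail n j 1 = 0 := by
  unfold lowTail
  refine sum_eq_zero fun x hx => ?_
  have : n - x ≠ 0 := by have := mem_range.1 hx; omega
  simp [this]

lemma lowTail_full (n : ℕ) (p : ℝ) : lowTail n (n + 1) p = 1 := by
  have := add_pow p (1 - p) n
  rw [add_sub_cancel, one_pow] at this
  rw [this, lowTail]
  exact sum_congr rfl fun x _ => by ring

lemma lowInt_at_zero (n j : ℕ) : lowInt n j 0 = 0 := by
  unfold lowInt
  rw [sum_eq_zero, zero_div]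
  intro i _
  rw [lowTail_at_zero _ _ (by omega), sub_self]

lemma lowInt_at_one (n j : ℕ) (hj : j ≤ n + 1) : lowInt n j 1 = j / (n + 1) := by
  unfold lowInt
  rw [sum_congr rfl (g := fun _ => (1 : ℝ))]
  · simp
  · intro i hi
    rw [lowTail_at_one _ _ (by have := mem_range.1 hi; omega), sub_zero]

lemma bpmf_nonneg (n j : ℕ) {p : ℝ} (h0 : 0 ≤ p) (h1 : p ≤ 1) : 0 ≤ bpmf n j p := by
  have : 0 ≤ 1 - p := by linarith
  unfold bpmf; positivity

lemma bpmf_pos (n j : ℕ) (hj : j ≤ n) {p : ℝ} (h0 : 0 < p) (h1 : p < 1) : 0 < bpmf n j p := by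
  have : 0 < 1 - p := by linarith
  have : 0 < n.choose j := Nat.choose_pos hj
  unfold bpmf; positivity

lemma tdens_pos (n j : ℕ) (hj : 1 ≤ j) (hj' : j ≤ n) {p : ℝ} (h0 : 0 < p) (h1 : p < 1) :
    0 < tdens n j p := by
  have : 0 < 1 - p := by linarith
  have : 0 < n.choose j := Nat.choose_pos hj'
  have : (0 : ℝ) < j := by exact_mod_cast hj
  unfold tdens; positivity

lemma lowTail_nonneg (n j : ℕ) {p : ℝ} (h0 : 0 ≤ p) (h1 : p ≤ 1) : 0 ≤ lowTail n j p := by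
  have : 0 ≤ 1 - p := by linarith
  unfold lowTail
  exact sum_nonneg fun _ _ => by positivity

lemma lowTail_le_succ (n j : ℕ) {p : ℝ} (h0 : 0 ≤ p) (h1 : p ≤ 1) :
    lowTail n j p ≤ lowTail n (j + 1) p := by
  rw [lowTail_succ]; linarith [bpmf_nonneg n j h0 h1]

lemma lowTail_lt_succ (n j : ℕ) (hj : j ≤ n) {p : ℝ} (h0 : 0 < p) (h1 : p < 1) :
    lowTail n j p < lowTail n (j + 1) p := by
  rw [lowTail_succ]; linarith [bpmf_pos n j hj h0 h1]

lemma lowTail_strictAntiOn (n j : ℕ) (hj : 1 ≤ j) (hj' : j ≤ n) :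
    StrictAntiOn (lowTail n j) (Set.Icc 0 1) := by
  refine strictAntiOn_of_deriv_neg (convex_Icc 0 1) (continuous_lowTail n j).continuousOn ?_
  intro p hp
  rw [interior_Icc] at hp
  rw [(hasDerivAt_lowTail n j hj' p).deriv]
  linarith [tdens_pos n j hj hj' hp.1 hp.2]

lemma upperTail_eq (n j : ℕ) (hj : j ≤ n + 1) (p : ℝ) : upperTail n j p = 1 - lowTail n j p := by
  rw [← lowTail_full n p, upperTail, lowTail, lowTail, eq_sub_iff_add_eq, add_comm,
    ← sum_range_add_sum_Ico _ hj]
  rfl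

lemma integral_lowTail (n j : ℕ) (hj : j ≤ n + 1) (a b : ℝ) :
    ∫ p in a..b, lowTail n j p = lowInt n j b - lowInt n j a :=
  intervalIntegral.integral_eq_sub_of_hasDerivAt (fun x _ => hasDerivAt_lowInt n j hj x)
    ((continuous_lowTail n j).intervalIntegrable _ _)

lemma avgCoverage_eq_iff (n j : ℕ) (hj : j ≤ n + 1) {a b : ℝ} (hab : a < b) (α : ℝ) :
    avgCoverage n j a b = 1 - α ↔ lowInt n j b - lowInt n j a = α * (b - a) := by
  have h : ∫ p in a..b, upperTail n j p = (b - a) - (lowInt n j b - lowInt n j a) := by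
    rw [← integral_lowTail n j hj]
    have : ∀ p, upperTail n j p = 1 - lowTail n j p := upperTail_eq n j hj
    simp only [this]
    rw [intervalIntegral.integral_sub (by simp)
      ((continuous_lowTail n j).intervalIntegrable _ _)]
    simp
  have hne : b - a ≠ 0 := by linarith
  rw [avgCoverage, h]
  constructor
  · intro e
    field_simp at e
    linarith
  · intro e
    rw [e]
    field_simp

end

/-! ### Averages of the lower tail and the two-step comparison -/

section

open Set Filter Topology

/-- The average of `lowTail n j` over `(a, b)`. -/
noncomputable def lowAvg (n j : ℕ) (a b : ℝ) : ℝ := (lowInt n j b - lowInt n j a) / (b - a)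

lemma lowInt_sub_eq (n j : ℕ) {a b : ℝ} (hab : a < b) :
    lowInt n j b - lowInt n j a = lowAvg n j a b * (b - a) := by
  have : b - a ≠ 0 := by linarith
  rw [lowAvg, div_mul_cancel₀ _ this]

lemma avgCoverage_eq_iff' (n j : ℕ) (hj : j ≤ n + 1) {a b : ℝ} (hab : a < b) (α : ℝ) :
    avgCoverage n j a b = 1 - α ↔ lowAvg n j a b = α := by
  have : b - a ≠ 0 := by linarith
  rw [avgCoverage_eq_iff n j hj hab, lowAvg, div_eq_iff this]

lemma exists_lowInt_sub (n j : ℕ) (hj : j ≤ n + 1) {a b : ℝ} (hab : a < b) :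
    ∃ c ∈ Ioo a b, lowInt n j b - lowInt n j a = lowTail n j c * (b - a) := by
  obtain ⟨c, hc, h⟩ := exists_hasDerivAt_eq_slope (lowInt n j) (lowTail n j) hab
    (continuous_lowInt n j).continuousOn fun x _ => hasDerivAt_lowInt n j hj x
  refine ⟨c, hc, ?_⟩
  have : b - a ≠ 0 := by linarith
  rw [h, div_mul_cancel₀ _ this]

lemma lowInt_sub_lt (n j : ℕ) (hj : 1 ≤ j) (hj' : j ≤ n) {a b : ℝ} (h0 : 0 ≤ a) (hab : a < b)
    (h1 : b ≤ 1) : lowInt n j b - lowInt n j a < lowTail n j a * (b - a) := by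
  obtain ⟨c, hc, h⟩ := exists_lowInt_sub n j (by omega) hab
  rw [h]
  refine mul_lt_mul_of_pos_right (lowTail_strictAntiOn n j hj hj' ⟨h0, by linarith⟩
    ⟨by linarith [hc.1], by linarith [hc.2]⟩ hc.1) (by linarith)

lemma lt_lowInt_sub (n j : ℕ) (hj : 1 ≤ j) (hj' : j ≤ n) {a b : ℝ} (h0 : 0 ≤ a) (hab : a < b)
    (h1 : b ≤ 1) : lowTail n j b * (b - a) < lowInt n j b - lowInt n j a := by
  obtain ⟨c, hc, h⟩ := exists_lowInt_sub n j (by omega) hab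
  rw [h]
  refine mul_lt_mul_of_pos_right (lowTail_strictAntiOn n j hj hj'
    ⟨by linarith [hc.1], by linarith [hc.2]⟩ ⟨by linarith, by linarith⟩ hc.2) (by linarith)

lemma lowAvg_lt (n j : ℕ) (hj : 1 ≤ j) (hj' : j ≤ n) {a b : ℝ} (h0 : 0 ≤ a) (hab : a < b)
    (h1 : b ≤ 1) : lowAvg n j a b < lowTail n j a := by
  rw [lowAvg, div_lt_iff₀ (by linarith)]; exact lowInt_sub_lt n j hj hj' h0 hab h1

lemma lt_lowAvg (n j : ℕ) (hj : 1 ≤ j) (hj' : j ≤ n) {a b : ℝ} (h0 : 0 ≤ a) (hab : a < b)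
    (h1 : b ≤ 1) : lowTail n j b < lowAvg n j a b := by
  rw [lowAvg, lt_div_iff₀ (by linarith)]; exact lt_lowInt_sub n j hj hj' h0 hab h1

/-- On the added part (a', a) the function exceeds its value at a, which in turn exceeds its mean
over (a, b). -/
lemma lowAvg_lt_of_left_lt (n j : ℕ) (hj : 1 ≤ j) (hj' : j ≤ n) {a a' b : ℝ} (h0 : 0 ≤ a')
    (ha : a' < a) (hab : a < b) (h1 : b ≤ 1) : lowAvg n j a b < lowAvg n j a' b := by
  have e1 := lowAvg_lt n j hj hj' (h0.trans ha.le) hab h1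
  have e2 := lt_lowInt_sub n j hj hj' h0 ha (by linarith)
  have e3 := lowInt_sub_eq n j hab
  rw [lowAvg.eq_1 n j a' b, lt_div_iff₀ (by linarith)]
  nlinarith

lemma lowAvg_lt_of_lt_right (n j : ℕ) (hj : 1 ≤ j) (hj' : j ≤ n) {a b b' : ℝ} (h0 : 0 ≤ a)
    (hab : a < b') (hb : b' < b) (h1 : b ≤ 1) : lowAvg n j a b < lowAvg n j a b' := by
  have e1 := lt_lowAvg n j hj hj' h0 hab (by linarith)
  have e2 := lowInt_sub_lt n j hj hj' (by linarith) hb h1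
  have e3 := lowInt_sub_eq n j hab
  rw [lowAvg.eq_1 n j a b, div_lt_iff₀ (by linarith)]
  nlinarith

lemma lowAvg_le_lowAvg (n j : ℕ) (hj : 1 ≤ j) (hj' : j ≤ n) {a a' b b' : ℝ} (h0 : 0 ≤ a')
    (ha : a' ≤ a) (hab : a < b) (hab' : a' < b') (hb : b' ≤ b) (h1 : b ≤ 1) :
    lowAvg n j a b ≤ lowAvg n j a' b' := by
  have s1 : lowAvg n j a b ≤ lowAvg n j a' b := by
    rcases ha.eq_or_lt with rfl | h
    · rfl
    · exact (lowAvg_lt_of_left_lt n j hj hj' h0 h hab h1).le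
  refine s1.trans ?_
  rcases hb.eq_or_lt with rfl | h
  · rfl
  · exact (lowAvg_lt_of_lt_right n j hj hj' h0 hab' h h1).le

/-- A differentiable function that is nonpositive at `a` and vanishes at `b > a` cannot be
strictly decreasing at each of its zeros. -/
lemma false_of_deriv_neg_at_zeros {f f' : ℝ → ℝ} {a b : ℝ} (hab : a < b)
    (hd : ∀ x ∈ Icc a b, HasDerivAt f (f' x) x) (ha : f a ≤ 0) (hb : f b = 0)
    (hz : ∀ z ∈ Icc a b, f z = 0 → f' z < 0) : False := by
  have key : ∀ z ∈ Icc a b, f z = 0 → ∀ᶠ x in 𝓝[≠] z, slope f z x < 0 := fun z hz1 hz2 =>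
    (hasDerivAt_iff_tendsto_slope.1 (hd z hz1)).eventually_lt_const (hz z hz1 hz2)
  have hbm : b ∈ Icc a b := ⟨hab.le, le_rfl⟩
  -- Since f vanishes at b with negative slopes nearby, it is positive just to the left of b.
  obtain ⟨c, hc, hfc⟩ : ∃ c ∈ Ioo a b, 0 < f c := by
    have h1 := (key b hbm hb).filter_mono (nhdsWithin_mono b (fun x (hx : x ∈ Iio b) => (ne_of_lt hx : x ≠ b)))
    obtain ⟨c, hs, hc⟩ := (h1.and (Ioo_mem_nhdsLT hab)).exists
    refine ⟨c, hc, ?_⟩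
    rw [slope_def_field, hb, sub_zero] at hs
    by_contra hcon
    exact absurd hs (not_lt.2 (div_nonneg_of_nonpos (not_lt.1 hcon) (by linarith [hc.2])))
  have hcont : ContinuousOn f (Icc a c) := fun x hx =>
    (hd x ⟨hx.1, hx.2.trans hc.2.le⟩).continuousAt.continuousWithinAt
  have hcl : IsClosed (Icc a c ∩ f ⁻¹' Iic 0) := hcont.preimage_isClosed_of_isClosed isClosed_Icc isClosed_Iic
  have hcpt : IsCompact (Icc a c ∩ f ⁻¹' Iic 0) := isCompact_Icc.of_isClosed_subset hcl inter_subset_left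
  -- The last point before c where f is nonpositive. It is a zero with f positive to its right, so
  -- its right slopes are nonnegative, against the hypothesis.
  obtain ⟨z, ⟨hzI, hz0⟩, hzmax⟩ := hcpt.exists_isMaxOn ⟨a, ⟨le_rfl, hc.1.le⟩, ha⟩ continuousOn_id
  have hzc : z < c := by
    rcases hzI.2.eq_or_lt with h | h
    · rw [h] at hz0; exact absurd hfc (not_lt.2 hz0)
    · exact h
  have hpos : ∀ x ∈ Ioo z c, 0 < f x := by
    intro x hx
    by_contra hcon
    have := hzmax (⟨⟨hzI.1.trans hx.1.le, hx.2.le⟩, not_lt.1 hcon⟩ : x ∈ Icc a c ∩ f ⁻¹' Iic 0)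
    exact absurd hx.1 (not_lt.2 this)
  have hzm : z ∈ Icc a b := ⟨hzI.1, hzI.2.trans hc.2.le⟩
  have hfz : f z = 0 := by
    refine le_antisymm hz0 ?_
    refine ge_of_tendsto ((hd z hzm).continuousAt.tendsto.mono_left
      (nhdsWithin_le_nhds (s := Ioi z))) ?_
    filter_upwards [Ioo_mem_nhdsGT hzc] with x hx using (hpos x hx).le
  have h1 := (key z hzm hfz).filter_mono (nhdsWithin_mono z (fun x (hx : x ∈ Ioi z) => (ne_of_gt hx : x ≠ z)))
  obtain ⟨x, hs, hx⟩ := (h1.and (Ioo_mem_nhdsGT hzc)).exists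
  rw [slope_def_field, hfz, sub_zero] at hs
  exact absurd hs (not_lt.2 (div_nonneg (hpos x hx).le (by linarith [hx.1])))

/-- If the endpoint two steps to the right does not increase with the level, then the endpoint
reached by two backward steps strictly decreases, provided the first-order condition `hρ` holds
at every intermediate configuration. -/
lemma lt_of_two_steps (n j : ℕ) (hj : 1 ≤ j) (hj' : j + 1 ≤ n) {α α' w p v w' p' v' : ℝ}
    (hα : α < α') (hw : 0 ≤ w) (hwp : w < p) (hpv : p < v) (hv : v ≤ 1)
    (hw' : 0 ≤ w') (hwp' : w' < p') (hpv' : p' < v') (hvv : v' ≤ v)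
    (h1 : lowAvg n j w p = α) (h2 : lowAvg n (j + 1) p v = α)
    (h1' : lowAvg n j w' p' = α') (h2' : lowAvg n (j + 1) p' v' = α')
    (hρ : ∀ z ∈ Icc p' p, w < z → ∀ ℓ ≤ α', lowAvg n j w z = ℓ → lowAvg n (j + 1) z v = ℓ →
      (ℓ - lowTail n j z) * (v - z) < (lowTail n (j + 1) z - ℓ) * (z - w)) : w' < w := by
  by_contra hcon
  rw [not_lt] at hcon
  -- Otherwise (w', p') lies weakly to the right of (w, p) at both ends, and its mean α' could not
  -- exceed α.
  have hpp : p' < p := by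
    by_contra h
    have := lowAvg_le_lowAvg n j hj (by omega) hw hcon hwp' hwp (not_lt.1 h) (by linarith)
    linarith
  have hw'p : w < p' := hcon.trans_lt hwp'
  -- The difference of the mean of G_{j+1} over (x, v) and that of G_j over (w, x), multiplied by
  -- the positive factor (x - w)(v - x) to clear denominators.
  set K : ℝ → ℝ := fun x => (x - w) * (lowInt n (j + 1) v - lowInt n (j + 1) x)
    - (v - x) * (lowInt n j x - lowInt n j w) with hK
  set K' : ℝ → ℝ := fun x => (lowInt n (j + 1) v - lowInt n (j + 1) x)
    - (x - w) * lowTail n (j + 1) x + (lowInt n j x - lowInt n j w) - (v - x) * lowTail n j x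
  have hKd : ∀ x, HasDerivAt K (K' x) x := by
    intro x
    have d1 := ((hasDerivAt_id x).sub_const w).mul
      ((hasDerivAt_lowInt n (j + 1) (by omega) x).const_sub (lowInt n (j + 1) v))
    have d2 := ((hasDerivAt_id x).const_sub v).mul
      ((hasDerivAt_lowInt n j (by omega) x).sub_const (lowInt n j w))
    refine (d1.sub d2).congr_deriv ?_
    simp only [K', id]; ring
  have hKform : ∀ x, w < x → x < v → K x = (x - w) * (v - x) *
      (lowAvg n (j + 1) x v - lowAvg n j w x) := by
    intro x hx1 hx2
    simp only [hK]
    rw [lowInt_sub_eq n (j + 1) hx2, lowInt_sub_eq n j hx1]; ring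
  refine false_of_deriv_neg_at_zeros hpp (fun x _ => hKd x) ?_ ?_ ?_
  -- K(p') ≤ 0: moving v' right to v lowers the mean of G_{j+1} from α', and moving w' left to w
  -- raises the mean of G_j from α'.
  · rw [hKform p' hw'p (hpp.trans hpv)]
    have e1 := lowAvg_le_lowAvg n (j + 1) (by omega) hj' (hw'.trans hwp'.le) le_rfl
      (hpp.trans hpv) hpv' hvv hv
    have e2 := lowAvg_le_lowAvg n j hj (by omega) hw hcon hwp' hw'p le_rfl (by linarith)
    refine mul_nonpos_of_nonneg_of_nonpos (mul_nonneg ?_ ?_) ?_ <;> linarith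
  · rw [hKform p hwp hpv, h1, h2]; ring
  · intro z hz hz0
    have hwz : w < z := hw'p.trans_le hz.1
    have hzv : z < v := hz.2.trans_lt hpv
    rw [hKform z hwz hzv] at hz0
    have hL : lowAvg n (j + 1) z v = lowAvg n j w z := by
      have hne : (z - w) * (v - z) ≠ 0 := (mul_pos (by linarith) (by linarith)).ne'
      have := (mul_eq_zero.1 hz0).resolve_left hne
      linarith
    have hle : lowAvg n j w z ≤ α' := by
      rw [← hL, ← h2']
      exact lowAvg_le_lowAvg n (j + 1) (by omega) hj' (hw'.trans hwp'.le) hz.1 hzv hpv' hvv hv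
    have := hρ z hz hwz _ hle rfl hL
    -- At a zero with common mean ℓ, the derivative is (ℓ - G_j(z))(v - z) - (G_{j+1}(z) - ℓ)(z -
    -- w).
    simp only [K']
    rw [lowInt_sub_eq n (j + 1) hzv, lowInt_sub_eq n j hwz, hL]
    linarith

end

/-! ### Exponential estimates to the left of a point -/

section

open Set Filter Topology Finset

/-- A function with nonnegative derivative that vanishes at `0` is nonnegative. -/
lemma nonneg_of_hasDerivAt {f f' : ℝ → ℝ} {d : ℝ} (hd : ∀ x, 0 ≤ x → x ≤ d → HasDerivAt f (f' x) x)
    (h0 : f 0 = 0) (hf : ∀ x, 0 ≤ x → x ≤ d → 0 ≤ f' x) {x : ℝ} (hx : 0 ≤ x) (hxd : x ≤ d) :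
    0 ≤ f x := by
  rcases hx.eq_or_lt with rfl | hx'
  · rw [h0]
  obtain ⟨c, hc, h⟩ := exists_hasDerivAt_eq_slope f f' hx'
    (fun y hy => (hd y hy.1 (hy.2.trans hxd)).continuousAt.continuousWithinAt)
    fun y hy => hd y hy.1.le (hy.2.le.trans hxd)
  rw [h0, sub_zero, sub_zero, eq_div_iff hx'.ne'] at h
  rw [← h]
  exact mul_nonneg (hf c hc.1.le (hc.2.le.trans hxd)) hx

/-- The Taylor remainder of the exponential function at `0`. -/
noncomputable def expRem (N : ℕ) (x : ℝ) : ℝ := Real.exp x - ∑ i ∈ range N, x ^ i / (i.factorial : ℝ)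

lemma hasDerivAt_expRem_succ (N : ℕ) (x : ℝ) : HasDerivAt (expRem (N + 1)) (expRem N x) x := by
  have h : HasDerivAt (fun x : ℝ => ∑ i ∈ range (N + 1), x ^ i / (i.factorial : ℝ))
      (∑ i ∈ range (N + 1), (i : ℝ) * x ^ (i - 1) / (i.factorial : ℝ)) x :=
    HasDerivAt.fun_sum fun i _ => (hasDerivAt_pow i x).div_const _
  refine ((Real.hasDerivAt_exp x).sub h).congr_deriv ?_
  rw [expRem, sum_range_succ']
  simp only [Nat.cast_zero, zero_mul, zero_div, add_zero, Nat.add_sub_cancel, sub_right_inj]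
  refine sum_congr rfl fun i _ => ?_
  rw [Nat.factorial_succ]
  have : (i.factorial : ℝ) ≠ 0 := by positivity
  have : ((i : ℝ) + 1) ≠ 0 := by positivity
  push_cast
  field_simp

lemma expRem_succ (N : ℕ) (x : ℝ) :
    expRem (N + 1) x = expRem N x - x ^ N / (N.factorial : ℝ) := by
  rw [expRem, expRem, sum_range_succ]; ring

lemma expRem_succ_zero (N : ℕ) : expRem (N + 1) 0 = 0 := by
  rw [expRem, sum_range_succ']; simp

/-- The remainder is dominated by a geometric series of ratio x / (N + 1). In the induction, the
derivative of the difference for N + 1 is (N + 1) / (N + 2) times the difference for N. -/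
lemma expRem_mul_le (N : ℕ) : ∀ x : ℝ, 0 ≤ x →
    expRem N x * (1 - x / (N + 1)) ≤ x ^ N / (N.factorial : ℝ) := by
  induction N with
  | zero =>
    intro x _
    have h := Real.add_one_le_exp (-x)
    have e : Real.exp x * Real.exp (-x) = 1 := by rw [← Real.exp_add]; simp
    simp only [expRem, range_zero, sum_empty, sub_zero, Nat.cast_zero, zero_add, div_one, pow_zero,
      Nat.factorial_zero, Nat.cast_one]
    nlinarith [Real.exp_pos x]
  | succ N ih =>
    intro x hx
    have hN : ((N : ℝ) + 1) ≠ 0 := by positivity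
    have hN2 : ((N : ℝ) + 2) ≠ 0 := by positivity
    have hf : (N.factorial : ℝ) ≠ 0 := by positivity
    have key := nonneg_of_hasDerivAt
      (f := fun x => x ^ (N + 1) / ((N + 1).factorial : ℝ)
        - expRem (N + 1) x * (1 - x / ((N : ℝ) + 2)))
      (f' := fun x => ((N + 1) / (N + 2) : ℝ) *
        (x ^ N / (N.factorial : ℝ) - expRem N x * (1 - x / (N + 1)))) (d := x)
      (fun y _ _ => by
        have d1 := (hasDerivAt_pow (N + 1) y).div_const ((N + 1).factorial : ℝ)
        have d2 := (hasDerivAt_expRem_succ N y).mul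
          (((hasDerivAt_id y).div_const ((N : ℝ) + 2)).const_sub 1)
        refine (d1.sub d2).congr_deriv ?_
        rw [expRem_succ, Nat.factorial_succ]
        push_cast
        simp only [id]
        field_simp
        ring)
      (by simp [expRem_succ_zero])
      (fun y hy _ => mul_nonneg (by positivity) (sub_nonneg.2 (ih y hy))) hx le_rfl
    simp only [sub_nonneg] at key
    push_cast
    convert key using 3
    ring

/-- `c₀ + c₁ g` dominates `g / x`, where `g = (exp x - 1 - x) / x`. -/
def IsExpTangent (c₀ c₁ : ℝ) : Prop :=
  ∀ x : ℝ, 0 < x → (1 - c₁ * x) * (Real.exp x - 1 - x) < c₀ * x ^ 2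

/-- Expand (1 - c₁ x)(exp x - 1 - x) / x² up to x⁴. The condition c₁ ≥ 1 / 7 lets `expRem_mul_le 6`
absorb the whole remainder into the coefficient 1 / 720. -/
lemma isExpTangent_of_poly {c₀ c₁ : ℝ} (hc₀ : 0 < c₀) (hc₁ : 1 / 7 ≤ c₁)
    (h : ∀ x : ℝ, 0 < x → c₁ * x < 1 → 1 / 2 + (1 / 6 - c₁ / 2) * x + (1 / 24 - c₁ / 6) * x ^ 2
      + (1 / 120 - c₁ / 24) * x ^ 3 + (1 / 720 - c₁ / 120) * x ^ 4 < c₀) : IsExpTangent c₀ c₁ := by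
  intro x hx
  have hpos : 0 < c₀ * x ^ 2 := by positivity
  have hE : 0 ≤ Real.exp x - 1 - x := by linarith [Real.add_one_le_exp x]
  rcases le_or_gt 1 (c₁ * x) with h1 | h1
  · exact lt_of_le_of_lt (mul_nonpos_of_nonpos_of_nonneg (by linarith) hE) hpos
  have hr := expRem_mul_le 6 x hx.le
  have hr0 : 0 ≤ expRem 6 x := by
    have := Real.sum_le_exp_of_nonneg hx.le 6
    rw [expRem]; linarith
  have he : Real.exp x - 1 - x
      = x ^ 2 / 2 + x ^ 3 / 6 + x ^ 4 / 24 + x ^ 5 / 120 + expRem 6 x := by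
    simp only [expRem, sum_range_succ, range_zero, sum_empty, Nat.factorial]
    push_cast; ring
  have hr' : (1 - c₁ * x) * expRem 6 x ≤ x ^ 6 / 720 := by
    have h2 : (1 - c₁ * x) * expRem 6 x ≤ (1 - x / 7) * expRem 6 x :=
      mul_le_mul_of_nonneg_right (by nlinarith) hr0
    simp only [Nat.factorial] at hr
    push_cast at hr
    norm_num at hr
    linarith
  have hp := mul_lt_mul_of_pos_right (h x hx h1) (pow_pos hx 2)
  rw [he, mul_add]
  nlinarith

lemma isExpTangent_one_third : IsExpTangent (1 / 2) (1 / 3) :=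
  isExpTangent_of_poly (by norm_num) (by norm_num) fun x hx _ => by
    have := pow_pos hx 2; have := pow_pos hx 3; have := pow_pos hx 4; linarith

lemma isExpTangent_three_tenths : IsExpTangent (2531 / 5000) (3 / 10) :=
  isExpTangent_of_poly (by norm_num) (by norm_num) fun x hx _ => by
    have := pow_pos hx 3; have := pow_pos hx 4
    nlinarith [sq_nonneg (x - 4 / 5), mul_nonneg hx.le (sq_nonneg (x - 4 / 5)), sq_nonneg (x ^ 2 - 16 / 25)]

lemma isExpTangent_seven_twentyfifths : IsExpTangent (259 / 500) (7 / 25) :=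
  isExpTangent_of_poly (by norm_num) (by norm_num) fun x hx _ => by
    have := pow_pos hx 3; have := pow_pos hx 4
    nlinarith [sq_nonneg (x - 16 / 15), mul_nonneg hx.le (sq_nonneg (x - 16 / 15)), sq_nonneg (x ^ 2 - 256 / 225)]

/-- Exponential bound for the density to the left of `p`. -/
lemma tdens_sub_le (n j : ℕ) (hj : 1 ≤ j) {p s : ℝ} (hp : 0 < p) (hp1 : p < 1)
    (hs : 0 ≤ s) (hsp : s ≤ p) : tdens n j (p - s) ≤
      tdens n j p * Real.exp ((((n - j : ℕ) : ℝ) / (1 - p) - (j - 1) / p) * s) := by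
  have hq : 0 < 1 - p := by linarith
  have e1 : (p - s) ^ (j - 1) ≤ p ^ (j - 1) * Real.exp (-((j - 1) * s / p)) := by
    have h1 : p - s ≤ p * Real.exp (-(s / p)) := by
      have := Real.add_one_le_exp (-(s / p))
      calc p - s = p * (-(s / p) + 1) := by field_simp; ring
        _ ≤ _ := mul_le_mul_of_nonneg_left this hp.le
    refine (pow_le_pow_left₀ (by linarith) h1 _).trans ?_
    rw [mul_pow, ← Real.exp_nat_mul, Nat.cast_sub hj]
    refine le_of_eq ?_
    congr 2
    push_cast; ring
  have e2 : (1 - (p - s)) ^ (n - j)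
      ≤ (1 - p) ^ (n - j) * Real.exp (((n - j : ℕ) : ℝ) * s / (1 - p)) := by
    have h1 : 1 - (p - s) ≤ (1 - p) * Real.exp (s / (1 - p)) := by
      have := Real.add_one_le_exp (s / (1 - p))
      calc 1 - (p - s) = (1 - p) * (s / (1 - p) + 1) := by field_simp; ring
        _ ≤ _ := mul_le_mul_of_nonneg_left this hq.le
    refine (pow_le_pow_left₀ (by linarith) h1 _).trans ?_
    rw [mul_pow, ← Real.exp_nat_mul]
    refine le_of_eq ?_
    congr 2
    ring
  have hexp : Real.exp ((((n - j : ℕ) : ℝ) / (1 - p) - (j - 1) / p) * s)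
      = Real.exp (-((j - 1) * s / p)) * Real.exp (((n - j : ℕ) : ℝ) * s / (1 - p)) := by
    rw [← Real.exp_add]; congr 1; field_simp; ring
  rw [hexp]
  unfold tdens
  have h3 : (0 : ℝ) ≤ j * (n.choose j : ℝ) := by positivity
  have := mul_le_mul e1 e2 (by have : 0 ≤ 1 - (p - s) := by linarith
                               positivity) (by positivity)
  calc (j : ℝ) * (n.choose j : ℝ) * (p - s) ^ (j - 1) * (1 - (p - s)) ^ (n - j)
      = (j * (n.choose j : ℝ)) * ((p - s) ^ (j - 1) * (1 - (p - s)) ^ (n - j)) := by ring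
    _ ≤ _ := mul_le_mul_of_nonneg_left this h3
    _ = _ := by ring

/-- Linear bound for the excess of the average over the left interval. -/
lemma left_excess_lt (n j : ℕ) (hj : 1 ≤ j) (hj' : j ≤ n) {c₀ c₁ w p h : ℝ}
    (hT : IsExpTangent c₀ c₁) (hc₀ : 0 < c₀) (hw : 0 ≤ w) (hwp : w < p) (hp1 : p < 1)
    (hh : h = ((n - j : ℕ) : ℝ) / (1 - p) - (j - 1) / p) (hh0 : 0 < h) :
    lowAvg n j w p - lowTail n j p <
      (p - w) * (c₀ * tdens n j p + c₁ * h * (lowAvg n j w p - lowTail n j p)) := by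
  have hp : 0 < p := by linarith
  set f := tdens n j p with hf
  have hfpos : 0 < f := tdens_pos n j hj hj' hp hp1
  have hexpd : ∀ s : ℝ, HasDerivAt (fun s => Real.exp (h * s)) (h * Real.exp (h * s)) s := by
    intro s
    have := ((hasDerivAt_id s).const_mul h).exp
    simpa [mul_comm] using this
  -- Integrating the density bound once bounds G_j(p - s) - G_j(p); integrating again, in `n2`,
  -- bounds the excess of the average times the length.
  have n1 : ∀ s, 0 ≤ s → s ≤ p - w →
      0 ≤ f * (Real.exp (h * s) - 1) / h - (lowTail n j (p - s) - lowTail n j p) := by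
    intro s hs hs'
    refine nonneg_of_hasDerivAt (d := p - w)
      (f := fun s => f * (Real.exp (h * s) - 1) / h - (lowTail n j (p - s) - lowTail n j p))
      (f' := fun s => f * Real.exp (h * s) - tdens n j (p - s)) (fun x _ _ => ?_) (by simp)
      (fun x hx hx' => ?_) hs hs'
    · have d1 := (((hexpd x).sub_const 1).const_mul f).div_const h
      have d2 := ((hasDerivAt_lowTail n j hj' (p - x)).comp x
        ((hasDerivAt_id x).const_sub p)).sub_const (lowTail n j p)
      refine (d1.sub d2).congr_deriv ?_
      field_simp
    · rw [sub_nonneg, hf, hh]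
      exact tdens_sub_le n j hj hp hp1 hx (by linarith)
  have n2 : 0 ≤ f * (Real.exp (h * (p - w)) - 1 - h * (p - w)) / h ^ 2
      - (lowInt n j p - lowInt n j (p - (p - w)) - lowTail n j p * (p - w)) := by
    refine nonneg_of_hasDerivAt (d := p - w)
      (f := fun s => f * (Real.exp (h * s) - 1 - h * s) / h ^ 2
        - (lowInt n j p - lowInt n j (p - s) - lowTail n j p * s))
      (f' := fun s => f * (Real.exp (h * s) - 1) / h - (lowTail n j (p - s) - lowTail n j p))
      (fun x _ _ => ?_) (by simp) (fun x hx hx' => n1 x hx hx') (by linarith) le_rfl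
    have d1 := ((((hexpd x).sub_const 1).sub ((hasDerivAt_id x).const_mul h)).const_mul f).div_const
      (h ^ 2)
    have d2 := (((hasDerivAt_lowInt n j (by omega) (p - x)).comp x
      ((hasDerivAt_id x).const_sub p)).const_sub (lowInt n j p)).sub
        ((hasDerivAt_id x).const_mul (lowTail n j p))
    refine (d1.sub d2).congr_deriv ?_
    field_simp
  rw [sub_sub_cancel, lowInt_sub_eq n j hwp] at n2
  set A := lowAvg n j w p - lowTail n j p with hA
  have hApos : 0 < A := by
    have := lt_lowAvg n j hj hj' hw hwp hp1.le
    linarith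
  set d := p - w with hd
  have hdpos : 0 < d := by linarith
  have hx : 0 < h * d := by positivity
  have ht := hT (h * d) hx
  have hAd : A * d ≤ f * (Real.exp (h * d) - 1 - h * d) / h ^ 2 := by
    have : A * d = lowAvg n j w p * d - lowTail n j p * d := by rw [hA]; ring
    linarith
  rw [le_div_iff₀ (by positivity)] at hAd
  -- If c₁ h d ≥ 1, the term with c₁ alone dominates the excess; otherwise 1 - c₁ h d is positive
  -- and the tangent inequality at x = h d applies.
  rcases le_or_gt 1 (c₁ * (h * d)) with h1 | h1
  · have : A ≤ d * (c₁ * h * A) := by nlinarith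
    have : 0 < d * (c₀ * f) := by positivity
    nlinarith
  · have e1 : A * d * h ^ 2 * (1 - c₁ * (h * d)) < f * (c₀ * (h * d) ^ 2) := by
      have := mul_le_mul_of_nonneg_right hAd (sub_nonneg.2 h1.le)
      have := mul_lt_mul_of_pos_left ht hfpos
      nlinarith
    have e2 : (d * h ^ 2) * (A * (1 - c₁ * (h * d))) < (d * h ^ 2) * (f * c₀ * d) := by nlinarith
    have := lt_of_mul_lt_mul_left e2 (by positivity)
    nlinarith

end

/-! ### The rescaled drop to the right of a point and its second derivative -/

section

open Set Filter Topology

/-- The constant continuation beyond 1 stays differentiable because the derivative vanishes at 1.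
This lets `rightDrop` be studied on all of [0, ∞). -/
lemma hasDerivAt_comp_min_one {A A' : ℝ → ℝ} (h : ∀ x, HasDerivAt A (A' x) x) (h1 : A' 1 = 0)
    (t : ℝ) : HasDerivAt (fun t => A (min t 1)) (A' (min t 1)) t := by
  rcases lt_trichotomy t 1 with ht | rfl | ht
  · rw [min_eq_left ht.le]
    refine (h t).congr_of_eventuallyEq ?_
    filter_upwards [Iio_mem_nhds ht] with x hx
    rw [min_eq_left (le_of_lt hx)]
  · rw [min_self, h1]
    have h2 := h 1
    rw [h1] at h2
    rw [hasDerivAt_iff_isLittleO] at h2 ⊢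
    have h3 : Tendsto (fun t : ℝ => min t 1) (𝓝 1) (𝓝 1) := by
      have : Continuous fun t : ℝ => min t 1 := by fun_prop
      simpa using this.tendsto 1
    have h4 := h2.comp_tendsto h3
    simp only [Function.comp_def, smul_zero, sub_zero, min_self] at h4 ⊢
    refine h4.trans_isBigO (Asymptotics.isBigO_of_le _ fun x => ?_)
    rw [Real.norm_eq_abs, Real.norm_eq_abs]
    rcases le_total x 1 with hx | hx
    · rw [min_eq_left hx]
    · rw [min_eq_right hx]; simp
  · rw [min_eq_right ht.le, h1]
    refine (hasDerivAt_const t (A 1)).congr_of_eventuallyEq ?_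
    filter_upwards [Ioi_mem_nhds ht] with x hx
    rw [min_eq_right (le_of_lt hx)]

/-- The rescaled binomial weight to the right of the point with odds-mean `l`. -/
noncomputable def tailWeight (j m : ℕ) (l y : ℝ) : ℝ :=
  (1 + y / l) ^ j * (max 0 (1 - y / m)) ^ (m - 1)

lemma tailWeight_antitone (j m : ℕ) {l l' y : ℝ} (hl : 0 < l) (hll : l ≤ l') (hy : 0 ≤ y) :
    tailWeight j m l' y ≤ tailWeight j m l y := by
  have h1 : 0 ≤ 1 + y / l' := by have := hl.trans_le hll; positivity
  have h2 : 1 + y / l' ≤ 1 + y / l := by gcongr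
  have h3 : 0 ≤ max 0 (1 - y / m) := le_max_left _ _
  unfold tailWeight
  exact mul_le_mul_of_nonneg_right (pow_le_pow_left₀ h1 h2 _) (by positivity)

lemma tailWeight_zero (j m : ℕ) (l : ℝ) : tailWeight j m l 0 = 1 := by simp [tailWeight]

/-- Quasiconcavity of the weight times the cube of an affine function. -/
lemma le_tailWeight_mul_cube (j m : ℕ) (hm : 2 ≤ m) {l K c x y z : ℝ} (hl : 0 < l) (hK : 0 ≤ K)
    (hc : 0 < c) (hx : 0 ≤ x) (hxy : x ≤ y) (hyz : y ≤ z)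
    (h1 : c ≤ tailWeight j m l x * (1 + K * x) ^ 3)
    (h2 : c ≤ tailWeight j m l z * (1 + K * z) ^ 3) :
    c ≤ tailWeight j m l y * (1 + K * y) ^ 3 := by
  have hm0 : (0 : ℝ) < m := by have : 0 < m := by omega
                               exact_mod_cast this
  -- Beyond m the truncated weight is zero, which the positive bound c excludes at z.
  have hzm : z < m := by
    by_contra hcon
    have : max 0 (1 - z / m) = 0 := by
      rw [max_eq_left_iff, sub_nonpos, one_le_div hm0]; exact not_lt.1 hcon
    rw [tailWeight, this, zero_pow (by omega)] at h2
    simp at h2; linarith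
  -- The logarithm is a nonnegative combination of logarithms of affine functions, hence concave.
  have hlog : ∀ u : ℝ, 0 ≤ u → u < m → 0 < tailWeight j m l u * (1 + K * u) ^ 3 ∧
      Real.log (tailWeight j m l u * (1 + K * u) ^ 3) = j * Real.log (1 + u / l)
        + ((m - 1 : ℕ) : ℝ) * Real.log (1 - u / m) + 3 * Real.log (1 + K * u) := by
    intro u hu hum
    have p1 : 0 < 1 + u / l := by positivity
    have p2 : 0 < 1 - u / m := by rw [sub_pos, div_lt_one hm0]; exact hum
    have p3 : 0 < 1 + K * u := by positivity
    rw [tailWeight, max_eq_right p2.le]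
    refine ⟨by positivity, ?_⟩
    rw [Real.log_mul (by positivity) (by positivity), Real.log_mul (by positivity) (by positivity),
      Real.log_pow, Real.log_pow, Real.log_pow]
    push_cast; ring
  rcases hxy.eq_or_lt with rfl | hxy'
  · exact h1
  have hxz : 0 < z - x := by linarith
  obtain ⟨a, b, ha, hb, hab, rfl⟩ : ∃ a b : ℝ, 0 ≤ a ∧ 0 ≤ b ∧ a + b = 1 ∧ y = a * x + b * z :=
    ⟨(z - y) / (z - x), (y - x) / (z - x), div_nonneg (by linarith) hxz.le,
      div_nonneg (by linarith) hxz.le, by field_simp; ring, by field_simp; ring⟩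
  have hy0 : 0 ≤ a * x + b * z := hx.trans hxy
  obtain ⟨px, lx⟩ := hlog x hx (by linarith)
  obtain ⟨py, ly⟩ := hlog _ hy0 (by linarith)
  obtain ⟨pz, lz⟩ := hlog z (by linarith) hzm
  rw [← Real.log_le_log_iff hc px, lx] at h1
  rw [← Real.log_le_log_iff hc pz, lz] at h2
  rw [← Real.log_le_log_iff hc py, ly]
  have hconc : ∀ u v : ℝ, 0 < u → 0 < v →
      a * Real.log u + b * Real.log v ≤ Real.log (a * u + b * v) := fun u v hu hv => by
    simpa using strictConcaveOn_log_Ioi.concaveOn.2 hu hv ha hb hab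
  have hz0 : 0 ≤ z := by linarith
  have c1 := hconc (1 + x / l) (1 + z / l) (by positivity) (by positivity)
  have c2 := hconc (1 - x / m) (1 - z / m)
    (by rw [sub_pos, div_lt_one hm0]; linarith) (by rw [sub_pos, div_lt_one hm0]; exact hzm)
  have c3 := hconc (1 + K * x) (1 + K * z) (by positivity) (by positivity)
  have e1 : a * (1 + x / l) + b * (1 + z / l) = 1 + (a * x + b * z) / l := by
    linear_combination hab
  have e2 : a * (1 - x / m) + b * (1 - z / m) = 1 - (a * x + b * z) / m := by
    linear_combination hab
  have e3 : a * (1 + K * x) + b * (1 + K * z) = 1 + K * (a * x + b * z) := by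
    linear_combination hab
  rw [e1] at c1; rw [e2] at c2; rw [e3] at c3
  have k1 := mul_le_mul_of_nonneg_left c1 (Nat.cast_nonneg (α := ℝ) j)
  have k2 := mul_le_mul_of_nonneg_left c2 (Nat.cast_nonneg (α := ℝ) (m - 1))
  have k3 := mul_le_mul_of_nonneg_left h1 ha
  have k4 := mul_le_mul_of_nonneg_left h2 hb
  have k5 : Real.log c = a * Real.log c + b * Real.log c := by rw [← add_mul, hab, one_mul]
  rw [k5]
  nlinarith

section SignPattern

variable {f f' f'' : ℝ → ℝ}

lemma exists_deriv_pos (hd : ∀ x, 0 ≤ x → HasDerivAt f (f' x) x) {a b : ℝ} (ha : 0 ≤ a) (hab : a < b)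
    (h : f a < f b) : ∃ c ∈ Ioo a b, 0 < f' c := by
  obtain ⟨c, hc, e⟩ := exists_hasDerivAt_eq_slope f f' hab
    (fun y hy => (hd y (ha.trans hy.1)).continuousAt.continuousWithinAt)
    fun y hy => hd y (ha.trans hy.1.le)
  exact ⟨c, hc, by rw [e]; exact div_pos (by linarith) (by linarith)⟩

lemma exists_deriv_neg (hd : ∀ x, 0 ≤ x → HasDerivAt f (f' x) x) {a b : ℝ} (ha : 0 ≤ a) (hab : a < b)
    (h : f b < f a) : ∃ c ∈ Ioo a b, f' c < 0 := by
  obtain ⟨c, hc, e⟩ := exists_hasDerivAt_eq_slope f f' hab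
    (fun y hy => (hd y (ha.trans hy.1)).continuousAt.continuousWithinAt)
    fun y hy => hd y (ha.trans hy.1.le)
  exact ⟨c, hc, by rw [e]; exact div_neg_of_neg_of_pos (by linarith) (by linarith)⟩

/-- A dip of f below 0 before b makes f' negative and then positive, hence f'' negative and then
positive. As f'' is also nonnegative at 0, this contradicts that {f'' ≥ 0} is an interval. -/
lemma nonneg_of_second_deriv_pattern (hd : ∀ x, 0 ≤ x → HasDerivAt f (f' x) x)
    (hd' : ∀ x, 0 ≤ x → HasDerivAt f' (f'' x) x) (h0 : f 0 = 0) (h0' : f' 0 = 0)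
    (hq : ∀ x y z, 0 ≤ x → x ≤ y → y ≤ z → 0 ≤ f'' x → 0 ≤ f'' z → 0 ≤ f'' y)
    (h00 : 0 ≤ f'' 0) {y b : ℝ} (hy : 0 ≤ y) (hyb : y ≤ b) (hb : 0 ≤ f b) : 0 ≤ f y := by
  by_contra hcon
  rw [not_le] at hcon
  have hy0 : 0 < y := by
    rcases hy.eq_or_lt with rfl | h
    · linarith
    · exact h
  have hyb' : y < b := by
    rcases hyb.eq_or_lt with rfl | h
    · linarith
    · exact h
  obtain ⟨s₂, hs₂, e₂⟩ := exists_deriv_neg hd le_rfl hy0 (by linarith)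
  obtain ⟨s₃, hs₃, e₃⟩ := exists_deriv_pos hd hy hyb' (by linarith)
  obtain ⟨t₂, ht₂, g₂⟩ := exists_deriv_neg hd' le_rfl hs₂.1 (by linarith)
  obtain ⟨t₃, ht₃, g₃⟩ := exists_deriv_pos hd' hs₂.1.le (hs₂.2.trans hs₃.1) (by linarith)
  exact absurd (hq 0 t₂ t₃ le_rfl ht₂.1.le (ht₂.2.trans ht₃.1).le h00 g₃.le) (not_le.2 g₂)

/-- The same argument, where the positive value at a replaces the sign of f'' at 0: it produces an
earlier point with f'' > 0. -/
lemma nonneg_of_second_deriv_pattern_between (hd : ∀ x, 0 ≤ x → HasDerivAt f (f' x) x)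
    (hd' : ∀ x, 0 ≤ x → HasDerivAt f' (f'' x) x) (h0 : f 0 = 0) (h0' : f' 0 = 0)
    (hq : ∀ x y z, 0 ≤ x → x ≤ y → y ≤ z → 0 ≤ f'' x → 0 ≤ f'' z → 0 ≤ f'' y)
    {a y b : ℝ} (ha : 0 < a) (hfa : 0 < f a) (hy : a ≤ y) (hyb : y ≤ b) (hb : 0 ≤ f b) :
    0 ≤ f y := by
  by_contra hcon
  rw [not_le] at hcon
  have hy0 : a < y := by
    rcases hy.eq_or_lt with rfl | h
    · linarith
    · exact h
  have hyb' : y < b := by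
    rcases hyb.eq_or_lt with rfl | h
    · linarith
    · exact h
  obtain ⟨s₁, hs₁, e₁⟩ := exists_deriv_pos hd le_rfl ha (by linarith)
  obtain ⟨s₂, hs₂, e₂⟩ := exists_deriv_neg hd ha.le hy0 (by linarith)
  obtain ⟨s₃, hs₃, e₃⟩ := exists_deriv_pos hd (ha.le.trans hy) hyb' (by linarith)
  obtain ⟨t₁, ht₁, g₁⟩ := exists_deriv_pos hd' le_rfl hs₁.1 (by linarith)
  obtain ⟨t₂, ht₂, g₂⟩ := exists_deriv_neg hd' hs₁.1.le (hs₁.2.trans hs₂.1) (by linarith)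
  obtain ⟨t₃, ht₃, g₃⟩ := exists_deriv_pos hd' (ha.le.trans hs₂.1.le) (hs₂.2.trans hs₃.1)
    (by linarith)
  exact absurd (hq t₁ t₂ t₃ ht₁.1.le (ht₁.2.trans ht₂.1).le (ht₂.2.trans ht₃.1).le g₁.le g₃.le)
    (not_le.2 g₂)

end SignPattern

/-- The odds-mean `m p / (1 - p)`. -/
noncomputable def oddsMean (m : ℕ) (p : ℝ) : ℝ := m * p / (1 - p)

/-- The integral over `(p, p + (1 - p) y / m)` of the drop of `lowTail (j + m) (j + 1)` below its
value at `p`, rescaled; the function is extended by `0` beyond `1`. -/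
noncomputable def rightDrop (j m : ℕ) (p y : ℝ) : ℝ :=
  (y * lowTail (j + m) (j + 1) p - m / (1 - p) * (lowInt (j + m) (j + 1)
    (min (p + (1 - p) * y / m) 1) - lowInt (j + m) (j + 1) p)) / bpmf (j + m) j p

/-- The derivative of `rightDrop`. -/
noncomputable def rightDrop' (j m : ℕ) (p y : ℝ) : ℝ :=
  (lowTail (j + m) (j + 1) p - lowTail (j + m) (j + 1) (min (p + (1 - p) * y / m) 1))
    / bpmf (j + m) j p

lemma rightDrop_zero (j m : ℕ) {p : ℝ} (hp1 : p < 1) : rightDrop j m p 0 = 0 := by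
  simp [rightDrop, min_eq_left hp1.le]

lemma rightDrop'_zero (j m : ℕ) {p : ℝ} (hp1 : p < 1) : rightDrop' j m p 0 = 0 := by
  simp [rightDrop', min_eq_left hp1.le]

lemma hasDerivAt_affine (m : ℕ) (p y : ℝ) :
    HasDerivAt (fun y : ℝ => p + (1 - p) * y / m) ((1 - p) / m) y := by
  have := (((hasDerivAt_id y).const_mul (1 - p)).div_const (m : ℝ)).const_add p
  simpa using this

lemma hasDerivAt_rightDrop (j m : ℕ) (hm : 1 ≤ m) {p : ℝ} (hp1 : p < 1) (y : ℝ) :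
    HasDerivAt (rightDrop j m p) (rightDrop' j m p y) y := by
  have d1 := hasDerivAt_comp_min_one (fun x => hasDerivAt_lowInt (j + m) (j + 1) (by omega) x)
    (lowTail_at_one (j + m) (j + 1) (by omega)) (p + (1 - p) * y / m)
  have d2 := d1.comp y (hasDerivAt_affine m p y)
  have d3 := (((hasDerivAt_id y).mul_const (lowTail (j + m) (j + 1) p)).sub
    ((d2.sub_const (lowInt (j + m) (j + 1) p)).const_mul ((m : ℝ) / (1 - p)))).div_const
      (bpmf (j + m) j p)
  refine d3.congr_deriv ?_
  have h1 : (1 - p) ≠ 0 := by linarith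
  have h2 : (m : ℝ) ≠ 0 := by positivity
  rw [rightDrop']
  congr 1
  field_simp

lemma hasDerivAt_rightDrop' (j m : ℕ) (hm : 2 ≤ m) {p : ℝ} (hp0 : 0 < p) (hp1 : p < 1) {y : ℝ} :
    HasDerivAt (rightDrop' j m p) (tailWeight j m (oddsMean m p) y) y := by
  -- Here m ≥ 2 is needed: only then does the density vanish at 1, so that G_{j+1} continued by 0 is
  -- differentiable there.
  have h0 : tdens (j + m) (j + 1) 1 = 0 := by
    have : j + m - (j + 1) ≠ 0 := by omega
    simp [tdens, this]
  have d1 := hasDerivAt_comp_min_one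
    (fun x => hasDerivAt_lowTail (j + m) (j + 1) (by omega) x) (by rw [h0, neg_zero])
    (p + (1 - p) * y / m)
  have d2 := d1.comp y (hasDerivAt_affine m p y)
  have d3 := (d2.const_sub (lowTail (j + m) (j + 1) p)).div_const (bpmf (j + m) j p)
  refine d3.congr_deriv ?_
  have h1 : 0 < 1 - p := by linarith
  have h2 : (0 : ℝ) < m := by positivity
  have hpm : bpmf (j + m) j p ≠ 0 := (bpmf_pos _ _ (by omega) hp0 hp1).ne'
  rcases le_or_gt (m : ℝ) y with hy | hy
  · have e1 : max 0 (1 - y / (m : ℝ)) = 0 := by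
      rw [max_eq_left_iff, sub_nonpos, one_le_div h2]; exact hy
    have e2 : min (p + (1 - p) * y / m) 1 = 1 := by
      rw [min_eq_right_iff]
      have : (1 - p) * 1 ≤ (1 - p) * (y / m) :=
        mul_le_mul_of_nonneg_left ((one_le_div h2).2 hy) h1.le
      rw [mul_div_assoc]; linarith
    rw [e2, h0, tailWeight, e1, zero_pow (by omega)]; simp
  · have hym : y / m < 1 := (div_lt_one h2).2 hy
    have e1 : max 0 (1 - y / (m : ℝ)) = 1 - y / m := max_eq_right (by linarith)
    have e2 : min (p + (1 - p) * y / m) 1 = p + (1 - p) * y / m := by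
      rw [min_eq_left_iff, mul_div_assoc]
      have : (1 - p) * (y / m) ≤ (1 - p) * 1 := mul_le_mul_of_nonneg_left hym.le h1.le
      linarith
    rw [e2, tailWeight, e1, neg_mul, neg_neg, div_eq_iff hpm, tdens, bpmf, oddsMean]
    have hch : ((j + m).choose (j + 1) : ℝ) * (j + 1) = (j + m).choose j * m := by
      have := Nat.choose_succ_right_eq (j + m) j
      rw [Nat.add_sub_cancel_left] at this
      exact_mod_cast this
    have f1 : p + (1 - p) * y / m = p * (1 + y / (m * p / (1 - p))) := by
      field_simp
    have f2 : 1 - (p + (1 - p) * y / m) = (1 - p) * (1 - y / m) := by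
      field_simp; ring
    rw [f2, f1]
    have e3 : j + m - (j + 1) = m - 1 := by omega
    have e4 : j + m - j = (m - 1) + 1 := by omega
    rw [e3, e4, Nat.add_sub_cancel, mul_pow, mul_pow, pow_succ (1 - p)]
    push_cast
    set a := (1 + y / (m * p / (1 - p))) ^ j
    set b := (1 - y / (m : ℝ)) ^ (m - 1)
    set c := (1 - p) ^ (m - 1)
    calc ((j : ℝ) + 1) * ((j + m).choose (j + 1) : ℝ) * (p ^ j * a) * (c * b) * ((1 - p) / m)
        = (((j + m).choose (j + 1) : ℝ) * (j + 1)) * ((p ^ j * a) * (c * b) * ((1 - p) / m)) := by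
          ring
      _ = _ := by rw [hch]; field_simp

end

/-! ### From a bound for the right drop to the first-order condition -/

section

open Set Filter Topology

lemma oddsMean_pos {m : ℕ} (hm : 1 ≤ m) {p : ℝ} (hp0 : 0 < p) (hp1 : p < 1) : 0 < oddsMean m p := by
  have h1 : 0 < 1 - p := by linarith
  have h2 : (0 : ℝ) < m := by exact_mod_cast hm
  unfold oddsMean; positivity

/-- The comparison function for `rightDrop`. -/
noncomputable def dropBound (C K y : ℝ) : ℝ := C * y ^ 2 / (1 + K * y)

lemma hasDerivAt_dropBound {C K y : ℝ} (hK : 0 ≤ K) (hy : 0 ≤ y) :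
    HasDerivAt (dropBound C K) (C * (2 * y + K * y ^ 2) / (1 + K * y) ^ 2) y := by
  have h : 1 + K * y ≠ 0 := by positivity
  have d := ((hasDerivAt_pow 2 y).const_mul C).div
    (((hasDerivAt_id y).const_mul K).const_add 1) h
  refine d.congr_deriv ?_
  simp only [id]
  field_simp
  push_cast
  ring

lemma hasDerivAt_dropBound' {C K y : ℝ} (hK : 0 ≤ K) (hy : 0 ≤ y) :
    HasDerivAt (fun y => C * (2 * y + K * y ^ 2) / (1 + K * y) ^ 2) (2 * C / (1 + K * y) ^ 3) y := by
  have h : 1 + K * y ≠ 0 := by positivity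
  have d := ((((hasDerivAt_id y).const_mul 2).add ((hasDerivAt_pow 2 y).const_mul K)).const_mul C).div
    ((((hasDerivAt_id y).const_mul K).const_add 1).fun_pow 2) (pow_ne_zero 2 h)
  refine d.congr_deriv ?_
  simp only [id, Pi.add_apply]
  field_simp
  push_cast
  ring

section Drop

variable {j m : ℕ} {p C K : ℝ}

lemma drop_second_deriv_pattern (hm : 2 ≤ m) (hp0 : 0 < p) (hp1 : p < 1) (hC : 0 < C) (hK : 0 ≤ K) :
    ∀ x y z, 0 ≤ x → x ≤ y → y ≤ z →
      0 ≤ tailWeight j m (oddsMean m p) x - 2 * C / (1 + K * x) ^ 3 →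
      0 ≤ tailWeight j m (oddsMean m p) z - 2 * C / (1 + K * z) ^ 3 →
      0 ≤ tailWeight j m (oddsMean m p) y - 2 * C / (1 + K * y) ^ 3 := by
  intro x y z hx hxy hyz h1 h2
  have e : ∀ u : ℝ, 0 ≤ u → (0 ≤ tailWeight j m (oddsMean m p) u - 2 * C / (1 + K * u) ^ 3 ↔
      2 * C ≤ tailWeight j m (oddsMean m p) u * (1 + K * u) ^ 3) := fun u hu => by
    have : 0 < (1 + K * u) ^ 3 := by positivity
    rw [sub_nonneg, div_le_iff₀ this]
  rw [e y (hx.trans hxy)]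
  rw [e x hx] at h1
  rw [e z (by linarith)] at h2
  exact le_tailWeight_mul_cube j m hm (oddsMean_pos (by omega) hp0 hp1) hK (by linarith) hx hxy hyz
    h1 h2

/-- The weight is 1 at y = 0 and the comparison function has second derivative 2C there, so 2C ≤ 1
gives the sign at 0 that lets the comparison descend from b to all smaller y. -/
lemma dropBound_le_of_half_le (hm : 2 ≤ m) (hp0 : 0 < p) (hp1 : p < 1) (hC : 0 < C) (hK : 0 ≤ K)
    (hC2 : 2 * C ≤ 1) {y b : ℝ} (hy : 0 ≤ y) (hyb : y ≤ b)
    (hb : dropBound C K b ≤ rightDrop j m p b) : dropBound C K y ≤ rightDrop j m p y := by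
  have := nonneg_of_second_deriv_pattern (f := fun y => rightDrop j m p y - dropBound C K y)
    (fun x hx => (hasDerivAt_rightDrop j m (by omega) hp1 x).sub (hasDerivAt_dropBound hK hx))
    (fun x hx => (hasDerivAt_rightDrop' j m hm hp0 hp1).sub (hasDerivAt_dropBound' hK hx))
    (by simp [rightDrop_zero j m hp1, dropBound]) (by simp [rightDrop'_zero j m hp1])
    (drop_second_deriv_pattern hm hp0 hp1 hC hK)
    (by simp [tailWeight_zero]; exact hC2) hy hyb (sub_nonneg.2 hb)
  exact sub_nonneg.1 this

lemma dropBound_le_between (hm : 2 ≤ m) (hp0 : 0 < p) (hp1 : p < 1) (hC : 0 < C) (hK : 0 ≤ K)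
    {a y b : ℝ} (ha0 : 0 < a) (ha : dropBound C K a < rightDrop j m p a) (hy : a ≤ y) (hyb : y ≤ b)
    (hb : dropBound C K b ≤ rightDrop j m p b) : dropBound C K y ≤ rightDrop j m p y := by
  have := nonneg_of_second_deriv_pattern_between
    (f := fun y => rightDrop j m p y - dropBound C K y)
    (fun x hx => (hasDerivAt_rightDrop j m (by omega) hp1 x).sub (hasDerivAt_dropBound hK hx))
    (fun x hx => (hasDerivAt_rightDrop' j m hm hp0 hp1).sub (hasDerivAt_dropBound' hK hx))
    (by simp [rightDrop_zero j m hp1, dropBound]) (by simp [rightDrop'_zero j m hp1])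
    (drop_second_deriv_pattern hm hp0 hp1 hC hK) ha0 (sub_pos.2 ha) hy hyb (sub_nonneg.2 hb)
  exact sub_nonneg.1 this

end Drop

/-- A comparison at the slope of the line `k₀ + k₁ τ`. -/
lemma dropBound_lt_iff {k₀ k₁ τ y r : ℝ} (hk₁ : 0 ≤ k₁) (hy : 0 < y) (hr : r = (1 - τ) * y) :
    dropBound (k₀ + k₁) k₁ y ≤ r ↔ y * (k₀ + k₁ * τ) ≤ 1 - τ := by
  have h : 0 < 1 + k₁ * y := by positivity
  rw [dropBound, div_le_iff₀ h, hr]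
  constructor
  · intro h1
    have : y * (y * (k₀ + k₁ * τ)) ≤ y * (1 - τ) := by nlinarith
    exact le_of_mul_le_mul_left this hy
  · intro h1
    have := mul_le_mul_of_nonneg_left h1 hy.le
    nlinarith

/-- The first-order condition of `lt_of_two_steps` follows from a bound for `rightDrop`. -/
lemma first_order_of_dropBound (j m : ℕ) (hj : 1 ≤ j) (hm : 1 ≤ m) {c₀ c₁ w p v ℓ k₀ k₁ : ℝ}
    (hT : IsExpTangent c₀ c₁) (hc₀ : 0 < c₀) (hc₁ : 0 ≤ c₁) (hw : 0 ≤ w) (hwp : w < p) (hpv : p < v)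
    (hv : v ≤ 1) (h1 : lowAvg (j + m) j w p = ℓ) (h2 : lowAvg (j + m) (j + 1) p v = ℓ)
    (hl : (j : ℝ) - 1 < oddsMean m p) (hk₀ : k₀ = c₀ * j / oddsMean m p)
    (hk₁ : k₁ = c₁ * (1 - (j - 1) / oddsMean m p))
    (hθ : dropBound (k₀ + k₁) k₁ (m * (v - p) / (1 - p)) ≤
      rightDrop j m p (m * (v - p) / (1 - p))) :
    (ℓ - lowTail (j + m) j p) * (v - p) < (lowTail (j + m) (j + 1) p - ℓ) * (p - w) := by
  have hp0 : 0 < p := by linarith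
  have hp1 : p < 1 := by linarith
  have hq : 0 < 1 - p := by linarith
  have hm0 : (0 : ℝ) < m := by exact_mod_cast hm
  have hlp := oddsMean_pos hm hp0 hp1
  set l := oddsMean m p with hldef
  have hpm : 0 < bpmf (j + m) j p := bpmf_pos _ _ (by omega) hp0 hp1
  set P := bpmf (j + m) j p with hP
  set h : ℝ := (m : ℝ) / (1 - p) * (1 - (j - 1) / l) with hh
  have hη : 0 < 1 - (j - 1) / l := by rw [sub_pos, div_lt_one hlp]; exact hl
  have hA := left_excess_lt (j + m) j hj (by omega) (h := h) hT hc₀ hw hwp hp1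
    (by rw [hh, hldef, oddsMean, Nat.add_sub_cancel_left]; field_simp) (by positivity)
  rw [h1] at hA
  have hdens : tdens (j + m) j p = P * (m / (1 - p) * (j / l)) := by
    have e := mul_tdens (j + m) j p
    rw [← hP] at e
    have : P * (m / (1 - p) * (j / l)) = j * P / p := by
      rw [hldef, oddsMean]; field_simp
    rw [this, eq_div_iff hp0.ne', ← e]; ring
  set A := ℓ - lowTail (j + m) j p with hAdef
  have hApos : 0 < A := by
    have := lt_lowAvg (j + m) j hj (by omega) hw hwp hp1.le
    rw [h1] at this; linarith
  set τ := A / P with hτ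
  have hAτ : A = τ * P := by rw [hτ]; field_simp
  have hB : lowTail (j + m) (j + 1) p - ℓ = (1 - τ) * P := by
    rw [lowTail_succ, ← hP]; linear_combination hAdef - hAτ
  set y := (m : ℝ) * (v - p) / (1 - p) with hy
  have hypos : 0 < y := by have : 0 < v - p := by linarith
                           positivity
  -- In the variable y the interval (p, v) has length y, and the mean of G_{j+1} over it is ℓ, which
  -- is (1 - τ) P below G_{j+1}(p).
  have hr : rightDrop j m p y = (1 - τ) * y := by
    have e1 : p + (1 - p) * y / m = v := by rw [hy]; field_simp; ring
    rw [rightDrop, e1, min_eq_left hv, lowInt_sub_eq _ _ hpv, h2, ← hP, div_eq_iff hpm.ne']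
    have : y * lowTail (j + m) (j + 1) p - m / (1 - p) * (ℓ * (v - p))
        = y * (lowTail (j + m) (j + 1) p - ℓ) := by rw [hy]; ring
    rw [this, hB]; ring
  have hk₁0 : 0 ≤ k₁ := by rw [hk₁]; positivity
  rw [dropBound_lt_iff hk₁0 hypos hr] at hθ
  -- The left estimate in rescaled form: τ < d (k₀ + k₁ τ), where d is the rescaled length of (w,
  -- p). Together with y (k₀ + k₁ τ) ≤ 1 - τ it gives τ y < d (1 - τ).
  have hA' : τ < ((m : ℝ) / (1 - p) * (p - w)) * (k₀ + k₁ * τ) := by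
    have e : (p - w) * (c₀ * tdens (j + m) j p + c₁ * h * A)
        = P * (((m : ℝ) / (1 - p) * (p - w)) * (k₀ + k₁ * τ)) := by
      rw [hdens, hAτ, hk₀, hk₁, hh]; ring
    rw [e, hAτ, mul_comm τ P] at hA
    exact lt_of_mul_lt_mul_left hA hpm.le
  rw [hB, hAτ]
  have hd : 0 < (m : ℝ) / (1 - p) * (p - w) := by
    have : 0 < p - w := by linarith
    positivity
  have e3 : τ * (v - p) < (1 - τ) * (p - w) := by
    refine lt_of_mul_lt_mul_left (a := (m : ℝ) / (1 - p)) ?_ (by positivity)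
    calc (m : ℝ) / (1 - p) * (τ * (v - p)) = τ * y := by rw [hy]; ring
      _ < (m : ℝ) / (1 - p) * (p - w) * (k₀ + k₁ * τ) * y := mul_lt_mul_of_pos_right hA' hypos
      _ = (m : ℝ) / (1 - p) * (p - w) * (y * (k₀ + k₁ * τ)) := by ring
      _ ≤ (m : ℝ) / (1 - p) * (p - w) * (1 - τ) := mul_le_mul_of_nonneg_left hθ hd.le
      _ = _ := by ring
  calc τ * P * (v - p) = P * (τ * (v - p)) := by ring
    _ < P * ((1 - τ) * (p - w)) := mul_lt_mul_of_pos_left e3 hpm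
    _ = _ := by ring

end

/-! ### The first-order condition for large odds-mean -/

section

open Set Filter Topology

/-- The derivative of `rightDrop` is nondecreasing and `rightDrop` vanishes at 0, so its ratio to y
is nondecreasing. -/
lemma rightDrop_mul_le (j m : ℕ) (hm : 1 ≤ m) {p a b : ℝ} (hp0 : 0 < p) (hp1 : p < 1) (ha : 0 < a)
    (hab : a ≤ b) : rightDrop j m p a * b ≤ rightDrop j m p b * a := by
  rcases hab.eq_or_lt with rfl | hab
  · rfl
  have hq : 0 < 1 - p := by linarith
  have hm0 : (0 : ℝ) < m := by exact_mod_cast hm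
  obtain ⟨x, hx, e1⟩ := exists_hasDerivAt_eq_slope (rightDrop j m p) (rightDrop' j m p) ha
    (fun y _ => (hasDerivAt_rightDrop j m hm hp1 y).continuousAt.continuousWithinAt)
    fun y _ => hasDerivAt_rightDrop j m hm hp1 y
  obtain ⟨z, hz, e2⟩ := exists_hasDerivAt_eq_slope (rightDrop j m p) (rightDrop' j m p) hab
    (fun y _ => (hasDerivAt_rightDrop j m hm hp1 y).continuousAt.continuousWithinAt)
    fun y _ => hasDerivAt_rightDrop j m hm hp1 y
  have hxz : x < z := hx.2.trans hz.1
  have hmono : rightDrop' j m p x ≤ rightDrop' j m p z := by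
    have hpm := bpmf_pos (j + m) j (by omega) hp0 hp1
    unfold rightDrop'
    refine div_le_div_of_nonneg_right (sub_le_sub_left ?_ _) hpm.le
    have hle : p + (1 - p) * x / m ≤ p + (1 - p) * z / m := by gcongr
    have h0 : ∀ u : ℝ, 0 ≤ u → 0 ≤ p + (1 - p) * u / m := fun u hu => by positivity
    exact (lowTail_strictAntiOn (j + m) (j + 1) (by omega) (by omega)).antitoneOn
      ⟨le_min (h0 x hx.1.le) zero_le_one, min_le_right _ _⟩
      ⟨le_min (h0 z (hx.1.trans hxz).le) zero_le_one, min_le_right _ _⟩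
      (min_le_min_right 1 hle)
  rw [rightDrop_zero j m hp1, sub_zero, sub_zero] at e1
  rw [e1, e2, div_le_div_iff₀ ha (by linarith)] at hmono
  nlinarith

/-- The average of `lowTail (j + 1)` over `(p, (j + 2) p / j)` is at most `lowTail j` at `p`. -/
lemma lowInt_sub_le_of_large (j m : ℕ) (hj : 1 ≤ j) (hm : 1 ≤ m) {p v : ℝ} (hp0 : 0 < p)
    (hp1 : p < 1) (hl : (j : ℝ) + 2 ≤ (j + m + 2) * p) (hv : v = p * (j + 2) / j) :
    lowInt (j + m) (j + 1) (min v 1) - lowInt (j + m) (j + 1) p ≤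
      (v - p) * lowTail (j + m) j p := by
  obtain ⟨i, rfl⟩ : ∃ i, j = i + 1 := ⟨j - 1, by omega⟩
  obtain ⟨q, rfl⟩ : ∃ q, m = q + 1 := ⟨m - 1, by omega⟩
  set n := i + 1 + (q + 1) with hn
  set c : ℝ := (n.choose (i + 1) : ℝ) with hc
  have hc0 : 0 ≤ c := by positivity
  have hi : ((i : ℝ) + 1) ≠ 0 := by positivity
  have hpv : p < v := by
    rw [hv, lt_div_iff₀ (by positivity)]; push_cast; nlinarith
  -- The last summand vanishes at both ends of [p, min v 1]. With v = p (j + 2) / j it makes the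
  -- derivative factor, its sign being that of (j + 2) - (j + m + 2) t on this interval, apart from
  -- zeros.
  set T : ℝ → ℝ := fun t => lowInt n (i + 1 + 1) t + (v - t) * lowTail n (i + 1) t
    + (i + 1) * c / (2 * p) * ((v - t) * (t - p) * (t ^ (i + 1) * (1 - t) ^ (q + 1))) with hT
  have hd : ∀ t, HasDerivAt T (-((i + 1) * c / (2 * p) * (t ^ i * (1 - t) ^ q *
      ((v - t) * (t - p) * ((i + q + 4) * t - (i + 3)))))) t := by
    intro t
    have d1 := hasDerivAt_lowInt n (i + 1 + 1) (by omega) t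
    have d2 := ((hasDerivAt_id t).const_sub v).mul (hasDerivAt_lowTail n (i + 1) (by omega) t)
    have d3 := (hasDerivAt_pow (i + 1) t).mul (((hasDerivAt_id t).const_sub 1).fun_pow (q + 1))
    have d4 := (((hasDerivAt_id t).const_sub v).mul ((hasDerivAt_id t).sub_const p)).mul d3
    refine ((d1.add d2).add (d4.const_mul ((i + 1) * c / (2 * p)))).congr_deriv ?_
    rw [lowTail_succ]
    have e1 : n - (i + 1) = q + 1 := by omega
    simp only [bpmf, tdens, e1, ← hc, id, Nat.add_sub_cancel, Pi.mul_apply]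
    rw [hv]
    push_cast
    field_simp
    ring
  have hanti : AntitoneOn T (Icc p (min v 1)) := by
    refine antitoneOn_of_deriv_nonpos (convex_Icc _ _)
      (fun t _ => (hd t).continuousAt.continuousWithinAt)
      (fun t _ => (hd t).differentiableAt.differentiableWithinAt) fun t ht => ?_
    rw [interior_Icc] at ht
    rw [(hd t).deriv, neg_nonpos]
    have h1 : 0 ≤ v - t := by linarith [ht.2.trans_le (min_le_left v 1)]
    have h2 : 0 ≤ 1 - t := by linarith [ht.2.trans_le (min_le_right v 1)]
    have h3 : 0 ≤ t - p := by linarith [ht.1]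
    have h4 : 0 ≤ t := by linarith [ht.1]
    have h5 : 0 ≤ ((i : ℝ) + q + 4) * t - (i + 3) := by
      push_cast at hl
      have : ((i : ℝ) + q + 4) * p ≤ (i + q + 4) * t :=
        mul_le_mul_of_nonneg_left (by linarith) (by positivity)
      linarith
    positivity
  have hple : p ≤ min v 1 := le_min hpv.le hp1.le
  have := hanti (left_mem_Icc.2 hple) (right_mem_Icc.2 hple) hple
  simp only [hT, sub_self, mul_zero, zero_mul, add_zero] at this
  rcases le_total v 1 with h | h
  · rw [min_eq_left h] at this ⊢
    simp only [sub_self, mul_zero, zero_mul, add_zero] at this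
    linarith
  · rw [min_eq_right h] at this ⊢
    rw [lowTail_at_one n (i + 1) (by omega)] at this
    simp only [sub_self, ne_eq, Nat.add_eq_zero_iff, one_ne_zero, and_false, not_false_eq_true, zero_pow, mul_zero, add_zero] at this
    linarith

lemma lowTail_self (n : ℕ) (p : ℝ) : lowTail n n p = 1 - p ^ n := by
  have h := lowTail_succ n n p
  rw [lowTail_full] at h
  simp [bpmf] at h
  linarith

/-- For m = 1 the lower tail is 1 - p^(j + 1), and Bernoulli's inequality shows that it drops at
least linearly. This replaces the second derivative argument, which needs m ≥ 2. -/
lemma sq_half_le_rightDrop_one (j : ℕ) {p y : ℝ} (hp0 : 0 < p) (hp1 : p < 1) (hy : 0 ≤ y)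
    (hy1 : y ≤ 1) : y ^ 2 / 2 ≤ rightDrop j 1 p y := by
  have hq : 0 < 1 - p := by linarith
  have := nonneg_of_hasDerivAt (d := 1) (f := fun y => rightDrop j 1 p y - y ^ 2 / 2)
    (f' := fun y => rightDrop' j 1 p y - y)
    (fun x _ _ => ((hasDerivAt_rightDrop j 1 le_rfl hp1 x).sub
      ((hasDerivAt_pow 2 x).div_const 2)).congr_deriv (by push_cast; ring))
    (by simp [rightDrop_zero j 1 hp1]) (fun x hx hx1 => ?_) hy hy1
  · exact sub_nonneg.1 this
  · rw [sub_nonneg, rightDrop', le_div_iff₀ (bpmf_pos _ _ (by omega) hp0 hp1)]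
    have ht : min (p + (1 - p) * x / (1 : ℕ)) 1 = p + (1 - p) * x := by
      rw [Nat.cast_one, div_one, min_eq_left]; nlinarith
    rw [ht, lowTail_self, lowTail_self]
    have hB := one_add_mul_le_pow (a := (1 - p) * x / p) (by
      have : 0 ≤ (1 - p) * x / p := by positivity
      linarith) (j + 1)
    have e : (p + (1 - p) * x) ^ (j + 1) = p ^ (j + 1) * (1 + (1 - p) * x / p) ^ (j + 1) := by
      rw [← mul_pow]; congr 1; field_simp
    have := mul_le_mul_of_nonneg_left hB (pow_pos hp0 (j + 1)).le
    rw [e]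
    have e2 : j + 1 - j = 1 := by omega
    have e3 : (j + 1).choose j = j + 1 := by simp
    rw [bpmf, e2, e3]
    have e4 : p ^ (j + 1) * (1 + ((j + 1 : ℕ) : ℝ) * ((1 - p) * x / p))
        = p ^ (j + 1) + x * (((j + 1 : ℕ) : ℝ) * p ^ j * (1 - p) ^ 1) := by
      field_simp
      ring
    linarith

/-- The first-order condition holds when the odds-mean is at least `j + 2`. -/
lemma first_order_of_large (j m : ℕ) (hj : 1 ≤ j) (hm : 1 ≤ m) {w p v ℓ : ℝ} (hw : 0 ≤ w)
    (hwp : w < p) (hpv : p < v) (hv : v ≤ 1) (h1 : lowAvg (j + m) j w p = ℓ)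
    (h2 : lowAvg (j + m) (j + 1) p v = ℓ) (hl : (j : ℝ) + 2 ≤ oddsMean m p) :
    (ℓ - lowTail (j + m) j p) * (v - p) < (lowTail (j + m) (j + 1) p - ℓ) * (p - w) := by
  have hp0 : 0 < p := by linarith
  have hp1 : p < 1 := by linarith
  have hq : 0 < 1 - p := by linarith
  have hm0 : (0 : ℝ) < m := by exact_mod_cast hm
  have hj0 : (0 : ℝ) < j := by exact_mod_cast hj
  have hlp := oddsMean_pos hm hp0 hp1
  refine first_order_of_dropBound j m hj hm isExpTangent_one_third (by norm_num) (by norm_num) hw hwp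
    hpv hv h1 h2 (by linarith) rfl rfl ?_
  set l := oddsMean m p with hldef
  set k₀ := 1 / 2 * (j : ℝ) / l with hk₀
  set k₁ := 1 / 3 * (1 - ((j : ℝ) - 1) / l) with hk₁
  have hk₀0 : 0 < k₀ := by positivity
  have hk₁0 : 0 ≤ k₁ := by
    have : ((j : ℝ) - 1) / l ≤ 1 := by rw [div_le_one hlp]; linarith
    rw [hk₁]; linarith
  -- For the tangent (1 / 2, 1 / 3) this is equivalent to l ≥ j + 2.
  have hC : 2 * (k₀ + k₁) ≤ 1 := by
    have : k₀ + k₁ = 1 / 3 + ((j : ℝ) + 2) / (6 * l) := by rw [hk₀, hk₁]; field_simp; ring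
    rw [this]
    have : ((j : ℝ) + 2) / (6 * l) ≤ 1 / 6 := by
      rw [div_le_iff₀ (by positivity)]; linarith
    linarith
  set y := (m : ℝ) * (v - p) / (1 - p) with hy
  have hypos : 0 < y := by have : 0 < v - p := by linarith
                           positivity
  rcases hm.eq_or_lt with rfl | hm2
  · have hy1 : y ≤ 1 := by
      rw [hy, div_le_one hq, Nat.cast_one]; linarith
    refine le_trans ?_ (sq_half_le_rightDrop_one j hp0 hp1 hypos.le hy1)
    rw [dropBound, div_le_iff₀ (by positivity)]
    have : 0 ≤ k₁ * y * y ^ 2 := by positivity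
    nlinarith [sq_nonneg y]
  -- The point with k₀ b = 1, where the comparison function is at most b. It corresponds to the
  -- right end p (j + 2) / j, where `lowInt_sub_le_of_large` gives a drop of at least b.
  · set b := 2 * l / j with hb
    have hb0 : 0 < b := by positivity
    have hpm : 0 < bpmf (j + m) j p := bpmf_pos _ _ (by omega) hp0 hp1
    have hE : b ≤ rightDrop j m p b := by
      have e1 : p + (1 - p) * b / m = p * (j + 2) / j := by
        rw [hb, hldef, oddsMean]; field_simp
      have hl' : (j : ℝ) + 2 ≤ (j + m + 2) * p := by
        rw [hldef, oddsMean, le_div_iff₀ hq] at hl; linarith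
      have := lowInt_sub_le_of_large j m hj hm hp0 hp1 hl' rfl
      rw [rightDrop, le_div_iff₀ hpm, e1]
      have e2 : b = m / (1 - p) * (p * (j + 2) / j - p) := by
        rw [hb, hldef, oddsMean]; field_simp; ring
      have h3 := mul_le_mul_of_nonneg_left this (by positivity : 0 ≤ (m : ℝ) / (1 - p))
      have h4 : (m : ℝ) / (1 - p) * ((p * (j + 2) / j - p) * lowTail (j + m) j p)
          = b * lowTail (j + m) j p := by rw [e2]; ring
      rw [lowTail_succ, mul_add]
      linarith
    -- The ratio of `rightDrop` to y is below 1 at y and at least 1 at b, and it is nondecreasing.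
    have hyb : y ≤ b := by
      by_contra hcon
      have h5 := rightDrop_mul_le j m hm hp0 hp1 hb0 (not_le.1 hcon).le
      have e1 : p + (1 - p) * y / m = v := by rw [hy]; field_simp; ring
      have h6 : rightDrop j m p y < y := by
        rw [rightDrop, e1, min_eq_left hv, lowInt_sub_eq _ _ hpv, h2, div_lt_iff₀ hpm]
        have h7 := lt_lowAvg (j + m) j hj (by omega) hw hwp hp1.le
        rw [h1] at h7
        have h8 := lowTail_succ (j + m) j p
        have : m / (1 - p) * (ℓ * (v - p)) = y * ℓ := by rw [hy]; ring
        rw [this, ← mul_sub]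
        exact mul_lt_mul_of_pos_left (by linarith) hypos
      nlinarith
    refine dropBound_le_of_half_le hm2 hp0 hp1 (by positivity) hk₁0 hC hypos.le hyb ?_
    refine le_trans ?_ hE
    rw [dropBound, div_le_iff₀ (by positivity)]
    have : k₀ * b = 1 := by rw [hk₀, hb]; field_simp
    nlinarith

end

/-! ### Exact integer arithmetic for binomial tails on a grid -/

/-- Accumulates the terms `n.choose i * a ^ i * b ^ (n - i)`, for `x ≤ i < x + k`, onto `acc`, when
`t` is the term with index `x`. -/
def binSum (n a b k : ℕ) : ℕ → ℕ → ℕ → ℕ :=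
  Nat.rec (motive := fun _ => ℕ → ℕ → ℕ → ℕ) (fun _ _ acc => acc)
    (fun _ ih x t acc => ih (Nat.succ x)
      (Nat.div (Nat.mul t (Nat.mul (Nat.sub n x) a)) (Nat.mul (Nat.succ x) b)) (Nat.add acc t)) k

/-- `(a + b) ^ n` times the value of `lowTail n j` at `a / (a + b)`. -/
def tailNum (n j a b : ℕ) : ℕ := binSum n a b j 0 (Nat.pow b n) 0

/-- The binomial coefficient, computed by its multiplicative formula. -/
def chooseNum (n j : ℕ) : ℕ :=
  Nat.rec (motive := fun _ => ℕ) 1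
    (fun i ih => Nat.div (Nat.mul ih (Nat.sub n i)) (Nat.succ i)) j

/-- `(a + b) ^ n` times the value of `bpmf n j` at `a / (a + b)`. -/
def massNum (n j a b : ℕ) : ℕ :=
  Nat.mul (chooseNum n j) (Nat.mul (Nat.pow a j) (Nat.pow b (Nat.sub n j)))

/-- The denominator of the grid of rational points. -/
def gridDen : ℕ := 131072

/-- `gridTail n j t` is `gridDen ^ n` times the value of `lowTail n j` at `t / gridDen`. -/
def gridTail (n j t : ℕ) : ℕ :=
  cond (Bool.and (Nat.ble 1 t) (Nat.ble n (Nat.add j j)))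
    (Nat.sub (Nat.pow gridDen n) (tailNum n (Nat.sub (Nat.succ n) j) (Nat.sub gridDen t) t))
    (tailNum n j t (Nat.sub gridDen t))

/-- `gridMass n j t` is `gridDen ^ n` times the value of `bpmf n j` at `t / gridDen`. -/
def gridMass (n j t : ℕ) : ℕ := massNum n j t (Nat.sub gridDen t)

/-- `gridSum n j t` is `(j - (n + 1) * lowInt n j (min (t / gridDen) 1)) * gridDen ^ (n + 1)`. -/
def gridSum (n j t : ℕ) : ℕ :=
  cond (Nat.ble gridDen t) 0
    (Nat.sub (Nat.mul j (Nat.add (Nat.mul gridDen (gridTail n j t))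
      (Nat.mul (Nat.sub gridDen t) (gridMass n j t))))
      (Nat.mul (Nat.mul (Nat.succ n) t) (gridTail n j t)))

lemma binSum_succ (n a b k x t acc : ℕ) : binSum n a b (k + 1) x t acc =
    binSum n a b k (x + 1) (t * ((n - x) * a) / ((x + 1) * b)) (acc + t) := rfl

lemma binTerm_step (n a x : ℕ) {b : ℕ} (hb : 0 < b) :
    n.choose x * a ^ x * b ^ (n - x) * ((n - x) * a) / ((x + 1) * b)
      = n.choose (x + 1) * a ^ (x + 1) * b ^ (n - (x + 1)) := by
  rcases lt_or_ge x n with h | h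
  · refine Nat.div_eq_of_eq_mul_left (by positivity) ?_
    have h1 := Nat.choose_succ_right_eq n x
    have h2 : b ^ (n - x) = b ^ (n - (x + 1)) * b := by
      rw [← pow_succ]; congr 1; omega
    calc _ = (n.choose x * (n - x)) * a ^ (x + 1) * b ^ (n - x) := by ring
      _ = _ := by rw [← h1, h2]; ring
  · rw [Nat.sub_eq_zero_of_le h, Nat.choose_eq_zero_of_lt (by omega : n < x + 1)]; simp

lemma binSum_eq (n a : ℕ) {b : ℕ} (hb : 0 < b) (k : ℕ) : ∀ x acc,
    binSum n a b k x (n.choose x * a ^ x * b ^ (n - x)) acc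
      = acc + ∑ i ∈ Finset.range k, n.choose (x + i) * a ^ (x + i) * b ^ (n - (x + i)) := by
  induction k with
  | zero => intro x acc; rfl
  | succ k ih =>
    intro x acc
    rw [binSum_succ, binTerm_step n a x hb, ih, Finset.sum_range_succ', add_zero, add_comm (∑ i ∈ _, _),
      ← add_assoc]
    congr 1
    exact Finset.sum_congr rfl fun i _ => by rw [show x + 1 + i = x + (i + 1) by ring]

lemma tailNum_eq (n j a : ℕ) {b : ℕ} (hb : 0 < b) :
    tailNum n j a b = ∑ x ∈ Finset.range j, n.choose x * a ^ x * b ^ (n - x) := by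
  have := binSum_eq n a hb j 0 0
  simp only [Nat.choose_zero_right, pow_zero, mul_one, one_mul, Nat.sub_zero, zero_add] at this
  exact this

/-- The symmetry X ↦ n - X. It lets `gridTail` sum whichever tail is shorter. -/
lemma tailNum_add (n j a b : ℕ) (ha : 0 < a) (hb : 0 < b) (hj : j ≤ n + 1) :
    tailNum n j a b + tailNum n (n + 1 - j) b a = (a + b) ^ n := by
  rw [tailNum_eq n j a hb, tailNum_eq n _ b ha, add_pow, ← Finset.sum_range_add_sum_Ico _ hj,
    Finset.range_eq_Ico, Finset.sum_Ico_eq_sum_range _ j (n + 1),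
    ← Finset.sum_range_reflect _ (n + 1 - j)]
  congr 1
  · exact Finset.sum_congr rfl fun x _ => by rw [Nat.cast_id]; ring
  · refine Finset.sum_congr rfl fun x hx => ?_
    have hx := Finset.mem_range.1 hx
    have e : n + 1 - j - 1 - x = n - (j + x) := by omega
    rw [e, Nat.choose_symm (by omega), Nat.sub_sub_self (by omega), Nat.cast_id]
    ring

lemma chooseNum_eq (n j : ℕ) : chooseNum n j = n.choose j := by
  induction j with
  | zero => simp [chooseNum]
  | succ j ih =>
    have e : chooseNum n (j + 1) = chooseNum n j * (n - j) / (j + 1) := rfl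
    rw [e, ih, ← Nat.choose_succ_right_eq, Nat.mul_div_cancel _ (by omega)]

/-- A closed form of the antiderivative by one tail and one probability, which makes `gridSum`
cheap. Both sides vanish at 0 and have equal derivatives. -/
lemma lowInt_eq (n j : ℕ) (hj : 1 ≤ j) (hj' : j ≤ n) (p : ℝ) : (n + 1) * lowInt n j p =
    (n + 1) * (p * lowTail n j p) + j * (1 - lowTail n j p) - (1 - p) * (j * bpmf n j p) := by
  set F : ℝ → ℝ := fun p => (n + 1) * (p * lowTail n j p) + j * (1 - lowTail n j p)
    - (1 - p) * (j * bpmf n j p) - (n + 1) * lowInt n j p with hF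
  have hd : ∀ x, HasDerivAt F 0 x := by
    intro x
    have d1 := hasDerivAt_lowTail n j hj' x
    have d2 := hasDerivAt_bpmf n j x
    have d3 := hasDerivAt_lowInt n j (by omega) x
    refine (((((hasDerivAt_id x).mul d1).const_mul ((n : ℝ) + 1)).add
      ((d1.const_sub 1).const_mul (j : ℝ))).sub (((hasDerivAt_id x).const_sub 1).mul
      (d2.const_mul (j : ℝ))) |>.sub (d3.const_mul ((n : ℝ) + 1))).congr_deriv ?_
    have e1 := mul_tdens n j x
    have e2 : (1 - x) * tdens n (j + 1) x = (n - j) * bpmf n j x := by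
      rcases hj'.lt_or_eq with h | rfl
      · exact one_sub_mul_tdens n j h x
      · simp [tdens]
    simp only [id]
    linear_combination (-(n + 1 : ℝ) + j) * e1 + j * e2
  have h0 : F 0 = 0 := by
    have : bpmf n j 0 = 0 := by rw [bpmf, zero_pow (by omega)]; ring
    simp [hF, lowTail_at_zero n j hj, lowInt_at_zero, this]
  have := is_const_of_deriv_eq_zero (fun x => (hd x).differentiableAt) (fun x => (hd x).deriv) p 0
  rw [h0] at this
  linarith

lemma lowInt_le (n j : ℕ) {p : ℝ} (hp : 0 ≤ p) (hp1 : p ≤ 1) : (n + 1) * lowInt n j p ≤ j := by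
  have h0 : (n : ℝ) + 1 ≠ 0 := by positivity
  rw [lowInt, mul_div_cancel₀ _ h0]
  calc _ ≤ ∑ i ∈ Finset.range j, (1 : ℝ) := Finset.sum_le_sum fun i _ => by
        linarith [lowTail_nonneg (n + 1) (i + 1) hp hp1]
    _ = j := by simp

lemma cast_tailNum {a b D : ℕ} (hb : 0 < b) (hD : a + b = D) (n j : ℕ) (hj : j ≤ n + 1) :
    (tailNum n j a b : ℝ) = lowTail n j ((a : ℝ) / D) * (D : ℝ) ^ n := by
  have hD0 : (D : ℝ) ≠ 0 := by have : 0 < D := by omega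
                               positivity
  have e : 1 - (a : ℝ) / D = b / D := by rw [← hD] at hD0 ⊢; push_cast at hD0 ⊢; field_simp; ring
  rw [tailNum_eq n j a hb, lowTail, Finset.sum_mul]
  push_cast
  refine Finset.sum_congr rfl fun x hx => ?_
  have hx : x ≤ n := by have := Finset.mem_range.1 hx; omega
  rw [e, div_pow, div_pow]
  have : (D : ℝ) ^ n = (D : ℝ) ^ x * (D : ℝ) ^ (n - x) := by rw [← pow_add]; congr 1; omega
  rw [this]
  field_simp

lemma cast_massNum {a b D : ℕ} (hb : 0 < b) (hD : a + b = D) (n j : ℕ) (hj : j ≤ n) :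
    (massNum n j a b : ℝ) = bpmf n j ((a : ℝ) / D) * (D : ℝ) ^ n := by
  have hD0 : (D : ℝ) ≠ 0 := by have : 0 < D := by omega
                               positivity
  have e : 1 - (a : ℝ) / D = b / D := by rw [← hD] at hD0 ⊢; push_cast at hD0 ⊢; field_simp; ring
  have e0 : massNum n j a b = n.choose j * (a ^ j * b ^ (n - j)) := by
    rw [← chooseNum_eq]; rfl
  rw [e0, bpmf, e, div_pow, div_pow]
  have : (D : ℝ) ^ n = (D : ℝ) ^ j * (D : ℝ) ^ (n - j) := by rw [← pow_add]; congr 1; omega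
  push_cast
  rw [this]
  field_simp

lemma gridDen_pos : (0 : ℝ) < gridDen := by norm_num [gridDen]

lemma cast_gridTail (n j : ℕ) (hj : j ≤ n + 1) {t : ℕ} (ht : t < gridDen) :
    (gridTail n j t : ℝ) = lowTail n j ((t : ℝ) / gridDen) * (gridDen : ℝ) ^ n := by
  rw [← cast_tailNum (Nat.sub_pos_of_lt ht) (Nat.add_sub_cancel' ht.le) n j hj, Nat.cast_inj]
  rcases hc : Bool.and (Nat.ble 1 t) (Nat.ble n (Nat.add j j)) with _ | _
  · rw [gridTail, hc, cond_false]; rfl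
  · rw [gridTail, hc, cond_true]
    have h1 : 0 < t := by
      rw [Bool.and_eq_true, Nat.ble_eq] at hc; exact hc.1
    have := tailNum_add n j t (gridDen - t) h1 (Nat.sub_pos_of_lt ht) hj
    rw [Nat.add_sub_cancel' ht.le] at this
    exact Nat.sub_eq_of_eq_add this.symm

lemma cast_gridMass (n j : ℕ) (hj : j ≤ n) {t : ℕ} (ht : t < gridDen) :
    (gridMass n j t : ℝ) = bpmf n j ((t : ℝ) / gridDen) * (gridDen : ℝ) ^ n :=
  cast_massNum (Nat.sub_pos_of_lt ht) (Nat.add_sub_cancel' ht.le) n j hj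

lemma cast_gridSum (n j : ℕ) (hj : 1 ≤ j) (hj' : j ≤ n) (t : ℕ) :
    (gridSum n j t : ℝ) =
      (j - (n + 1) * lowInt n j (min ((t : ℝ) / gridDen) 1)) * (gridDen : ℝ) ^ (n + 1) := by
  have h0 : (n : ℝ) + 1 ≠ 0 := by positivity
  rcases le_or_gt gridDen t with h | h
  · have e : gridSum n j t = 0 := by
      have : Nat.ble gridDen t = true := by rw [Nat.ble_eq]; exact h
      simp only [gridSum, this, cond_true]
    have h1 : 1 ≤ (t : ℝ) / gridDen := by
      rw [le_div_iff₀ gridDen_pos, one_mul]; exact_mod_cast h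
    rw [e, min_eq_right h1, lowInt_at_one n j (by omega), mul_div_cancel₀ _ h0]
    simp
  · have hb : Nat.ble gridDen t = false := by
      rw [Bool.eq_false_iff, ne_eq, Nat.ble_eq]; omega
    have e : gridSum n j t = j * (gridDen * gridTail n j t + (gridDen - t) * gridMass n j t)
        - (n + 1) * t * gridTail n j t := by
      simp only [gridSum, hb, cond_false]; rfl
    have h1 : (t : ℝ) / gridDen ≤ 1 := by
      rw [div_le_one gridDen_pos]; exact_mod_cast h.le
    have h2 : 0 ≤ (t : ℝ) / gridDen := by have := gridDen_pos; positivity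
    rw [min_eq_left h1]
    have key : (j - (n + 1) * lowInt n j ((t : ℝ) / gridDen)) * (gridDen : ℝ) ^ (n + 1) =
        j * (gridDen * gridTail n j t + (gridDen - t) * gridMass n j t)
          - (n + 1) * t * gridTail n j t := by
      rw [lowInt_eq n j hj hj', cast_gridTail n j (by omega) h, cast_gridMass n j hj' h]
      have := gridDen_pos.ne'
      field_simp
      ring
    -- The subtraction of natural numbers in `gridSum` does not truncate, because (n + 1) `lowInt` ≤
    -- j.
    have key2 : (n + 1) * t * gridTail n j t ≤
        j * (gridDen * gridTail n j t + (gridDen - t) * gridMass n j t) := by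
      have h3 : 0 ≤ (j - (n + 1) * lowInt n j ((t : ℝ) / gridDen)) * (gridDen : ℝ) ^ (n + 1) :=
        mul_nonneg (by linarith [lowInt_le n j h2 h1]) (by positivity)
      rw [key] at h3
      have h4 : (((n + 1) * t * gridTail n j t : ℕ) : ℝ) ≤
          ((j * (gridDen * gridTail n j t + (gridDen - t) * gridMass n j t) : ℕ) : ℝ) := by
        push_cast [Nat.cast_sub h.le]; linarith
      exact_mod_cast h4
    rw [e, key, Nat.cast_sub key2]
    push_cast [Nat.cast_sub h.le]
    ring

/-! ### Anchors for the right drop -/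

section

open Set Filter Topology

lemma oddsMean_le {m : ℕ} {p q : ℝ} (hpq : p ≤ q) (hq : q < 1) :
    oddsMean m p ≤ oddsMean m q := by
  unfold oddsMean
  have : 0 < 1 - q := by linarith
  rw [div_le_div_iff₀ (by linarith) this]
  have : (0 : ℝ) ≤ m := by positivity
  nlinarith

/-- The second derivative `tailWeight` depends on p only through the odds-mean, and decreases in it.
Hence a value computed at the right end of a cell bounds the whole cell from below. -/
lemma rightDrop_antitone (j m : ℕ) (hm : 2 ≤ m) {p q y : ℝ} (hp : 0 < p) (hpq : p ≤ q) (hq : q < 1)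
    (hy : 0 ≤ y) : rightDrop j m q y ≤ rightDrop j m p y := by
  have hp1 : p < 1 := by linarith
  have hq0 : 0 < q := by linarith
  have h' : ∀ x, 0 ≤ x → x ≤ y → 0 ≤ rightDrop' j m p x - rightDrop' j m q x := fun x hx hxy =>
    nonneg_of_hasDerivAt (f := fun x => rightDrop' j m p x - rightDrop' j m q x)
      (fun z _ _ => (hasDerivAt_rightDrop' j m hm hp hp1).sub (hasDerivAt_rightDrop' j m hm hq0 hq))
      (by simp [rightDrop'_zero j m hp1, rightDrop'_zero j m hq])
      (fun z hz _ => sub_nonneg.2 (tailWeight_antitone j m (oddsMean_pos (by omega) hp hp1)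
        (oddsMean_le hpq hq) hz)) hx hxy
  exact sub_nonneg.1 (nonneg_of_hasDerivAt (f := fun x => rightDrop j m p x - rightDrop j m q x)
    (fun z _ _ => (hasDerivAt_rightDrop j m (by omega) hp1 z).sub
      (hasDerivAt_rightDrop j m (by omega) hq z))
    (by simp [rightDrop_zero j m hp1, rightDrop_zero j m hq]) h' hy le_rfl)

/-- There is a `y` at which `rightDrop j m q` exceeds `(1 - τ) y`, and which is small enough for the
line with the slopes of the tangent `(c₀, c₁)` at all points of `[p, q]`. -/
def IsDropAnchor (j m : ℕ) (c₀ c₁ p q τ : ℝ) : Prop :=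
  ∃ y, 0 < y ∧ y * (c₀ * j + c₁ * (oddsMean m p - (j - 1)) * τ) ≤ oddsMean m p * (1 - τ) ∧
    (1 - τ) * y < rightDrop j m q y

/-- Collecting the terms with the odds-mean l, the first inequality reads y (c₀ j - c₁ (j - 1) τ) ≤
l (1 - τ - c₁ y τ). The left side is nonnegative, so it persists when l grows. -/
lemma IsDropAnchor.mono {j m : ℕ} (hm : 2 ≤ m) {c₀ c₁ p q r τ : ℝ} (hc₁ : 0 ≤ c₁)
    (hc : c₁ ≤ c₀) (hp : 0 < p) (hpr : p ≤ r) (hrq : r ≤ q) (hq : q < 1) (hτ0 : 0 ≤ τ)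
    (hτ1 : τ ≤ 1) (h : IsDropAnchor j m c₀ c₁ p q τ) : IsDropAnchor j m c₀ c₁ r r τ := by
  obtain ⟨y, hy, h1, h2⟩ := h
  refine ⟨y, hy, ?_, h2.trans_le (rightDrop_antitone j m hm (by linarith) hrq hq hy.le)⟩
  have hl := oddsMean_le (m := m) hpr (by linarith)
  have hlp := oddsMean_pos (m := m) (by omega) hp (by linarith)
  set l := oddsMean m p
  set l' := oddsMean m r
  have hj : (0 : ℝ) ≤ j := by positivity
  have e : 0 ≤ y * (c₀ * j - c₁ * (j - 1) * τ) := by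
    refine mul_nonneg hy.le ?_
    have : c₁ * ((j - 1) * τ) ≤ c₁ * j := mul_le_mul_of_nonneg_left (by nlinarith) hc₁
    nlinarith
  have e2 : 0 ≤ l * (1 - τ - c₁ * y * τ) := by nlinarith
  have e3 : 0 ≤ 1 - τ - c₁ * y * τ := nonneg_of_mul_nonneg_right e2 hlp
  nlinarith [mul_le_mul_of_nonneg_right hl e3]

/-- The first-order condition from anchors at both ends of a range of `τ`, or from an anchor at its
lower end if the slopes of the line are small. -/
lemma first_order_of_anchor (j m : ℕ) (hj : 1 ≤ j) (hm : 2 ≤ m) {c₀ c₁ w p v ℓ τ₀ τ₁ a b : ℝ}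
    (hT : IsExpTangent c₀ c₁) (hc₁ : 0 < c₁) (hc : c₁ ≤ c₀) (hc₁' : 2 * c₁ ≤ 1) (hw : 0 ≤ w)
    (hwp : w < p)
    (hpv : p < v) (hv : v ≤ 1) (h1 : lowAvg (j + m) j w p = ℓ) (h2 : lowAvg (j + m) (j + 1) p v = ℓ)
    (ha : 0 < a) (hap : a ≤ p) (hpb : p ≤ b) (hb : b < 1) (hl : (j : ℝ) - 1 < oddsMean m a)
    (hτ₀ : 0 ≤ τ₀) (hτ₀' : τ₀ ≤ 1) (hτ : τ₀ * bpmf (j + m) j p ≤ ℓ - lowTail (j + m) j p)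
    (hA : IsDropAnchor j m c₀ c₁ a b τ₀)
    (hB : 2 * (c₀ * j - c₁ * (j - 1)) ≤ oddsMean m a * (1 - 2 * c₁) ∨
      τ₁ ≤ 1 ∧ ℓ - lowTail (j + m) j p ≤ τ₁ * bpmf (j + m) j p ∧ IsDropAnchor j m c₀ c₁ a b τ₁) :
    (ℓ - lowTail (j + m) j p) * (v - p) < (lowTail (j + m) (j + 1) p - ℓ) * (p - w) := by
  have hp0 : 0 < p := by linarith
  have hp1 : p < 1 := by linarith
  have hq : 0 < 1 - p := by linarith
  have hc₀ : 0 < c₀ := by linarith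
  have hm0 : (0 : ℝ) < m := by have : 0 < m := by omega
                               exact_mod_cast this
  have hj0 : (1 : ℝ) ≤ j := by exact_mod_cast hj
  have hla := oddsMean_pos (m := m) (by omega) ha (by linarith)
  have hlp := oddsMean_pos (m := m) (by omega) hp0 hp1
  have hle : oddsMean m a ≤ oddsMean m p := oddsMean_le hap hp1
  refine first_order_of_dropBound j m hj (by omega) hT hc₀ hc₁.le hw hwp hpv hv h1 h2
    (by linarith) rfl rfl ?_
  have hpm : 0 < bpmf (j + m) j p := bpmf_pos _ _ (by omega) hp0 hp1
  set P := bpmf (j + m) j p with hP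
  set τ := (ℓ - lowTail (j + m) j p) / P with hτdef
  have hAτ : ℓ - lowTail (j + m) j p = τ * P := by rw [hτdef]; field_simp
  have hτ0 : τ₀ ≤ τ := by rw [hτdef, le_div_iff₀ hpm]; exact hτ
  set y := (m : ℝ) * (v - p) / (1 - p) with hy
  have hypos : 0 < y := by have : 0 < v - p := by linarith
                           positivity
  have hr : rightDrop j m p y = (1 - τ) * y := by
    have e1 : p + (1 - p) * y / m = v := by rw [hy]; field_simp; ring
    rw [rightDrop, e1, min_eq_left hv, lowInt_sub_eq _ _ hpv, h2, ← hP, div_eq_iff hpm.ne']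
    have : y * lowTail (j + m) (j + 1) p - m / (1 - p) * (ℓ * (v - p))
        = y * (lowTail (j + m) (j + 1) p - ℓ) := by rw [hy]; ring
    rw [this, lowTail_succ, ← hP]
    linear_combination -y * hAτ
  set l := oddsMean m p with hldef
  set k₀ := c₀ * j / l with hk₀
  set k₁ := c₁ * (1 - (j - 1) / l) with hk₁
  have hk₀0 : 0 < k₀ := by positivity
  have hk₁0 : 0 < k₁ := by
    have : ((j : ℝ) - 1) / l < 1 := by rw [div_lt_one hlp]; linarith
    have : 0 < 1 - ((j : ℝ) - 1) / l := by linarith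
    positivity
  have line : ∀ {t z : ℝ}, z * (c₀ * j + c₁ * (l - (j - 1)) * t) ≤ l * (1 - t) →
      z * (k₀ + k₁ * t) ≤ 1 - t := fun {t z} h => by
    have e : z * (k₀ + k₁ * t) = z * (c₀ * j + c₁ * (l - (j - 1)) * t) / l := by
      rw [hk₀, hk₁]; field_simp
    rw [e, div_le_iff₀ hlp]; linarith
  have bound : ∀ {t z : ℝ}, 0 < z → z * (k₀ + k₁ * t) ≤ 1 - t →
      dropBound (k₀ + k₁) k₁ z ≤ (1 - t) * z := fun {t z} hz h =>
    (dropBound_lt_iff hk₁0.le hz rfl).2 h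
  obtain ⟨y₀, hy₀, h3, h4⟩ := hA.mono hm hc₁.le hc ha hap hpb hb hτ₀ hτ₀'
  -- The ratio of `rightDrop` to y is 1 - τ at y and more than 1 - τ₀ ≥ 1 - τ at y₀, and it is
  -- nondecreasing.
  have hyy : y ≤ y₀ := by
    by_contra hcon
    have := rightDrop_mul_le j m (by omega) hp0 hp1 hy₀ (not_le.1 hcon).le
    rw [hr] at this
    have e1 : (1 - τ) * y * y₀ ≤ (1 - τ₀) * y₀ * y := by
      have : 0 ≤ y * y₀ := by positivity
      nlinarith
    nlinarith [mul_lt_mul_of_pos_right h4 hypos]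
  have h5 := (bound hy₀ (line h3)).trans h4.le
  rcases hB with hB | ⟨hτ1, hB, hB'⟩
  · refine dropBound_le_of_half_le hm hp0 hp1 (by positivity) hk₁0.le ?_ hypos.le hyy h5
    have e : k₀ + k₁ = c₁ + (c₀ * j - c₁ * (j - 1)) / l := by rw [hk₀, hk₁]; field_simp; ring
    have : (c₀ * j - c₁ * (j - 1)) / l ≤ (1 - 2 * c₁) / 2 := by
      rw [div_le_iff₀ hlp]
      have h6 := mul_le_mul_of_nonneg_right hle (by linarith : 0 ≤ 1 - 2 * c₁)
      calc c₀ * j - c₁ * (j - 1) ≤ oddsMean m a * (1 - 2 * c₁) / 2 := by linarith only [hB]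
        _ ≤ l * (1 - 2 * c₁) / 2 := by linarith only [h6]
        _ = _ := by ring
    linarith only [e, this]
  · have hττ : τ ≤ τ₁ := by rw [hτdef, div_le_iff₀ hpm]; exact hB
    obtain ⟨y₁, hy₁, h6, h7⟩ := hB'.mono hm hc₁.le hc ha hap hpb hb (by linarith) hτ1
    -- Either y lies between the two anchors and the comparison interpolates, or y ≤ y₁ and the
    -- bound at y₁ holds at y directly.
    rcases le_total y₁ y with h8 | h8
    · exact dropBound_le_between hm hp0 hp1 (by positivity) hk₁0.le hy₁
        ((bound hy₁ (line h6)).trans_lt h7) h8 hyy h5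
    · rw [dropBound_lt_iff hk₁0.le hypos hr]
      have e0 : 0 ≤ k₀ + k₁ * τ := by have : 0 ≤ τ := by linarith
                                      positivity
      calc y * (k₀ + k₁ * τ) ≤ y₁ * (k₀ + k₁ * τ₁) :=
            mul_le_mul h8 (by gcongr) e0 hy₁.le
        _ ≤ 1 - τ₁ := line h6
        _ ≤ 1 - τ := by linarith

end

/-! ### Verified cells in p and τ -/

section

open Set Filter Topology

def anchorDen (j m c₀ c₁ a q : ℕ) : ℕ :=
  Nat.add (Nat.mul (Nat.mul c₀ j) (Nat.mul (Nat.sub gridDen a) 128))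
    (Nat.mul (Nat.mul c₁ (Nat.sub (Nat.mul m a) (Nat.mul (Nat.sub j 1) (Nat.sub gridDen a)))) q)

/-- The largest grid point t for which y = m (t - b) / (`gridDen` - b) satisfies the upper bound in
`IsDropAnchor`. The common denominator 15000 serves all three tangents; τ has denominator 128. -/
def anchorPoint (j m c₀ c₁ a b q : ℕ) : ℕ :=
  Nat.add b (Nat.div (Nat.mul (Nat.mul a (Nat.sub 128 q)) (Nat.mul 15000 (Nat.sub gridDen b)))
    (anchorDen j m c₀ c₁ a q))

/-- The inequality (1 - τ) y < `rightDrop` with denominators cleared. As `gridSum` contains `lowInt`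
with a minus sign, the term at b stands on the smaller side. -/
def anchorTest (j m b q t : ℕ) : Bool :=
  Bool.and (Nat.ble (Nat.succ b) t)
    (Nat.ble (Nat.succ (Nat.mul 128 (gridSum (Nat.add j m) (Nat.succ j) b)))
      (Nat.add (Nat.mul 128 (gridSum (Nat.add j m) (Nat.succ j) t))
        (Nat.mul (Nat.mul (Nat.succ (Nat.add j m))
          (Nat.add (Nat.mul (Nat.sub 128 q) (gridTail (Nat.add j m) j b))
            (Nat.mul q (gridTail (Nat.add j m) (Nat.succ j) b))))
          (Nat.sub t b))))

/-- A test for `IsDropAnchor` on the interval from `a / gridDen` to `b / gridDen`, for the tangent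
`(c₀ / 15000, c₁ / 15000)` and `τ = q / 128`. -/
def anchorCheck (j m a b c₀ c₁ q : ℕ) : Bool := anchorTest j m b q (anchorPoint j m c₀ c₁ a b q)

def slopeCheck (j m a c₀ c₁ : ℕ) : Bool :=
  Nat.ble (Nat.mul (Nat.mul 2 (Nat.mul c₀ j)) (Nat.sub gridDen a))
    (Nat.add (Nat.mul (Nat.mul m a) (Nat.sub 15000 (Nat.mul 2 c₁)))
      (Nat.mul (Nat.mul 2 (Nat.mul c₁ (Nat.sub j 1))) (Nat.sub gridDen a)))

def rangeCheck (j m a b c₀ c₁ lo hi : ℕ) : Bool :=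
  Bool.and (anchorCheck j m a b c₀ c₁ lo)
    (Bool.or (slopeCheck j m a c₀ c₁) (anchorCheck j m a b c₀ c₁ hi))

def rangeCheckAny (j m a b lo hi : ℕ) : Bool :=
  Bool.or (rangeCheck j m a b 7500 5000 lo hi)
    (Bool.or (rangeCheck j m a b 7593 4500 lo hi) (rangeCheck j m a b 7770 4200 lo hi))

/-- Prunes the bisection in `coverCheck`: without an anchor at the lower end, no subdivision of the
range can succeed. -/
def anchorCheckAny (j m a b q : ℕ) : Bool :=
  Bool.or (anchorCheck j m a b 7500 5000 q)
    (Bool.or (anchorCheck j m a b 7593 4500 q) (anchorCheck j m a b 7770 4200 q))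

/-- Covers the range from `lo / 128` to `hi / 128` of `τ` by bisection. -/
def coverCheck (j m a b fuel : ℕ) : ℕ → ℕ → Bool :=
  Nat.rec (motive := fun _ => ℕ → ℕ → Bool) (fun lo hi => rangeCheckAny j m a b lo hi)
    (fun _ ih lo hi => Bool.or (rangeCheckAny j m a b lo hi) (Bool.and (anchorCheckAny j m a b lo)
      (Bool.and (ih lo (Nat.div (Nat.add lo hi) 2)) (ih (Nat.div (Nat.add lo hi) 2) hi)))) fuel

/-- Ensures τ ≤ q / 128 at every p up to b for all levels up to 27 / 100, since a convex combination
of G_j and G_{j+1} decreases in p. For q = 0 no level is left to consider. -/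
def levelCheck (j m b q : ℕ) : Bool :=
  Nat.ble (Nat.mul (Nat.mul 27 128) (Nat.pow gridDen (Nat.add j m)))
    (Nat.mul 100 (Nat.add (Nat.mul (Nat.sub 128 q) (gridTail (Nat.add j m) j b))
      (Nat.mul q (gridTail (Nat.add j m) (Nat.succ j) b))))

/-- The least `q` with `levelCheck j m b q`. -/
def levelPoint (j m b : ℕ) : ℕ :=
  Nat.succ (Nat.div (Nat.mul 128 (Nat.sub (Nat.mul 27 (Nat.pow gridDen (Nat.add j m)))
    (Nat.mul 100 (gridTail (Nat.add j m) j b))))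
    (Nat.mul 100 (Nat.sub (gridTail (Nat.add j m) (Nat.succ j) b)
      (gridTail (Nat.add j m) j b))))

def cellCheckAt (j m a b q : ℕ) : Bool :=
  cond (Nat.ble 128 q) (coverCheck j m a b 2 0 128)
    (Bool.and (levelCheck j m b q) (coverCheck j m a b 2 0 q))

def cellCheck (j m a b : ℕ) : Bool :=
  Bool.or (levelCheck j m b 0) (cellCheckAt j m a b (levelPoint j m b))

/-- Covers the interval from `a / gridDen` to `b / gridDen` by cells, found by bisection. -/
def cellsCheck (j m fuel : ℕ) : ℕ → ℕ → Bool :=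
  Nat.rec (motive := fun _ => ℕ → ℕ → Bool) (fun a b => cellCheck j m a b)
    (fun _ ih a b => Bool.or (cellCheck j m a b)
      (Bool.and (ih a (Nat.div (Nat.add a b) 2)) (ih (Nat.div (Nat.add a b) 2) b))) fuel

/-- The condition needed in `lt_of_two_steps`, for levels up to `27 / 100`. -/
def IsFirstOrderAt (j m : ℕ) (p : ℝ) : Prop :=
  ∀ w v ℓ, 0 ≤ w → w < p → p < v → v ≤ 1 → ℓ ≤ 27 / 100 → lowAvg (j + m) j w p = ℓ →
    lowAvg (j + m) (j + 1) p v = ℓ →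
    (ℓ - lowTail (j + m) j p) * (v - p) < (lowTail (j + m) (j + 1) p - ℓ) * (p - w)

section Cell

variable {j m a b : ℕ}

lemma oddsMean_grid (m : ℕ) {a : ℕ} (ha : a < gridDen) :
    oddsMean m ((a : ℝ) / gridDen) = m * a / (gridDen - a) := by
  have h1 : (0 : ℝ) < gridDen - a := by rw [sub_pos]; exact_mod_cast ha
  have h0 := gridDen_pos
  have h2 : 1 - (a : ℝ) / gridDen ≠ 0 := by
    have : 1 - (a : ℝ) / gridDen = (gridDen - a) / gridDen := by field_simp
    rw [this]; positivity
  unfold oddsMean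
  field_simp

lemma lt_of_anchorTest {q t : ℕ} (h : anchorTest j m b q t = true) : b < t := by
  simp only [anchorTest, Bool.and_eq_true, Nat.ble_eq, Nat.succ_eq_add_one] at h
  omega

lemma lt_rightDrop_of_anchorTest (hj : 1 ≤ j) (hm : 2 ≤ m) (hb0 : 0 < b) (hb : b < gridDen) {q t : ℕ}
    (hq : q ≤ 128) (h : anchorTest j m b q t = true) :
    (1 - (q : ℝ) / 128) * (m * (t - b) / (gridDen - b)) <
      rightDrop j m ((b : ℝ) / gridDen) (m * (t - b) / (gridDen - b)) := by
  have hbt := lt_of_anchorTest h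
  simp only [anchorTest, Bool.and_eq_true, Nat.ble_eq, Nat.succ_eq_add_one, Nat.add_eq, Nat.mul_eq,
    Nat.sub_eq] at h
  have h2 : ((128 * gridSum (j + m) (j + 1) b + 1 : ℕ) : ℝ) ≤ ((128 * gridSum (j + m) (j + 1) t
      + (j + m + 1) * ((128 - q) * gridTail (j + m) j b + q * gridTail (j + m) (j + 1) b)
        * (t - b) : ℕ) : ℝ) := by exact_mod_cast h.2
  push_cast [Nat.cast_sub hq, Nat.cast_sub hbt.le] at h2
  have hD := gridDen_pos
  have hbD : (0 : ℝ) < gridDen - b := by rw [sub_pos]; exact_mod_cast hb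
  have hm0 : (0 : ℝ) < m := by have : 0 < m := by omega
                               exact_mod_cast this
  rw [cast_gridSum _ _ (by omega) (by omega), cast_gridSum _ _ (by omega) (by omega),
    cast_gridTail _ _ (by omega) hb, cast_gridTail _ _ (by omega) hb] at h2
  have hp0 : 0 < (b : ℝ) / gridDen := by have : (0 : ℝ) < b := by exact_mod_cast hb0
                                         positivity
  have hp1 : (b : ℝ) / gridDen < 1 := by rw [div_lt_one hD]; exact_mod_cast hb
  have hpm := bpmf_pos (j + m) j (by omega) hp0 hp1
  have e1 : (b : ℝ) / gridDen + (1 - (b : ℝ) / gridDen) * (m * (t - b) / (gridDen - b)) / m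
      = t / gridDen := by field_simp; ring
  rw [rightDrop, e1, lt_div_iff₀ hpm]
  rw [min_eq_left hp1.le, lowTail_succ] at h2
  rw [lowTail_succ]
  set p := (b : ℝ) / gridDen with hp
  set G := lowTail (j + m) j p
  set P := bpmf (j + m) j p
  set M := lowInt (j + m) (j + 1) p
  set M' := lowInt (j + m) (j + 1) (min ((t : ℝ) / gridDen) 1)
  have e2 : (m : ℝ) / (1 - p) = m * gridDen / (gridDen - b) := by rw [hp]; field_simp
  rw [e2]
  have h3 : 0 < (((j + m : ℕ) : ℝ) + 1) * (gridDen : ℝ) ^ (j + m) := by positivity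
  have h4 : (M' - M) * gridDen < ((1 - (q : ℝ) / 128) * G + q / 128 * (G + P)) * (t - b) := by
    refine lt_of_mul_lt_mul_left (a := 128 * ((((j + m : ℕ) : ℝ) + 1) * (gridDen : ℝ) ^ (j + m))) ?_
      (by positivity)
    rw [pow_succ] at h2
    push_cast at h2 ⊢
    linarith
  have h5 := mul_lt_mul_of_pos_left h4 (by positivity : 0 < (m : ℝ) / (gridDen - b))
  have e3 : (m : ℝ) / (gridDen - b) * ((M' - M) * gridDen)
      = m * gridDen / (gridDen - b) * (M' - M) := by ring
  have e4 : (m : ℝ) / (gridDen - b) * (((1 - (q : ℝ) / 128) * G + q / 128 * (G + P)) * (t - b))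
      = (m * (t - b) / (gridDen - b)) * ((1 - (q : ℝ) / 128) * G + q / 128 * (G + P)) := by ring
  rw [e3, e4] at h5
  linarith

lemma isDropAnchor_of_anchorCheck (hj : 1 ≤ j) (hm : 2 ≤ m) (ha : (j - 1) * (gridDen - a) < m * a)
    (hab : a ≤ b) (hb : b < gridDen) {c₀ c₁ q : ℕ} (hq : q ≤ 128)
    (h : anchorCheck j m a b c₀ c₁ q = true) :
    IsDropAnchor j m (c₀ / 15000) (c₁ / 15000) (a / gridDen) (b / gridDen) (q / 128) := by
  have ha0 : 0 < a := Nat.pos_of_ne_zero (by rintro rfl; simp at ha)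
  have hbt := lt_of_anchorTest h
  have hbt' : (b : ℝ) < anchorPoint j m c₀ c₁ a b q := by exact_mod_cast hbt
  have hbD : (0 : ℝ) < gridDen - b := by rw [sub_pos]; exact_mod_cast hb
  have haD : (0 : ℝ) < gridDen - a := by rw [sub_pos]; exact_mod_cast hab.trans_lt hb
  have hm0 : (0 : ℝ) < m := by have : 0 < m := by omega
                               exact_mod_cast this
  refine ⟨_, ?_, ?_, lt_rightDrop_of_anchorTest hj hm (by omega) hb hq h⟩
  · have : (0 : ℝ) < anchorPoint j m c₀ c₁ a b q - b := by linarith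
    positivity
  · rw [oddsMean_grid m (hab.trans_lt hb)]
    have e : anchorPoint j m c₀ c₁ a b q - b =
        a * (128 - q) * (15000 * (gridDen - b)) / anchorDen j m c₀ c₁ a q :=
      Nat.add_sub_cancel_left _ _
    have h1 := Nat.div_mul_le_self (a * (128 - q) * (15000 * (gridDen - b))) (anchorDen j m c₀ c₁ a q)
    rw [← e] at h1
    have e2 : anchorDen j m c₀ c₁ a q = c₀ * j * ((gridDen - a) * 128)
      + c₁ * (m * a - (j - 1) * (gridDen - a)) * q := rfl
    rw [e2] at h1
    have h2 : (((anchorPoint j m c₀ c₁ a b q - b) * (c₀ * j * ((gridDen - a) * 128)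
      + c₁ * (m * a - (j - 1) * (gridDen - a)) * q) : ℕ) : ℝ) ≤
      ((a * (128 - q) * (15000 * (gridDen - b)) : ℕ) : ℝ) := by exact_mod_cast h1
    push_cast [Nat.cast_sub hbt.le, Nat.cast_sub ha.le, Nat.cast_sub hj, Nat.cast_sub hq,
      Nat.cast_sub hb.le, Nat.cast_sub (hab.trans hb.le)] at h2
    set t : ℝ := ((anchorPoint j m c₀ c₁ a b q : ℕ) : ℝ)
    have e3 : (m : ℝ) * (t - b) / (gridDen - b) * (c₀ / 15000 * j +
        c₁ / 15000 * (m * a / (gridDen - a) - (j - 1)) * (q / 128)) =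
        m / ((gridDen - b) * (gridDen - a) * 15000 * 128) * ((t - b) * (c₀ * j * ((gridDen - a) * 128)
          + c₁ * (m * a - (j - 1) * (gridDen - a)) * q)) := by
      field_simp
    have e4 : (m : ℝ) * a / (gridDen - a) * (1 - q / 128) =
        m / ((gridDen - b) * (gridDen - a) * 15000 * 128) * (a * (128 - q) * (15000 * (gridDen - b))) := by
      field_simp
    rw [e3, e4]
    exact mul_le_mul_of_nonneg_left h2 (by positivity)

lemma slope_of_slopeCheck (hj : 1 ≤ j) (ha : a < gridDen) {c₀ c₁ : ℕ} (hc : 2 * c₁ ≤ 15000)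
    (h : slopeCheck j m a c₀ c₁ = true) :
    2 * ((c₀ : ℝ) / 15000 * j - c₁ / 15000 * (j - 1)) ≤
      oddsMean m (a / gridDen) * (1 - 2 * (c₁ / 15000)) := by
  have haD : (0 : ℝ) < gridDen - a := by rw [sub_pos]; exact_mod_cast ha
  simp only [slopeCheck, Nat.ble_eq, Nat.add_eq, Nat.mul_eq, Nat.sub_eq] at h
  have h2 : ((2 * (c₀ * j) * (gridDen - a) : ℕ) : ℝ) ≤ ((m * a * (15000 - 2 * c₁)
    + 2 * (c₁ * (j - 1)) * (gridDen - a) : ℕ) : ℝ) := by exact_mod_cast h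
  push_cast [Nat.cast_sub hc, Nat.cast_sub hj, Nat.cast_sub ha.le] at h2
  rw [oddsMean_grid m ha, div_mul_eq_mul_div ((m : ℝ) * a), le_div_iff₀ haD]
  linarith

/-- The first-order condition for the points `p` of a cell and a range of `τ`. -/
def IsCovered (j m a b lo hi : ℕ) : Prop :=
  ∀ p : ℝ, (a : ℝ) / gridDen ≤ p → p ≤ (b : ℝ) / gridDen → ∀ w v ℓ, 0 ≤ w → w < p → p < v → v ≤ 1 →
    lowAvg (j + m) j w p = ℓ → lowAvg (j + m) (j + 1) p v = ℓ →
    (lo : ℝ) / 128 * bpmf (j + m) j p ≤ ℓ - lowTail (j + m) j p →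
    ℓ - lowTail (j + m) j p ≤ (hi : ℝ) / 128 * bpmf (j + m) j p →
    (ℓ - lowTail (j + m) j p) * (v - p) < (lowTail (j + m) (j + 1) p - ℓ) * (p - w)

variable (hj : 1 ≤ j) (hm : 2 ≤ m) (ha : (j - 1) * (gridDen - a) < m * a) (hab : a ≤ b)
  (hb : b < gridDen)
include hj hm ha hab hb

lemma isCovered_of_rangeCheck {c₀ c₁ lo hi : ℕ} (hT : IsExpTangent (c₀ / 15000) (c₁ / 15000))
    (hc₁ : 0 < c₁) (hc : c₁ ≤ c₀) (hc₁' : 2 * c₁ ≤ 15000) (hlo : lo ≤ 128) (hhi : hi ≤ 128)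
    (h : rangeCheck j m a b c₀ c₁ lo hi = true) : IsCovered j m a b lo hi := by
  intro p hap hpb w v ℓ hw hwp hpv hv h1 h2 h3 h4
  have haD : a < gridDen := by omega
  have hD := gridDen_pos
  have ha0 : 0 < a := Nat.pos_of_ne_zero (by rintro rfl; simp at ha)
  have ha0' : (0 : ℝ) < a := by exact_mod_cast ha0
  simp only [rangeCheck, Bool.and_eq_true, Bool.or_eq_true] at h
  have hc0' : (0 : ℝ) < c₁ := by exact_mod_cast hc₁
  have hc' : (c₁ : ℝ) ≤ c₀ := by exact_mod_cast hc
  have hc1' : 2 * (c₁ : ℝ) ≤ 15000 := by exact_mod_cast hc₁'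
  have hlo' : (lo : ℝ) ≤ 128 := by exact_mod_cast hlo
  have hhi' : (hi : ℝ) ≤ 128 := by exact_mod_cast hhi
  refine first_order_of_anchor j m hj hm (τ₁ := (hi : ℝ) / 128) hT (by positivity) (by gcongr)
    (by linarith) hw hwp hpv hv h1 h2
    (by positivity) hap hpb (by rw [div_lt_one hD]; exact_mod_cast hb) ?_ (by positivity)
    (by rw [div_le_one (by norm_num)]; exact hlo') h3
    (isDropAnchor_of_anchorCheck hj hm ha hab hb hlo h.1) ?_
  · have haD' : (0 : ℝ) < gridDen - a := by rw [sub_pos]; exact_mod_cast haD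
    rw [oddsMean_grid m haD, lt_div_iff₀ haD']
    have : (((j - 1) * (gridDen - a) : ℕ) : ℝ) < ((m * a : ℕ) : ℝ) := by exact_mod_cast ha
    push_cast [Nat.cast_sub hj, Nat.cast_sub haD.le] at this
    exact this
  · rcases h.2 with h5 | h5
    · exact Or.inl (slope_of_slopeCheck hj haD hc₁' h5)
    · exact Or.inr ⟨by rw [div_le_one (by norm_num)]; exact hhi', h4,
        isDropAnchor_of_anchorCheck hj hm ha hab hb hhi h5⟩

lemma isCovered_of_rangeCheckAny {lo hi : ℕ} (hlo : lo ≤ 128) (hhi : hi ≤ 128)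
    (h : rangeCheckAny j m a b lo hi = true) : IsCovered j m a b lo hi := by
  simp only [rangeCheckAny, Bool.or_eq_true] at h
  rcases h with h | h | h
  · refine isCovered_of_rangeCheck hj hm ha hab hb ?_ (by norm_num) (by norm_num) (by norm_num)
      hlo hhi h
    convert isExpTangent_one_third using 1 <;> norm_num
  · refine isCovered_of_rangeCheck hj hm ha hab hb ?_ (by norm_num) (by norm_num) (by norm_num)
      hlo hhi h
    convert isExpTangent_three_tenths using 1 <;> norm_num
  · refine isCovered_of_rangeCheck hj hm ha hab hb ?_ (by norm_num) (by norm_num) (by norm_num)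
      hlo hhi h
    convert isExpTangent_seven_twentyfifths using 1 <;> norm_num

lemma isCovered_of_coverCheck (fuel : ℕ) : ∀ {lo hi : ℕ}, lo ≤ 128 → hi ≤ 128 →
    coverCheck j m a b fuel lo hi = true → IsCovered j m a b lo hi := by
  induction fuel with
  | zero => exact fun hlo hhi h => isCovered_of_rangeCheckAny hj hm ha hab hb hlo hhi h
  | succ k ih =>
    intro lo hi hlo hhi h
    have h' : (rangeCheckAny j m a b lo hi || (anchorCheckAny j m a b lo &&
      (coverCheck j m a b k lo ((lo + hi) / 2) && coverCheck j m a b k ((lo + hi) / 2) hi))) = true := h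
    simp only [Bool.or_eq_true, Bool.and_eq_true] at h'
    rcases h' with h' | ⟨-, h1, h2⟩
    · exact isCovered_of_rangeCheckAny hj hm ha hab hb hlo hhi h'
    · have c1 := ih hlo (by omega) h1
      have c2 := ih (by omega) hhi h2
      intro p hap hpb w v ℓ hw hwp hpv hv e1 e2 h3 h4
      rcases le_total (ℓ - lowTail (j + m) j p) ((((lo + hi) / 2 : ℕ) : ℝ) / 128 * bpmf (j + m) j p)
        with h | h
      · exact c1 p hap hpb w v ℓ hw hwp hpv hv e1 e2 h3 h
      · exact c2 p hap hpb w v ℓ hw hwp hpv hv e1 e2 h h4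

omit ha hab in
lemma le_of_levelCheck {q : ℕ} (hq : q ≤ 128) (h : levelCheck j m b q = true) {p : ℝ}
    (hap : (a : ℝ) / gridDen ≤ p) (hpb : p ≤ (b : ℝ) / gridDen) :
    27 / 100 ≤ lowTail (j + m) j p + (q : ℝ) / 128 * bpmf (j + m) j p := by
  have hD := gridDen_pos
  have hb1 : (b : ℝ) / gridDen ≤ 1 := by rw [div_le_one hD]; exact_mod_cast hb.le
  have hp0 : 0 ≤ p := le_trans (by positivity) hap
  simp only [levelCheck, Nat.ble_eq, Nat.add_eq, Nat.mul_eq, Nat.sub_eq, Nat.succ_eq_add_one,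
    Nat.pow_eq] at h
  have h2 : ((27 * 128 * gridDen ^ (j + m) : ℕ) : ℝ) ≤ ((100 * ((128 - q) * gridTail (j + m) j b
    + q * gridTail (j + m) (j + 1) b) : ℕ) : ℝ) := by exact_mod_cast h
  push_cast [Nat.cast_sub hq] at h2
  rw [cast_gridTail _ _ (by omega) hb, cast_gridTail _ _ (by omega) hb] at h2
  have hDn : (0 : ℝ) < (gridDen : ℝ) ^ (j + m) := by positivity
  have h3 : 27 * 128 ≤ 100 * ((128 - q) * lowTail (j + m) j (b / gridDen)
      + q * lowTail (j + m) (j + 1) (b / gridDen)) :=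
    le_of_mul_le_mul_right (by linarith) hDn
  have m1 := (lowTail_strictAntiOn (j + m) j hj (by omega)).antitoneOn ⟨hp0, hpb.trans hb1⟩
    ⟨hp0.trans hpb, hb1⟩ hpb
  have m2 := (lowTail_strictAntiOn (j + m) (j + 1) (by omega) (by omega)).antitoneOn
    ⟨hp0, hpb.trans hb1⟩ ⟨hp0.trans hpb, hb1⟩ hpb
  have hq' : (q : ℝ) ≤ 128 := by exact_mod_cast hq
  have m3 := mul_le_mul_of_nonneg_left m1 (by linarith : 0 ≤ 128 - (q : ℝ))
  have m4 := mul_le_mul_of_nonneg_left m2 (by positivity : 0 ≤ (q : ℝ))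
  rw [lowTail_succ (j + m) j p] at m4
  linarith

lemma isFirstOrderAt_of_cellCheck (h : cellCheck j m a b = true) {p : ℝ}
    (hap : (a : ℝ) / gridDen ≤ p) (hpb : p ≤ (b : ℝ) / gridDen) : IsFirstOrderAt j m p := by
  intro w v ℓ hw hwp hpv hv hℓ h1 h2
  have hp0 : 0 < p := by linarith
  have hp1 : p < 1 := by linarith
  have hpm := bpmf_pos (j + m) j (by omega) hp0 hp1
  have hA := lt_lowAvg (j + m) j hj (by omega) hw hwp hp1.le
  rw [h1] at hA
  have hB := lowAvg_lt (j + m) (j + 1) (by omega) (by omega) hp0.le hpv hv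
  rw [h2, lowTail_succ] at hB
  simp only [cellCheck, Bool.or_eq_true] at h
  rcases h with h | h
  · have := le_of_levelCheck hj hm hb (by omega) h hap hpb
    norm_num at this
    linarith
  · set q := levelPoint j m b
    have c : ∃ hi : ℕ, hi ≤ 128 ∧ coverCheck j m a b 2 0 hi = true ∧
        ℓ - lowTail (j + m) j p ≤ (hi : ℝ) / 128 * bpmf (j + m) j p := by
      unfold cellCheckAt at h
      rcases hq : Nat.ble 128 q with _ | _
      · rw [hq, cond_false, Bool.and_eq_true] at h
        have hq' : q ≤ 128 := by
          by_contra hcon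
          have : Nat.ble 128 q = true := by rw [Nat.ble_eq]; omega
          rw [this] at hq; cases hq
        have := le_of_levelCheck hj hm hb hq' h.1 hap hpb
        exact ⟨q, hq', h.2, by linarith⟩
      · rw [hq, cond_true] at h
        exact ⟨128, le_rfl, h, by norm_num; linarith⟩
    obtain ⟨hi, hhi, hc, hle⟩ := c
    refine isCovered_of_coverCheck hj hm ha hab hb 2 (by omega) hhi hc p hap hpb w v ℓ hw hwp hpv hv
      h1 h2 ?_ hle
    norm_num
    linarith

omit ha hab hb in
lemma isFirstOrderAt_of_cellsCheck (fuel : ℕ) : ∀ {a b : ℕ}, (j - 1) * (gridDen - a) < m * a → a ≤ b →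
    b < gridDen → cellsCheck j m fuel a b = true → ∀ p : ℝ, (a : ℝ) / gridDen ≤ p →
    p ≤ (b : ℝ) / gridDen → IsFirstOrderAt j m p := by
  induction fuel with
  | zero => exact fun ha hab hb h p h1 h2 => isFirstOrderAt_of_cellCheck hj hm ha hab hb h h1 h2
  | succ k ih =>
    intro a b ha hab hb h p hap hpb
    have h' : (cellCheck j m a b || (cellsCheck j m k a ((a + b) / 2) &&
      cellsCheck j m k ((a + b) / 2) b)) = true := h
    simp only [Bool.or_eq_true, Bool.and_eq_true] at h'
    rcases h' with h' | ⟨h1, h2⟩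
    · exact isFirstOrderAt_of_cellCheck hj hm ha hab hb h' hap hpb
    · rcases le_total p ((((a + b) / 2 : ℕ) : ℝ) / gridDen) with hp | hp
      · exact ih ha (by omega) (by omega) h1 p hap hp
      · refine ih ?_ (by omega) hb h2 p hp hpb
        have h3 : a ≤ (a + b) / 2 := by omega
        calc (j - 1) * (gridDen - (a + b) / 2) ≤ (j - 1) * (gridDen - a) :=
              Nat.mul_le_mul_left _ (by omega)
          _ < m * a := ha
          _ ≤ _ := Nat.mul_le_mul_left _ h3

end Cell

end

/-! ### Enclosing the chain at level 27 / 100 -/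

section

open Set Filter Topology

section Gain

variable {n j : ℕ} (hj : 1 ≤ j) (hj' : j ≤ n) {α : ℝ}
include hj hj'

/-- The gain x ↦ `lowInt` x - α x has derivative G_j - α, so it rises and then falls. A step of the
chain joins two points of equal gain, w on the rising and p on the falling branch; comparing gains
therefore locates w. -/
lemma gain_lt_of_le_lowTail {x y : ℝ} (hx : 0 ≤ x) (hxy : x < y) (hy : y ≤ 1)
    (h : α ≤ lowTail n j y) : lowInt n j x - α * x < lowInt n j y - α * y := by
  have := lt_lowInt_sub n j hj hj' hx hxy hy
  nlinarith

lemma gain_le_of_lowTail_le {x y : ℝ} (hx : 0 ≤ x) (hxy : x ≤ y) (hy : y ≤ 1)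
    (h : lowTail n j x ≤ α) : lowInt n j y - α * y ≤ lowInt n j x - α * x := by
  rcases hxy.eq_or_lt with rfl | hxy
  · rfl
  have := lowInt_sub_lt n j hj hj' hx hxy hy
  nlinarith

omit hj hj' in
lemma gain_eq {w p : ℝ} (hwp : w < p) (h : lowAvg n j w p = α) :
    lowInt n j w - α * w = lowInt n j p - α * p := by
  have := lowInt_sub_eq n j hwp
  rw [h] at this
  linarith

/-- On the falling branch the gain at b ≥ p is at most that at p, which equals that at w; so the
point a of the rising branch has no larger gain than w. -/
lemma le_left_of_gain_le {w p a b : ℝ} (hw : 0 ≤ w) (hwp : w < p) (hpb : p ≤ b) (hb : b ≤ 1)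
    (h : lowAvg n j w p = α) (ha : a ≤ 1) (h1 : α ≤ lowTail n j a)
    (h2 : lowInt n j a - α * a ≤ lowInt n j b - α * b) : a ≤ w := by
  by_contra hcon
  have e1 := gain_lt_of_le_lowTail hj hj' hw (not_le.1 hcon) ha h1
  have e2 := lt_lowAvg n j hj hj' hw hwp (hpb.trans hb)
  have e3 := gain_le_of_lowTail_le hj hj' (hw.trans hwp.le) hpb hb (h ▸ e2.le)
  have e4 := gain_eq hwp h
  linarith

lemma left_le_of_lowTail_le {w p b : ℝ} (hw : 0 ≤ w) (hwp : w < p) (hp : p ≤ 1)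
    (h : lowAvg n j w p = α) (hb : 0 ≤ b) (h1 : lowTail n j b ≤ α) : w ≤ b := by
  by_contra hcon
  have e1 := lowAvg_lt n j hj hj' hw hwp hp
  have e2 := lowTail_strictAntiOn n j hj hj' ⟨hb, by linarith⟩ ⟨hw, by linarith⟩ (not_le.1 hcon)
  linarith

lemma left_le_of_gain_le {w p a b : ℝ} (hw : 0 ≤ w) (hwp : w < p) (hp : p ≤ 1)
    (h : lowAvg n j w p = α) (ha : 0 ≤ a) (hap : a ≤ p) (hb : 0 ≤ b) (h1 : lowTail n j a ≤ α)
    (h2 : lowInt n j a - α * a ≤ lowInt n j b - α * b) : w ≤ b := by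
  by_contra hcon
  have e1 := lowAvg_lt n j hj hj' hw hwp hp
  have e2 := gain_lt_of_le_lowTail hj hj' hb (not_le.1 hcon) (hwp.le.trans hp) (h ▸ e1.le)
  have e3 := gain_le_of_lowTail_le hj hj' ha hap hp h1
  have e4 := gain_eq hwp h
  linarith

end Gain

/-- The bisection method for the last grid point of `[lo, hi]` at which `P` holds. -/
def bisect (P : ℕ → Bool) (fuel : ℕ) : ℕ → ℕ → ℕ :=
  Nat.rec (motive := fun _ => ℕ → ℕ → ℕ) (fun lo _ => lo)
    (fun _ ih lo hi => cond (P (Nat.div (Nat.add lo hi) 2)) (ih (Nat.div (Nat.add lo hi) 2) hi)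
      (ih lo (Nat.div (Nat.add lo hi) 2))) fuel

/-- A test for `27 / 100 ≤ lowTail n j (t / gridDen)`. -/
def tailCheck (n j t : ℕ) : Bool :=
  Bool.and (Nat.ble (Nat.succ t) gridDen)
    (Nat.ble (Nat.mul 27 (Nat.pow gridDen n)) (Nat.mul 100 (gridTail n j t)))

/-- A constant minus a positive multiple of the gain at level 27 / 100, hence the reversed order in
`gainCheck`. -/
def gainNum (n j t : ℕ) : ℕ :=
  Nat.add (Nat.mul 100 (gridSum n j t))
    (Nat.mul (Nat.mul 27 t) (Nat.mul (Nat.succ n) (Nat.pow gridDen n)))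

/-- A test for `lowInt n j x - 27 / 100 * x ≤ lowInt n j y - 27 / 100 * y`, with `x = s / gridDen`
and `y = t / gridDen`. -/
def gainCheck (n j s t : ℕ) : Bool := Nat.ble (gainNum n j t) (gainNum n j s)

/-- A test for `t / gridDen` being a lower bound of the left end of a step to `b / gridDen`. -/
def lowerCheck (n j b t : ℕ) : Bool :=
  Bool.and (Nat.ble b gridDen) (Bool.and (tailCheck n j t) (gainCheck n j t b))

/-- A test for `t / gridDen` being an upper bound of the left end of a step to `a / gridDen`. -/
def upperCheck (n j a t : ℕ) : Bool :=
  Bool.or (Bool.not (tailCheck n j t)) (Bool.and (Bool.and (Nat.ble (Nat.succ a) gridDen)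
    (Bool.not (tailCheck n j a))) (gainCheck n j a t))

def startCheck (j m a : ℕ) : Bool :=
  Nat.ble (Nat.succ (Nat.mul (Nat.sub j 1) (Nat.sub gridDen a))) (Nat.mul m a)

def largePoint (j n : ℕ) : ℕ := Nat.succ (Nat.div (Nat.mul gridDen (Nat.add j 2)) (Nat.add n 2))

/-- A test for the first-order condition at all points of `[a / gridDen, 1)`. -/
def stepCheck (n j a : ℕ) : Bool :=
  -- Inside `track` the exemption for n ≤ 3 concerns only (n, j) = (2, 1) and (3, 2), which are
  -- treated by hand.
  Bool.or (Bool.or (Nat.ble (largePoint j n) a) (Bool.and (Nat.ble n 3) (Nat.ble n (Nat.succ j))))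
    (Bool.and (Bool.and (Nat.ble 2 (Nat.sub n j)) (Nat.ble (Nat.succ (largePoint j n)) gridDen))
      (Bool.and (startCheck j (Nat.sub n j) a) (cellsCheck j (Nat.sub n j) 7 a (largePoint j n))))

/-- A step of Newton's method from `t` for the point where the function in `gainCheck` has the
value that it has at `s`. -/
def newtonStep (n j s t : ℕ) : ℕ :=
  Nat.add t (Nat.div (Nat.sub (gainNum n j t) (gainNum n j s))
    (Nat.mul (Nat.succ n) (Nat.sub (Nat.mul 100 (gridTail n j t)) (Nat.mul 27 (Nat.pow gridDen n)))))

/-- The gain is concave, so Newton's method started to the left on the rising branch stays to the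
left of the solution. It only proposes points; `lowerCheck` and `upperCheck` certify them. -/
def newton (n j s t : ℕ) : ℕ := newtonStep n j s (newtonStep n j s (newtonStep n j s t))

def trackStep (n j a b : ℕ) (next : ℕ → ℕ → Bool) (a' b' : ℕ) : Bool :=
  Bool.and (Bool.and (lowerCheck n j b a') (upperCheck n j a b'))
    (Bool.and (stepCheck n (Nat.sub j 1) a') (next a' b'))

def upperPoint (n j a t : ℕ) : ℕ := cond (upperCheck n j a t) t (Nat.succ a)

def trackFrom (n j a b : ℕ) (next : ℕ → ℕ → Bool) (a' : ℕ) : Bool :=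
  trackStep n j a b next a' (upperPoint n j a
    (Nat.add (newton n j a (newton n j a a')) (Nat.succ (Nat.div 512 n))))

/-- Tracks, for a chain at the level `27 / 100`, intervals around its members with indices at most
`k`, from the interval from `a / gridDen` to `b / gridDen` around the one with index `k + 1`. -/
def track (n k : ℕ) : ℕ → ℕ → Bool :=
  Nat.rec (motive := fun _ => ℕ → ℕ → Bool) (fun _ _ => true)
    (fun i ih a b => trackFrom n (Nat.succ (Nat.succ i)) a b ih
      (newton n (Nat.succ (Nat.succ i)) b (Nat.sub a (Nat.div 170000 n)))) k

/-- The member with index k + 1 is enclosed without knowing later ones: G_{k+1} is below the level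
there, and G_{k+2} is above the level, or the index is n and the bound is 1. -/
def trackStart (n k a b : ℕ) : Bool :=
  Bool.and (Bool.and (tailCheck n (Nat.succ k) a)
    (Bool.or (Bool.and (Nat.ble n (Nat.succ k)) (Nat.ble gridDen b))
      (Bool.not (tailCheck n (Nat.succ (Nat.succ k)) b)))) (track n k a b)

/-- Since `gridDen` is 2 ^ 17, seventeen halvings isolate a single grid point. -/
def trackIndex (n k : ℕ) : Bool :=
  trackStart n k (bisect (tailCheck n (Nat.succ k)) 17 0 gridDen)
    (cond (Nat.ble n (Nat.succ k)) gridDen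
      (Nat.succ (bisect (tailCheck n (Nat.succ (Nat.succ k))) 17 0 gridDen)))

def trackAll (n : ℕ) : Bool := trackIndex n (cond (Nat.ble n 34) (Nat.sub n 1) 33)

def trackRange (k : ℕ) : Bool :=
  Nat.rec (motive := fun _ => Bool) true
    (fun i ih => Bool.and (trackAll (Nat.succ (Nat.succ i))) ih) k

set_option maxRecDepth 100000 in
lemma trackRange_true : trackRange 199 = true := by decide +kernel

set_option maxRecDepth 100000 in
lemma lowerCheck_two : lowerCheck 2 2 gridDen 90439 = true := by decide +kernel

set_option maxRecDepth 100000 in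
lemma lowerCheck_three : lowerCheck 3 3 gridDen 103546 = true := by decide +kernel

end

/-! ### Correctness of the enclosure and the first-order condition for j ≤ 33 -/

section

open Set Filter Topology

/-- The points `u j < ⋯ < u n` satisfy the chain conditions in terms of `lowAvg`. -/
structure IsLevelChain (n j : ℕ) (α : ℝ) (u : ℕ → ℝ) : Prop where
  nonneg : 0 ≤ u j
  le_one : u n ≤ 1
  lt : ∀ i, j ≤ i → i < n → u i < u (i + 1)
  avg : ∀ i, j ≤ i → i < n → lowAvg n (i + 1) (u i) (u (i + 1)) = α

lemma IsLevelChain.tail {n j : ℕ} {α : ℝ} {u : ℕ → ℝ} (h : IsLevelChain n j α u) {i : ℕ}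
    (hji : j ≤ i) (hin : i ≤ n) : IsLevelChain n i α u := by
  refine ⟨?_, h.le_one, fun k hk => h.lt k (hji.trans hk), fun k hk => h.avg k (hji.trans hk)⟩
  induction i, hji using Nat.le_induction with
  | base => exact h.nonneg
  | succ k hk ih => exact (ih (by omega)).trans (h.lt k hk (by omega)).le

lemma IsLevelChain.le_one' {n j : ℕ} {α : ℝ} {u : ℕ → ℝ} (h : IsLevelChain n j α u) {i : ℕ}
    (hji : j ≤ i) (hin : i ≤ n) : u i ≤ 1 := by
  have key : ∀ d i, j ≤ i → i + d = n → u i ≤ 1 := by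
    intro d
    induction d with
    | zero => rintro i - rfl; exact h.le_one
    | succ d ih =>
      intro i hji e
      exact (h.lt i hji (by omega)).le.trans (ih (i + 1) (by omega) (by omega))
  exact key (n - i) i hji (by omega)

lemma natCast_grid_le {t : ℕ} (h : t ≤ gridDen) : (t : ℝ) / gridDen ≤ 1 := by
  rw [div_le_one gridDen_pos]; exact_mod_cast h

lemma natCast_grid_nonneg (t : ℕ) : 0 ≤ (t : ℝ) / gridDen := by have := gridDen_pos; positivity

lemma tailCheck_iff {n j t : ℕ} (hj : j ≤ n + 1) : tailCheck n j t = true ↔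
    t < gridDen ∧ 27 / 100 ≤ lowTail n j (t / gridDen) := by
  have hD : (0 : ℝ) < (gridDen : ℝ) ^ n := pow_pos gridDen_pos n
  simp only [tailCheck, Bool.and_eq_true, Nat.ble_eq, Nat.succ_le_iff, Nat.mul_eq, Nat.pow_eq]
  refine and_congr_right fun ht => ?_
  rw [← Nat.cast_le (α := ℝ)]
  push_cast
  rw [cast_gridTail n j hj ht]
  constructor <;> intro h
  · exact le_of_mul_le_mul_right (by linarith) hD
  · have := mul_le_mul_of_nonneg_right h hD.le
    linarith

lemma lowTail_le_of_not_tailCheck {n j t : ℕ} (hj : j ≤ n) (h : tailCheck n j t = false) :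
    lowTail n j (min ((t : ℝ) / gridDen) 1) ≤ 27 / 100 := by
  by_contra hcon
  rw [not_le] at hcon
  rcases lt_or_ge t gridDen with ht | ht
  · rw [min_eq_left (natCast_grid_le ht.le)] at hcon
    have := (tailCheck_iff (by omega)).2 ⟨ht, hcon.le⟩
    rw [h] at this; cases this
  · have : 1 ≤ (t : ℝ) / gridDen := by
      rw [le_div_iff₀ gridDen_pos, one_mul]; exact_mod_cast ht
    rw [min_eq_right this, lowTail_at_one n j hj] at hcon
    norm_num at hcon

lemma gain_le_of_gainCheck {n j s t : ℕ} (hj : 1 ≤ j) (hj' : j ≤ n) (h : gainCheck n j s t = true) :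
    lowInt n j (min ((s : ℝ) / gridDen) 1) - 27 / 100 * (s / gridDen) ≤
      lowInt n j (min ((t : ℝ) / gridDen) 1) - 27 / 100 * (t / gridDen) := by
  have hD := gridDen_pos
  simp only [gainCheck, gainNum, Nat.ble_eq, Nat.mul_eq, Nat.pow_eq, Nat.add_eq,
    Nat.succ_eq_add_one] at h
  rw [← Nat.cast_le (α := ℝ)] at h
  push_cast at h
  rw [cast_gridSum n j hj hj', cast_gridSum n j hj hj'] at h
  have h1 : (0 : ℝ) < 100 * ((n + 1) * (gridDen : ℝ) ^ (n + 1)) := by positivity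
  refine le_of_mul_le_mul_left ?_ h1
  have e : ∀ x : ℝ, 100 * ((n + 1) * (gridDen : ℝ) ^ (n + 1)) * (27 / 100 * (x / gridDen))
      = 27 * x * ((n + 1) * (gridDen : ℝ) ^ n) := fun x => by field_simp; ring
  rw [mul_sub, mul_sub, e, e]
  linarith

lemma le_left_of_lowerCheck {n j b t : ℕ} (hj : 1 ≤ j) (hj' : j ≤ n) (h : lowerCheck n j b t = true)
    {w p : ℝ} (hw : 0 ≤ w) (hwp : w < p) (hpb : p ≤ b / gridDen)
    (h1 : lowAvg n j w p = 27 / 100) : (t : ℝ) / gridDen ≤ w := by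
  simp only [lowerCheck, Bool.and_eq_true, Nat.ble_eq] at h
  obtain ⟨hb, ht, hg⟩ := h
  rw [tailCheck_iff (by omega)] at ht
  have h2 := gain_le_of_gainCheck hj hj' hg
  rw [min_eq_left (natCast_grid_le ht.1.le), min_eq_left (natCast_grid_le hb)] at h2
  exact le_left_of_gain_le hj hj' hw hwp hpb (natCast_grid_le hb) h1 (natCast_grid_le ht.1.le) ht.2 h2

lemma left_le_of_upperCheck {n j a t : ℕ} (hj : 1 ≤ j) (hj' : j ≤ n) (h : upperCheck n j a t = true)
    {w p : ℝ} (hw : 0 ≤ w) (hwp : w < p) (hp : p ≤ 1) (hap : (a : ℝ) / gridDen ≤ p)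
    (h1 : lowAvg n j w p = 27 / 100) : w ≤ (t : ℝ) / gridDen := by
  have ht0 := natCast_grid_nonneg t
  simp only [upperCheck, Bool.or_eq_true, Bool.and_eq_true, Bool.not_eq_true', Nat.ble_eq,
    Nat.succ_le_iff] at h
  rcases h with h | ⟨⟨ha, h2⟩, h3⟩
  · exact (left_le_of_lowTail_le hj hj' hw hwp hp h1 (le_min ht0 zero_le_one)
      (lowTail_le_of_not_tailCheck hj' h)).trans (min_le_left _ _)
  · have h4 := lowTail_le_of_not_tailCheck hj' h2
    have h5 := gain_le_of_gainCheck hj hj' h3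
    rw [min_eq_left (natCast_grid_le ha.le)] at h4 h5
    rcases lt_or_ge (t : ℝ) gridDen with ht | ht
    · rw [min_eq_left (by rw [div_le_one gridDen_pos]; exact ht.le)] at h5
      exact left_le_of_gain_le hj hj' hw hwp hp h1 (natCast_grid_nonneg a) hap ht0 h4 h5
    · have : 1 ≤ (t : ℝ) / gridDen := by rw [le_div_iff₀ gridDen_pos, one_mul]; exact ht
      linarith

lemma isFirstOrderAt_of_large {j m : ℕ} (hj : 1 ≤ j) (hm : 1 ≤ m) {p : ℝ}
    (h : (j : ℝ) + 2 ≤ (j + m + 2) * p) : IsFirstOrderAt j m p := by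
  intro w v ℓ hw hwp hpv hv _ h1 h2
  refine first_order_of_large j m hj hm hw hwp hpv hv h1 h2 ?_
  have hq : 0 < 1 - p := by linarith
  rw [oddsMean, le_div_iff₀ hq]
  linarith

lemma isFirstOrderAt_of_largePoint_le {j m : ℕ} (hj : 1 ≤ j) (hm : 1 ≤ m) {p : ℝ}
    (h : (largePoint j (j + m) : ℝ) / gridDen ≤ p) : IsFirstOrderAt j m p := by
  refine isFirstOrderAt_of_large hj hm ?_
  have e : largePoint j (j + m) = gridDen * (j + 2) / (j + m + 2) + 1 := rfl
  have h1 : gridDen * (j + 2) < (j + m + 2) * largePoint j (j + m) := by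
    rw [e]; exact Nat.lt_mul_div_succ _ (by omega)
  have h2 : (gridDen : ℝ) * (j + 2) < (j + m + 2) * largePoint j (j + m) := by exact_mod_cast h1
  rw [div_le_iff₀ gridDen_pos] at h
  have h3 : (gridDen : ℝ) * (j + 2) ≤ gridDen * ((j + m + 2) * p) := by
    have := mul_le_mul_of_nonneg_left h (by positivity : (0 : ℝ) ≤ j + m + 2)
    linarith
  exact le_of_mul_le_mul_left h3 gridDen_pos

lemma isFirstOrderAt_of_stepCheck {j m a : ℕ} (hj : 1 ≤ j) (hm : 1 ≤ m)
    (hn : 4 ≤ j + m ∨ 2 ≤ m) (h : stepCheck (j + m) j a = true) {p : ℝ}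
    (hp : (a : ℝ) / gridDen ≤ p) : IsFirstOrderAt j m p := by
  have hD := gridDen_pos
  simp only [stepCheck, Bool.or_eq_true, Bool.and_eq_true, Nat.ble_eq, Nat.succ_le_iff, startCheck,
    Nat.sub_eq, Nat.mul_eq, Nat.add_sub_cancel_left, Nat.succ_eq_add_one] at h
  rcases h with (h | h) | ⟨⟨hm2, hl⟩, hs, hc⟩
  · refine isFirstOrderAt_of_largePoint_le hj hm (le_trans ?_ hp)
    gcongr
  · omega
  · rcases le_total ((largePoint j (j + m) : ℝ) / gridDen) p with h | h
    · exact isFirstOrderAt_of_largePoint_le hj hm h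
    · have hle : a ≤ largePoint j (j + m) := by
        have := hp.trans h
        rw [div_le_div_iff_of_pos_right hD] at this
        exact_mod_cast this
      exact isFirstOrderAt_of_cellsCheck hj hm2 7 hs hle (by omega) hc p hp h

lemma exists_of_track {n j : ℕ} (hj : 1 ≤ j) {u : ℕ → ℝ} (hu : IsLevelChain n j (27 / 100) u)
    (k : ℕ) : ∀ {a b : ℕ}, k + 1 ≤ n → j ≤ k → track n k a b = true → (a : ℝ) / gridDen ≤ u (k + 1) →
      u (k + 1) ≤ (b : ℝ) / gridDen →
      ∃ t : ℕ, stepCheck n j t = true ∧ (t : ℝ) / gridDen ≤ u j := by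
  induction k with
  | zero => intro a b _ hjk; omega
  | succ i ih =>
    intro a b hk hjk h ha hb
    obtain ⟨a', b', h⟩ : ∃ a' b', trackStep n (i + 2) a b (track n i) a' b' = true := ⟨_, _, h⟩
    simp only [trackStep, Bool.and_eq_true] at h
    obtain ⟨⟨h1, h2⟩, h3, h4⟩ := h
    have c := hu.tail (i := i + 1) hjk (by omega)
    have hlt := c.lt (i + 1) le_rfl (by omega)
    have havg := c.avg (i + 1) le_rfl (by omega)
    have e1 := le_left_of_lowerCheck (by omega) (by omega) h1 c.nonneg hlt hb havg
    have e2 := left_le_of_upperCheck (by omega) (by omega) h2 c.nonneg hlt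
      (hu.le_one' (by omega) (by omega)) ha havg
    rcases hjk.eq_or_lt with rfl | hlt
    · exact ⟨a', h3, e1⟩
    · exact ih (by omega) (by omega) h4 e1 e2

lemma exists_of_trackIndex {n j k : ℕ} (hj : 1 ≤ j) (hjk : j ≤ k) (hk : k + 1 ≤ n) {u : ℕ → ℝ}
    (hu : IsLevelChain n j (27 / 100) u) (h : trackIndex n k = true) :
    ∃ t : ℕ, stepCheck n j t = true ∧ (t : ℝ) / gridDen ≤ u j := by
  obtain ⟨a, b, h⟩ : ∃ a b, trackStart n k a b = true := ⟨_, _, h⟩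
  simp only [trackStart, Bool.and_eq_true, Bool.or_eq_true, Bool.not_eq_true', Nat.ble_eq] at h
  obtain ⟨⟨h1, h2⟩, h3⟩ := h
  have c := hu.tail hjk (by omega)
  have c1 := hu.tail (i := k + 1) (by omega) hk
  have hlt := c.lt k le_rfl (by omega)
  have havg := c.avg k le_rfl (by omega)
  have hle := hu.le_one' (i := k + 1) (by omega) hk
  refine exists_of_track hj hu k hk hjk h3 ?_ ?_
  · rw [tailCheck_iff (by omega)] at h1
    have h4 := lt_lowAvg n (k + 1) (by omega) hk c.nonneg hlt hle
    rw [havg] at h4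
    by_contra hcon
    have := lowTail_strictAntiOn n (k + 1) (by omega) hk ⟨c1.nonneg, hle⟩
      ⟨natCast_grid_nonneg a, natCast_grid_le h1.1.le⟩ (not_le.1 hcon)
    linarith
  · rcases h2 with ⟨h2, h4⟩ | h2
    · refine hle.trans ?_
      rw [le_div_iff₀ gridDen_pos, one_mul]; exact_mod_cast h4
    · rcases Nat.lt_or_ge (k + 1) n with hkn | hkn
      · exact (left_le_of_lowTail_le (j := k + 2) (by omega) (by omega) c1.nonneg
          (c1.lt (k + 1) le_rfl hkn) (hu.le_one' (by omega) (by omega))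
          (c1.avg (k + 1) le_rfl hkn) (le_min (natCast_grid_nonneg b) zero_le_one)
          (lowTail_le_of_not_tailCheck (by omega) h2)).trans (min_le_left _ _)
      · by_contra hcon
        have e : k + 1 + 1 = n + 1 := by omega
        have hb : b < gridDen := by
          have := (not_le.1 hcon).trans_le hle
          rw [div_lt_one gridDen_pos] at this
          exact_mod_cast this
        have : tailCheck n (k + 1 + 1) b = true := by
          rw [tailCheck_iff (by omega), e, lowTail_full]
          exact ⟨hb, by norm_num⟩
        rw [h2] at this; cases this

lemma trackAll_of_trackRange (k : ℕ) (h : trackRange k = true) : ∀ i < k, trackAll (i + 2) = true := by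
  induction k with
  | zero => intro i hi; omega
  | succ k ih =>
    have h' : (trackAll (k + 2) && trackRange k) = true := h
    rw [Bool.and_eq_true] at h'
    intro i hi
    rcases Nat.lt_succ_iff_lt_or_eq.1 hi with h1 | rfl
    · exact ih h'.2 i h1
    · exact h'.1

/-- For m = 1 the drop (1 - τ) y is at least y² / 2, so y ≤ 2 (1 - τ), and k₀ + k₁ τ ≤ 1 / 2 is
enough. T bounds τ for levels up to 27 / 100. -/
lemma isFirstOrderAt_one {j : ℕ} (hj : 1 ≤ j) {p T : ℝ} (hp : 0 < p) (hp1 : p < 1)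
    (hl : (j : ℝ) - 1 < oddsMean 1 p)
    (hT : 27 / 100 - lowTail (j + 1) j p ≤ T * bpmf (j + 1) j p)
    (hk : 1 / 2 * j / oddsMean 1 p + 1 / 3 * (1 - (j - 1) / oddsMean 1 p) * T ≤ 1 / 2) :
    IsFirstOrderAt j 1 p := by
  intro w v ℓ hw hwp hpv hv hℓ h1 h2
  have hq : 0 < 1 - p := by linarith
  have hlp := oddsMean_pos (m := 1) le_rfl hp hp1
  refine first_order_of_dropBound j 1 hj le_rfl isExpTangent_one_third (by norm_num) (by norm_num) hw
    hwp hpv hv h1 h2 hl rfl rfl ?_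
  set y := ((1 : ℕ) : ℝ) * (v - p) / (1 - p) with hy
  have hypos : 0 < y := by have : 0 < v - p := by linarith
                           rw [hy]; push_cast; positivity
  have hy1 : y ≤ 1 := by rw [hy, div_le_one hq, Nat.cast_one]; linarith
  have hr := sq_half_le_rightDrop_one j hp hp1 hypos.le hy1
  have hpm := bpmf_pos (j + 1) j (by omega) hp hp1
  have h3 : rightDrop j 1 p y = (1 - (ℓ - lowTail (j + 1) j p) / bpmf (j + 1) j p) * y := by
    have e1 : p + (1 - p) * y / (1 : ℕ) = v := by rw [hy]; push_cast; field_simp; ring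
    rw [rightDrop, e1, min_eq_left hv, lowInt_sub_eq _ _ hpv, h2, div_eq_iff hpm.ne', lowTail_succ]
    have e2 : ((1 : ℕ) : ℝ) / (1 - p) * (ℓ * (v - p)) = y * ℓ := by rw [hy]; ring
    rw [e2]
    field_simp
    ring
  set τ := (ℓ - lowTail (j + 1) j p) / bpmf (j + 1) j p with hτ
  have hτT : τ ≤ T := by rw [hτ, div_le_iff₀ hpm]; linarith
  have hk₁ : 0 ≤ 1 / 3 * (1 - ((j : ℝ) - 1) / oddsMean 1 p) := by
    have : ((j : ℝ) - 1) / oddsMean 1 p < 1 := by rw [div_lt_one hlp]; exact hl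
    linarith
  rw [dropBound_lt_iff hk₁ hypos h3]
  rw [h3] at hr
  have h4 := mul_le_mul_of_nonneg_left hτT hk₁
  have h5 : y / 2 ≤ 1 - τ := by
    refine le_of_mul_le_mul_right ?_ hypos
    linarith
  nlinarith

lemma isFirstOrderAt_one_one {u : ℕ → ℝ} (hu : IsLevelChain 2 1 (27 / 100) u) {p : ℝ} (hp : u 1 ≤ p)
    (hp1 : p < 1) : IsFirstOrderAt 1 1 p := by
  have h0 := le_left_of_lowerCheck (by norm_num) le_rfl lowerCheck_two hu.nonneg
    (hu.lt 1 le_rfl (by norm_num)) (by rw [div_self gridDen_pos.ne']; exact hu.le_one)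
    (hu.avg 1 le_rfl (by norm_num))
  have h1 : 689 / 1000 ≤ p := by
    refine le_trans ?_ (h0.trans hp)
    norm_num [gridDen]
  rcases le_total (3 / 4) p with h | h
  · exact isFirstOrderAt_of_large le_rfl le_rfl (by push_cast; linarith)
  · have hq : 0 < 1 - p := by linarith
    have hl : 22 / 10 ≤ oddsMean 1 p := by
      rw [oddsMean, Nat.cast_one, one_mul, le_div_iff₀ hq]; linarith
    refine isFirstOrderAt_one (T := 4 / 5) le_rfl (by linarith) hp1 (by push_cast; linarith) ?_ ?_
    · simp [lowTail, bpmf]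
      nlinarith
    · have : 1 / 2 * ((1 : ℕ) : ℝ) / oddsMean 1 p ≤ 23 / 100 := by
        rw [div_le_iff₀ (by linarith)]; push_cast; linarith
      push_cast at this ⊢
      norm_num at this ⊢
      linarith

lemma isFirstOrderAt_two_one {u : ℕ → ℝ} (hu : IsLevelChain 3 2 (27 / 100) u) {p : ℝ} (hp : u 2 ≤ p)
    (hp1 : p < 1) : IsFirstOrderAt 2 1 p := by
  have h0 := le_left_of_lowerCheck (by norm_num) le_rfl lowerCheck_three hu.nonneg
    (hu.lt 2 le_rfl (by norm_num)) (by rw [div_self gridDen_pos.ne']; exact hu.le_one)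
    (hu.avg 2 le_rfl (by norm_num))
  have h1 : 789 / 1000 ≤ p := by
    refine le_trans ?_ (h0.trans hp)
    norm_num [gridDen]
  rcases le_total (4 / 5) p with h | h
  · exact isFirstOrderAt_of_large (by norm_num) le_rfl (by push_cast; linarith)
  · have hq : 0 < 1 - p := by linarith
    have hl : 37 / 10 ≤ oddsMean 1 p := by
      rw [oddsMean, Nat.cast_one, one_mul, le_div_iff₀ hq]; linarith
    refine isFirstOrderAt_one (T := 2 / 3) (by norm_num) (by linarith) hp1 (by push_cast; linarith)
      ?_ ?_
    · have e : bpmf 3 2 p = 3 * p ^ 2 * (1 - p) := by norm_num [bpmf, Nat.choose]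
      have e' : lowTail 3 2 p = (1 - p) ^ 3 + 3 * p * (1 - p) ^ 2 := by
        simp [lowTail, Finset.sum_range_succ]
      have h2 : 0 ≤ (1 - p) ^ 3 := by positivity
      have h3 : (789 / 1000) * (1 / 5) ^ 2 ≤ p * (1 - p) ^ 2 := by gcongr; linarith
      have h4 : (789 / 1000) ^ 2 * (1 / 5) ≤ p ^ 2 * (1 - p) := by gcongr; linarith
      rw [e, e']
      linarith
    · have h2 : 1 / 2 * ((2 : ℕ) : ℝ) / oddsMean 1 p ≤ 271 / 1000 := by
        rw [div_le_iff₀ (by linarith)]; push_cast; linarith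
      have h3 : 0 ≤ (((2 : ℕ) : ℝ) - 1) / oddsMean 1 p := by
        have : 0 < oddsMean 1 p := by linarith
        push_cast; norm_num; exact this.le
      linarith

/-- The first-order condition to the right of a member with small index of a chain at the level
`27 / 100`. -/
lemma isFirstOrderAt_of_chain {j m : ℕ} (hj : 1 ≤ j) (hm : 1 ≤ m) (hn : j + m ≤ 200) (hj33 : j ≤ 33)
    {u : ℕ → ℝ} (hu : IsLevelChain (j + m) j (27 / 100) u) {p : ℝ} (hp : u j ≤ p) (hp1 : p < 1) :
    IsFirstOrderAt j m p := by
  have h := trackAll_of_trackRange 199 trackRange_true (j + m - 2) (by omega)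
  rw [show j + m - 2 + 2 = j + m by omega] at h
  obtain ⟨k, hjk, hk, h⟩ : ∃ k, j ≤ k ∧ k + 1 ≤ j + m ∧ trackIndex (j + m) k = true := by
    unfold trackAll at h
    rcases hb : Nat.ble (j + m) 34 with _ | _
    · rw [hb, cond_false] at h
      have : ¬ j + m ≤ 34 := fun hcon => by rw [← Nat.ble_eq, hb] at hcon; cases hcon
      exact ⟨33, hj33, by omega, h⟩
    · rw [hb, cond_true] at h
      exact ⟨j + m - 1, by omega, by omega, h⟩
  obtain ⟨t, h1, h2⟩ := exists_of_trackIndex hj hjk hk hu h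
  by_cases hc : 4 ≤ j + m ∨ 2 ≤ m
  · exact isFirstOrderAt_of_stepCheck hj hm hc h1 (h2.trans hp)
  · obtain rfl : m = 1 := by omega
    obtain rfl | rfl : j = 1 ∨ j = 2 := by omega
    · exact isFirstOrderAt_one_one hu hp hp1
    · exact isFirstOrderAt_two_one hu hp hp1

end

/-! ### Numerical certificates for matched points -/

/-- `gridDen ^ (j + m + 1)` times `m ^ 2 * y ^ (j + 2) * (1 - y) ^ (m - 1)`, with
`y = t / gridDen`. -/
def rightNum (j m t : ℕ) : ℕ :=
  Nat.mul (Nat.mul m m) (Nat.mul (Nat.pow t (Nat.add j 2)) (Nat.pow (Nat.sub gridDen t) (Nat.sub m 1)))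

/-- `gridDen ^ (j + m + 1)` times `(j + 1) ^ 2 * x ^ j * (1 - x) ^ (m + 1)`, with
`x = t / gridDen`. -/
def leftNum (j m t : ℕ) : ℕ :=
  Nat.mul (Nat.mul (Nat.succ j) (Nat.succ j))
    (Nat.mul (Nat.pow t j) (Nat.pow (Nat.sub gridDen t) (Nat.succ m)))

def rightLtLeft (j m a t : ℕ) : Bool := Nat.ble (Nat.succ (rightNum j m t)) (leftNum j m a)

/-- The hypotheses of `lowTail_mul_le_of_anchor` at s = a / `gridDen` and t = b / `gridDen`, and
G_j(s) ≥ 27 / 100, so that every point where G_j is at most this level lies at or beyond s. -/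
def pairCheckAt (j m a b : ℕ) : Bool :=
  Bool.and (Bool.and (Nat.ble (Nat.mul j gridDen) (Nat.mul (Nat.add j m) a))
    (Nat.ble (Nat.mul (Nat.add j 2) gridDen) (Nat.mul (Nat.succ (Nat.add j m)) b)))
    (Bool.and (Bool.and (Nat.ble (Nat.succ b) gridDen) (rightLtLeft j m a b))
      (Bool.and (tailCheck (Nat.add j m) j a)
        (Nat.ble (gridTail (Nat.add j m) j a) (gridTail (Nat.add j m) (Nat.add j 2) b))))

/-- For j ≥ 34 the base is `largePoint`, so that the same check also places all relevant p in the
range of large odds-mean; for smaller j it is just beyond j / (j + m). -/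
def pairBase (j m : ℕ) : ℕ :=
  cond (Nat.ble 34 j) (largePoint j (Nat.add j m)) (Nat.succ (Nat.div (Nat.mul j gridDen) (Nat.add j m)))

def maxNum (s t : ℕ) : ℕ := cond (Nat.ble s t) t s

def pairCheckFrom (j m a : ℕ) : Bool :=
  pairCheckAt j m a (bisect (rightLtLeft j m a) 10 (Nat.add a (Nat.div (Nat.mul 3 gridDen) (Nat.add j m)))
    (maxNum a (Nat.succ (Nat.div (Nat.mul (Nat.add j 2) gridDen) (Nat.succ (Nat.add j m))))))

def pairCheck (j m : ℕ) : Bool := pairCheckFrom j m (pairBase j m)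

/-- All the pairs `(j, m)` with `j + m = n`, `1 ≤ j ≤ i` and `2 ≤ m`. -/
def pairRow (n i : ℕ) : Bool :=
  Nat.rec (motive := fun _ => Bool) true
    (fun i ih => Bool.and (pairCheck (Nat.succ i) (Nat.sub n (Nat.succ i))) ih) i

def pairRange (k : ℕ) : Bool :=
  Nat.rec (motive := fun _ => Bool) true
    (fun i ih => Bool.and (pairRow (Nat.add i 3) (Nat.succ i)) ih) k

set_option maxRecDepth 100000 in
lemma pairRange_true : pairRange 198 = true := by decide +kernel

def topCheck (n : ℕ) : Bool := lowerCheck n n gridDen (largePoint (Nat.sub n 1) n)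

def topRange (k : ℕ) : Bool :=
  Nat.rec (motive := fun _ => Bool) true (fun i ih => Bool.and (topCheck (Nat.add i 4)) ih) k

set_option maxRecDepth 100000 in
lemma topRange_true : topRange 197 = true := by decide +kernel

/-! ### Matched points a < β(a) with G_{j+2}(β(a)) = G_j(a), and the excess between them -/

section

open Set Filter Topology

/-- The sign of the excess over matched points is decided by a comparison of monomials. -/
lemma lowInt_sub_sub_eq (j m : ℕ) (hm : 1 ≤ m) {a b : ℝ}
    (h : lowTail (j + m) (j + 2) b = lowTail (j + m) j a) :
    ((j + m : ℕ) + 1 : ℝ) * (lowInt (j + m) (j + 1) b - lowInt (j + m) (j + 1) a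
      - lowTail (j + m) j a * (b - a)) =
    ((j + m).choose j : ℝ) / (j + 1) * ((j + 1) ^ 2 * a ^ j * (1 - a) ^ (m + 1)
      - m ^ 2 * b ^ (j + 2) * (1 - b) ^ (m - 1)) := by
  have e1 := lowInt_eq (j + m) (j + 1) (by omega) (by omega) b
  have e2 := lowInt_eq (j + m) (j + 1) (by omega) (by omega) a
  have e3 := one_sub_mul_tdens (j + m) j (by omega) a
  have e4 := mul_tdens (j + m) (j + 1) a
  have e5 := lowTail_succ (j + m) (j + 1) b
  have e6 := lowTail_succ (j + m) j a
  rw [show j + 1 + 1 = j + 2 from rfl, h] at e5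
  have ec : ((j + m).choose (j + 1) : ℝ) = (j + m).choose j / (j + 1) * m := by
    have := Nat.choose_succ_right_eq (j + m) j
    rw [Nat.add_sub_cancel_left] at this
    have h' : ((j + m).choose (j + 1) : ℝ) * (j + 1) = (j + m).choose j * m := by exact_mod_cast this
    field_simp
    linarith
  have hB : m * b * bpmf (j + m) (j + 1) b = ((j + m).choose j : ℝ) / (j + 1) *
      (m ^ 2 * b ^ (j + 2) * (1 - b) ^ (m - 1)) := by
    rw [bpmf, ec, show j + m - (j + 1) = m - 1 by omega]; ring
  have hA : (j + 1) * (1 - a) * bpmf (j + m) j a = ((j + m).choose j : ℝ) / (j + 1) *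
      ((j + 1) ^ 2 * a ^ j * (1 - a) ^ (m + 1)) := by
    rw [bpmf, Nat.add_sub_cancel_left]; field_simp; ring
  rw [mul_sub ((j + m).choose j / (j + 1) : ℝ), ← hA, ← hB]
  push_cast at e1 e2 e3 e4 ⊢
  have e7 : (1 - a) * ((j + 1) * bpmf (j + m) (j + 1) a) = a * (m * bpmf (j + m) j a) := by
    linear_combination -(1 - a) * e4 + a * e3
  rw [e7, e6] at e2
  have e8 : lowTail (j + m) (j + 1) b = lowTail (j + m) j a - bpmf (j + m) (j + 1) b := by linarith
  rw [e8] at e1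
  linear_combination e1 - e2

section Matched

variable {n j : ℕ} (hj : 1 ≤ j) (hj' : j + 2 ≤ n)
include hj hj'

lemma exists_matched {a : ℝ} (ha : a ∈ Ioo (0 : ℝ) 1) :
    ∃ b, a < b ∧ b < 1 ∧ lowTail n (j + 2) b = lowTail n j a := by
  have h1 : lowTail n j a < lowTail n (j + 2) a :=
    (lowTail_lt_succ n j (by omega) ha.1 ha.2).trans (lowTail_lt_succ n (j + 1) (by omega) ha.1 ha.2)
  have h2 : lowTail n (j + 2) 1 < lowTail n j a := by
    rw [lowTail_at_one n (j + 2) hj', ← lowTail_at_one n j (by omega)]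
    exact lowTail_strictAntiOn n j hj (by omega) ⟨ha.1.le, ha.2.le⟩ ⟨zero_le_one, le_rfl⟩ ha.2
  obtain ⟨b, hb, e⟩ := intermediate_value_Ioo' ha.2.le (continuous_lowTail n (j + 2)).continuousOn
    ⟨h2, h1⟩
  exact ⟨b, hb.1, hb.2, e⟩

variable {β : ℝ → ℝ}
  (hβ : ∀ a ∈ Ioo (0 : ℝ) 1, a < β a ∧ β a < 1 ∧ lowTail n (j + 2) (β a) = lowTail n j a)
include hβ

lemma continuousAt_matched {a : ℝ} (ha : a ∈ Ioo (0 : ℝ) 1) : ContinuousAt β a := by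
  have hanti := lowTail_strictAntiOn n (j + 2) (by omega) hj'
  have hev : ∀ᶠ x in 𝓝 a, x ∈ Ioo (0 : ℝ) 1 := Ioo_mem_nhds ha.1 ha.2
  obtain ⟨h1, h2, h3⟩ := hβ a ha
  have hβa : β a ∈ Icc (0 : ℝ) 1 := ⟨by linarith [ha.1], h2.le⟩
  refine tendsto_order.2 ⟨fun l hl => ?_, fun l hl => ?_⟩
  · rcases le_or_gt l 0 with h | h
    · filter_upwards [hev] with x hx
      linarith [(hβ x hx).1, hx.1]
    · have hlm : l ∈ Icc (0 : ℝ) 1 := ⟨h.le, by linarith⟩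
      have := hanti hlm hβa hl
      rw [h3] at this
      filter_upwards [hev, (continuous_lowTail n j).continuousAt.eventually_lt_const this] with x hx h4
      obtain ⟨h5, h6, h7⟩ := hβ x hx
      rw [← h7] at h4
      exact (hanti.lt_iff_gt ⟨by linarith [hx.1], h6.le⟩ hlm).1 h4
  · rcases le_or_gt 1 l with h | h
    · filter_upwards [hev] with x hx
      linarith [(hβ x hx).2.1]
    · have hlm : l ∈ Icc (0 : ℝ) 1 := ⟨by linarith [ha.1], h.le⟩
      have := hanti hβa hlm hl
      rw [h3] at this
      filter_upwards [hev, (continuous_lowTail n j).continuousAt.eventually_const_lt this] with x hx h4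
      obtain ⟨h5, h6, h7⟩ := hβ x hx
      rw [← h7] at h4
      exact (hanti.lt_iff_gt hlm ⟨by linarith [hx.1], h6.le⟩).1 h4

lemma hasDerivAt_matched {a : ℝ} (ha : a ∈ Ioo (0 : ℝ) 1) :
    HasDerivAt β (tdens n j a / tdens n (j + 2) (β a)) a := by
  obtain ⟨h1, h2, h3⟩ := hβ a ha
  have hd := hasDerivAt_lowTail n (j + 2) hj' (β a)
  have hpos := tdens_pos n (j + 2) (by omega) hj' (by linarith [ha.1]) h2
  have hc := continuousAt_matched hj hj' hβ ha
  -- Implicit differentiation: the slope of β is the slope of G_j divided by the divided difference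
  -- of G_{j+2}, which is continuous at β(a) and nonzero there.
  have hds : ContinuousAt (fun x => dslope (lowTail n (j + 2)) (β a) (β x)) a :=
    ContinuousAt.comp (g := dslope (lowTail n (j + 2)) (β a))
      (continuousAt_dslope_same.2 hd.differentiableAt) hc
  have hval : dslope (lowTail n (j + 2)) (β a) (β a) = -tdens n (j + 2) (β a) := by
    rw [dslope_same, hd.deriv]
  rw [hasDerivAt_iff_tendsto_slope]
  have ht := (hasDerivAt_iff_tendsto_slope.1 (hasDerivAt_lowTail n j (by omega) a)).div
    (hds.tendsto.mono_left nhdsWithin_le_nhds) (by rw [hval]; linarith)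
  rw [hval, neg_div_neg_eq] at ht
  refine ht.congr' ?_
  have hev : ∀ᶠ x in 𝓝 a, x ∈ Ioo (0 : ℝ) 1 := Ioo_mem_nhds ha.1 ha.2
  have hne : ∀ᶠ x in 𝓝 a, dslope (lowTail n (j + 2)) (β a) (β x) < 0 :=
    hds.eventually_lt_const (hval.trans_lt (by linarith))
  filter_upwards [nhdsWithin_le_nhds hev, nhdsWithin_le_nhds hne] with x hx hx2
  have e := sub_smul_dslope (lowTail n (j + 2)) (β a) (β x)
  rw [(hβ x hx).2.2, h3, smul_eq_mul] at e
  rw [Pi.div_apply, slope_def_field, slope_def_field, ← e, div_div, mul_comm (x - a),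
    mul_comm (β x - β a), mul_div_mul_left _ _ hx2.ne]

end Matched

/-- The point at which the excess over matched points is stationary. -/
noncomputable def stationaryPoint (j m : ℕ) (a : ℝ) : ℝ :=
  ((m : ℝ) - 1) * (j + 1) / (j * m) * a + 1 / m

/-- By matching, the terms with G_j cancel. The remaining probabilities are a f / j and (1 - β) g /
(m - 1) for the two densities f and g, and β' = f / g, so the derivative is f times an affine
function of a and β. -/
lemma hasDerivAt_excess (j m : ℕ) (hj : 1 ≤ j) (hm : 2 ≤ m) {β : ℝ → ℝ}
    (hβ : ∀ a ∈ Ioo (0 : ℝ) 1, a < β a ∧ β a < 1 ∧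
      lowTail (j + m) (j + 2) (β a) = lowTail (j + m) j a) {a : ℝ} (ha : a ∈ Ioo (0 : ℝ) 1) :
    HasDerivAt (fun x => lowInt (j + m) (j + 1) (β x) - lowInt (j + m) (j + 1) x
      - lowTail (j + m) j x * (β x - x))
      (tdens (j + m) j a * (m / (m - 1)) * (β a - stationaryPoint j m a)) a := by
  obtain ⟨h1, h2, h3⟩ := hβ a ha
  have hb0 : 0 < β a := by linarith [ha.1]
  have dβ := hasDerivAt_matched hj (by omega) hβ ha
  have d1 := (hasDerivAt_lowInt (j + m) (j + 1) (by omega) (β a)).comp a dβ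
  have d2 := hasDerivAt_lowInt (j + m) (j + 1) (by omega) a
  have d3 := (hasDerivAt_lowTail (j + m) j (by omega) a).mul (dβ.sub (hasDerivAt_id a))
  refine ((d1.sub d2).sub d3).congr_deriv ?_
  have hpos := tdens_pos (j + m) (j + 2) (by omega) (by omega) hb0 h2
  have e1 := one_sub_mul_tdens (j + m) (j + 1) (by omega) (β a)
  have e2 := mul_tdens (j + m) j a
  have e3 := lowTail_succ (j + m) (j + 1) (β a)
  have e4 := lowTail_succ (j + m) j a
  rw [show j + 1 + 1 = j + 2 from rfl] at e1 e3
  rw [h3] at e3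
  have hj0 : (0 : ℝ) < j := by exact_mod_cast hj
  have hm1 : (0 : ℝ) < (m : ℝ) - 1 := by
    have : (2 : ℝ) ≤ m := by exact_mod_cast hm
    linarith
  have hm0 : (0 : ℝ) < m := by linarith
  set f := tdens (j + m) j a
  set g := tdens (j + m) (j + 2) (β a)
  push_cast at e1
  have e5 : bpmf (j + m) (j + 1) (β a) = (1 - β a) * g / (m - 1) := by
    rw [eq_div_iff hm1.ne', e1]; ring
  have e6 : bpmf (j + m) j a = a * f / j := by rw [eq_div_iff hj0.ne', e2]; ring
  simp only [Pi.sub_apply, id]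
  rw [e4, e6, (by linarith : lowTail (j + m) (j + 1) (β a) = lowTail (j + m) j a
    - bpmf (j + m) (j + 1) (β a)), e5, stationaryPoint]
  field_simp
  ring

lemma stationaryPoint_mul_le (j m : ℕ) (hj : 1 ≤ j) (hm : 2 ≤ m) {a : ℝ}
    (ha : (j : ℝ) ≤ (j + m) * a) :
    stationaryPoint j m a * (1 - stationaryPoint j m a) ≤
      (((m : ℝ) - 1) * (j + 1) / (j * m)) ^ 2 * (a * (1 - a)) := by
  have hj0 : (1 : ℝ) ≤ j := by exact_mod_cast hj
  have hm0 : (2 : ℝ) ≤ m := by exact_mod_cast hm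
  have key : (((m : ℝ) - 1) * (j + 1) / (j * m)) ^ 2 * (a * (1 - a))
      - stationaryPoint j m a * (1 - stationaryPoint j m a)
      = (m - 1) / (j ^ 2 * m ^ 2) * ((j + 1) * (j + m - 1) * a - j ^ 2) := by
    unfold stationaryPoint
    field_simp
    ring
  have h1 : (j : ℝ) ^ 2 ≤ (j + 1) * (j + m - 1) * a := by
    refine le_of_mul_le_mul_left ?_ (by linarith : (0 : ℝ) < j + m)
    have h2 := mul_le_mul_of_nonneg_left ha
      (mul_nonneg (by linarith) (by linarith) : (0 : ℝ) ≤ (j + 1) * (j + m - 1))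
    nlinarith
  have h2 : 0 ≤ ((m : ℝ) - 1) / (j ^ 2 * m ^ 2) * ((j + 1) * (j + m - 1) * a - j ^ 2) :=
    mul_nonneg (div_nonneg (by linarith) (by positivity)) (by linarith)
  linarith

lemma pow_mul_pow_le_of_mode_le (i q : ℕ) (hq : 1 ≤ q) {x y : ℝ} (hx : 0 ≤ x)
    (hx' : (i : ℝ) + 1 ≤ (i + 1 + q) * x) (hxy : x ≤ y) (hy : y ≤ 1) :
    y ^ (i + 1) * (1 - y) ^ q ≤ x ^ (i + 1) * (1 - x) ^ q := by
  obtain ⟨r, rfl⟩ : ∃ r, q = r + 1 := ⟨q - 1, by omega⟩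
  have hd : ∀ t : ℝ, HasDerivAt (fun t : ℝ => t ^ (i + 1) * (1 - t) ^ (r + 1))
      (t ^ i * (1 - t) ^ r * ((i + 1) - (i + 1 + (r + 1)) * t)) t := fun t => by
    refine ((hasDerivAt_pow (i + 1) t).mul
      (((hasDerivAt_id t).const_sub 1).fun_pow (r + 1))).congr_deriv ?_
    simp only [id, Nat.add_sub_cancel]
    push_cast
    ring
  have hanti : AntitoneOn (fun t : ℝ => t ^ (i + 1) * (1 - t) ^ (r + 1)) (Icc x 1) := by
    refine antitoneOn_of_deriv_nonpos (convex_Icc _ _)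
      (fun t _ => (hd t).continuousAt.continuousWithinAt)
      (fun t _ => (hd t).differentiableAt.differentiableWithinAt) fun t ht => ?_
    rw [interior_Icc] at ht
    rw [(hd t).deriv]
    have h1 : 0 ≤ t := by linarith [ht.1]
    have h2 : 0 ≤ 1 - t := by linarith [ht.2]
    refine mul_nonpos_of_nonneg_of_nonpos (by positivity) ?_
    push_cast at hx'
    have : ((i : ℝ) + 1 + (r + 1)) * x ≤ (i + 1 + (r + 1)) * t :=
      mul_le_mul_of_nonneg_left ht.1.le (by positivity)
    linarith
  exact hanti ⟨le_rfl, hxy.trans hy⟩ ⟨hxy, hy⟩ hxy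

lemma hasDerivAt_stationaryPoint (j m : ℕ) (x : ℝ) :
    HasDerivAt (stationaryPoint j m) (((m : ℝ) - 1) * (j + 1) / (j * m)) x := by
  have := ((hasDerivAt_id x).const_mul (((m : ℝ) - 1) * (j + 1) / (j * m))).add_const (1 / (m : ℝ))
  rwa [mul_one] at this

/-- Up to a constant, this is the log-ratio of the two monomials of `lowInt_sub_sub_eq` along the
curve b = `stationaryPoint` a. With κ the slope of this curve, its derivative is ((j + m + 1) a -
j)(1 / (a (1 - a)) - κ² / (b (1 - b))), whose sign `stationaryPoint_mul_le` gives. -/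
lemma stationaryPoint_log_antitone (j m : ℕ) (hj : 1 ≤ j) (hm : 2 ≤ m) {x y : ℝ}
    (hx : (j : ℝ) ≤ (j + m) * x) (hxy : x ≤ y) (hy : y < 1) (hy' : stationaryPoint j m y < 1) :
    (j + 2) * Real.log (stationaryPoint j m y) + (m - 1) * Real.log (1 - stationaryPoint j m y)
      - j * Real.log y - (m + 1) * Real.log (1 - y) ≤
    (j + 2) * Real.log (stationaryPoint j m x) + (m - 1) * Real.log (1 - stationaryPoint j m x)
      - j * Real.log x - (m + 1) * Real.log (1 - x) := by
  have hj0 : (1 : ℝ) ≤ j := by exact_mod_cast hj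
  have hm0 : (2 : ℝ) ≤ m := by exact_mod_cast hm
  set κ := ((m : ℝ) - 1) * (j + 1) / (j * m) with hκ
  have hm1 : (0 : ℝ) < m - 1 := by linarith
  have hκ0 : 0 < κ := by positivity
  have hjm : (0 : ℝ) < j + m := by linarith
  have hx0 : 0 < x := by
    by_contra hcon
    nlinarith
  have hs : ∀ t, x ≤ t → 0 < stationaryPoint j m t := fun t ht => by
    have : 0 < t := by linarith
    unfold stationaryPoint
    positivity
  have hs1 : ∀ t, t ≤ y → stationaryPoint j m t < 1 := fun t ht => by
    refine lt_of_le_of_lt ?_ hy'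
    unfold stationaryPoint
    gcongr
  have hd : ∀ t ∈ Icc x y, HasDerivAt (fun t => (j + 2) * Real.log (stationaryPoint j m t)
      + (m - 1) * Real.log (1 - stationaryPoint j m t) - j * Real.log t
      - (m + 1) * Real.log (1 - t)) ((j + 2) * (κ / stationaryPoint j m t)
      + (m - 1) * (-κ / (1 - stationaryPoint j m t)) - j * (1 / t) - (m + 1) * (-1 / (1 - t))) t := by
    intro t ht
    have d := hasDerivAt_stationaryPoint j m t
    exact ((((d.log (hs t ht.1).ne').const_mul _).add (((d.const_sub 1).log
      (by linarith [hs1 t ht.2])).const_mul _)).sub (((hasDerivAt_id t).log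
      (by simp only [id]; linarith [ht.1])).const_mul _)).sub
      ((((hasDerivAt_id t).const_sub 1).log (by simp only [id]; linarith [ht.2])).const_mul _)
  have hanti := antitoneOn_of_deriv_nonpos (convex_Icc x y)
    (fun t ht => (hd t ht).continuousAt.continuousWithinAt)
    (fun t ht => (hd t (interior_subset ht)).differentiableAt.differentiableWithinAt) fun t ht => by
      have ht := interior_subset ht
      rw [(hd t ht).deriv]
      have ht0 : 0 < t := by linarith [ht.1]
      have ht1 : 0 < 1 - t := by linarith [ht.2]
      have hb0 := hs t ht.1
      have hb1 : 0 < 1 - stationaryPoint j m t := by linarith [hs1 t ht.2]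
      have hle : (j : ℝ) ≤ (j + m) * t :=
        hx.trans (mul_le_mul_of_nonneg_left ht.1 hjm.le)
      have key := stationaryPoint_mul_le j m hj hm hle
      rw [← hκ] at key
      have e : (j + m + 1) * stationaryPoint j m t - (j + 2) = κ * ((j + m + 1) * t - j) := by
        unfold stationaryPoint
        rw [hκ]
        field_simp
        ring
      set b := stationaryPoint j m t
      have hA : 0 ≤ ((j : ℝ) + m + 1) * t - j := by nlinarith
      have e2 : (j + 2) * (κ / b) + (m - 1) * (-κ / (1 - b)) - j * (1 / t) - (m + 1) * (-1 / (1 - t))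
          = ((j + m + 1) * t - j) / (t * (1 - t)) - κ * ((j + m + 1) * b - (j + 2)) / (b * (1 - b)) := by
        field_simp
        ring
      rw [e2, e, sub_nonpos, div_le_div_iff₀ (by positivity) (by positivity)]
      have := mul_le_mul_of_nonneg_left key hA
      linarith
  exact hanti ⟨le_rfl, hxy⟩ ⟨hxy, le_rfl⟩ hxy

end

/-! ### Propagation of the excess inequality from one point -/

section

open Set Filter Topology

section Anchor

variable {j m : ℕ} (hj : 1 ≤ j) (hm : 2 ≤ m) {s t : ℝ} (hs1 : s < 1)
  (hs : (j : ℝ) ≤ (j + m) * s) (ht : (j : ℝ) + 2 ≤ (j + m + 1) * t) (ht1 : t < 1)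
  (hG : lowTail (j + m) j s ≤ lowTail (j + m) (j + 2) t)
  (hφ : (m : ℝ) ^ 2 * t ^ (j + 2) * (1 - t) ^ (m - 1) < (j + 1) ^ 2 * s ^ j * (1 - s) ^ (m + 1))
include hj hm hs1 hs ht ht1 hG hφ

/-- If the excess over matched points is positive at one point beyond the mean, then it is
nonnegative at all points to the right. -/
lemma excess_nonneg_of_matched {β : ℝ → ℝ}
    (hβ : ∀ a ∈ Ioo (0 : ℝ) 1, a < β a ∧ β a < 1 ∧
      lowTail (j + m) (j + 2) (β a) = lowTail (j + m) j a) {a : ℝ} (ha : s ≤ a) (ha1 : a < 1) :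
    0 ≤ lowInt (j + m) (j + 1) (β a) - lowInt (j + m) (j + 1) a
      - lowTail (j + m) j a * (β a - a) := by
  have hj0 : (1 : ℝ) ≤ j := by exact_mod_cast hj
  have hm0 : (2 : ℝ) ≤ m := by exact_mod_cast hm
  have hs0 : 0 < s := by
    by_contra hcon
    nlinarith
  have ht0 : 0 < t := by
    by_contra hcon
    nlinarith
  set E : ℝ → ℝ := fun x => lowInt (j + m) (j + 1) (β x) - lowInt (j + m) (j + 1) x
    - lowTail (j + m) j x * (β x - x) with hE
  have hmem : ∀ {x}, s ≤ x → x < 1 → x ∈ Ioo (0 : ℝ) 1 := fun h1 h2 => ⟨by linarith, h2⟩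
  have hC : (0 : ℝ) < ((j + m).choose j : ℝ) / (j + 1) := by
    have : 0 < (j + m).choose j := Nat.choose_pos (by omega)
    positivity
  have hn1 : (0 : ℝ) < ((j + m : ℕ) : ℝ) + 1 := by positivity
  have hEq : ∀ {x}, x ∈ Ioo (0 : ℝ) 1 → (((j + m : ℕ) : ℝ) + 1) * E x =
      ((j + m).choose j : ℝ) / (j + 1) * ((j + 1) ^ 2 * x ^ j * (1 - x) ^ (m + 1)
        - m ^ 2 * (β x) ^ (j + 2) * (1 - β x) ^ (m - 1)) := fun {x} hx =>
    lowInt_sub_sub_eq j m (by omega) (hβ x hx).2.2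
  have hanti := lowTail_strictAntiOn (j + m) j hj (by omega)
  have hanti2 := lowTail_strictAntiOn (j + m) (j + 2) (by omega) (by omega)
  have htβ : ∀ {x}, s ≤ x → x < 1 → t ≤ β x := fun {x} h1 h2 => by
    obtain ⟨h3, h4, h5⟩ := hβ x (hmem h1 h2)
    refine (hanti2.le_iff_ge ⟨by linarith, h4.le⟩ ⟨ht0.le, ht1.le⟩).1 ?_
    rw [h5]
    exact (hanti.antitoneOn ⟨hs0.le, hs1.le⟩ ⟨by linarith, h2.le⟩ h1).trans hG
  have hmono : ∀ {x y : ℝ}, t ≤ x → x ≤ y → y ≤ 1 → (m : ℝ) ^ 2 * y ^ (j + 2) * (1 - y) ^ (m - 1) ≤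
      m ^ 2 * x ^ (j + 2) * (1 - x) ^ (m - 1) := fun {x y} h1 h2 h3 => by
    have h4 : ((j + 1 : ℕ) : ℝ) + 1 ≤ ((j + 1 : ℕ) + 1 + (m - 1 : ℕ)) * x := by
      rw [Nat.cast_sub (by omega)]
      push_cast
      nlinarith
    have := pow_mul_pow_le_of_mode_le (j + 1) (m - 1) (by omega) (by linarith) h4 h2 h3
    rw [mul_assoc, mul_assoc]
    gcongr
  have hcont : ∀ {x}, x ∈ Ioo (0 : ℝ) 1 → ContinuousAt E x := fun hx =>
    (hasDerivAt_excess j m hj hm hβ hx).continuousAt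
  have hEs : 0 < E s := by
    have hsm := hmem le_rfl hs1
    refine pos_of_mul_pos_right (a := ((j + m : ℕ) : ℝ) + 1) ?_ hn1.le
    rw [hEq hsm]
    have := hmono le_rfl (htβ le_rfl hs1) (hβ s hsm).2.1.le
    exact mul_pos hC (by linarith)
  by_contra hcon
  have hneg : E a < 0 := not_le.1 hcon
  have hlow : ∀ {x}, x ∈ Ioo (0 : ℝ) 1 → -(1 - x) ≤ E x := fun {x} hx => by
    obtain ⟨h1, h2, -⟩ := hβ x hx
    have h3 := lt_lowInt_sub (j + m) (j + 1) (by omega) (by omega) hx.1.le h1 h2.le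
    have h4 := lowTail_nonneg (j + m) (j + 1) (by linarith [hx.1]) h2.le
    have h5 : lowTail (j + m) j x ≤ 1 := by
      rw [← lowTail_at_zero (j + m) j hj]
      exact hanti.antitoneOn ⟨le_rfl, zero_le_one⟩ ⟨hx.1.le, hx.2.le⟩ hx.1.le
    have h6 : 0 ≤ lowTail (j + m) (j + 1) (β x) * (β x - x) := mul_nonneg h4 (by linarith)
    have h7 : lowTail (j + m) j x * (β x - x) ≤ 1 * (β x - x) :=
      mul_le_mul_of_nonneg_right h5 (by linarith)
    simp only [hE]
    linarith
  -- Since E x ≥ -(1 - x), the value at c is at least E a / 2 > E a; so the minimum over [s, c] is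
  -- interior, and β agrees there with the stationary point.
  set c := 1 + E a / 2 with hc
  have hac : a < c := by
    have := hlow (hmem ha ha1)
    linarith
  have hc1 : c < 1 := by linarith
  obtain ⟨x, hx, hmin⟩ := isCompact_Icc.exists_isMinOn (nonempty_Icc.2 (ha.trans hac.le))
    (fun y (hy : y ∈ Icc s c) =>
      (hcont (hmem hy.1 (hy.2.trans_lt hc1))).continuousWithinAt)
  have hxa : E x ≤ E a := hmin ⟨ha, hac.le⟩
  have hxs : s < x := by
    rcases hx.1.eq_or_lt with rfl | h
    · linarith
    · exact h
  have hxc : x < c := by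
    rcases hx.2.eq_or_lt with h | h
    · have := hlow (hmem hx.1 (hx.2.trans_lt hc1))
      rw [h] at this hxa
      linarith
    · exact h
  have hx1 : x < 1 := hxc.trans hc1
  have hxm := hmem hx.1 hx1
  have hf : ∀ {y}, y ∈ Ioo (0 : ℝ) 1 → 0 < tdens (j + m) j y * (m / (m - 1)) := fun hy =>
    mul_pos (tdens_pos (j + m) j hj (by omega) hy.1 hy.2) (div_pos (by linarith) (by linarith))
  have hstat : β x = stationaryPoint j m x := by
    have h0 := (hmin.isLocalMin (Icc_mem_nhds hxs hxc)).hasDerivAt_eq_zero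
      (hasDerivAt_excess j m hj hm hβ hxm)
    rcases mul_eq_zero.1 h0 with h | h
    · exact absurd h (hf hxm).ne'
    · linarith
  -- the last zero before the minimum
  have hz : ∃ z ∈ Ioo s x, E z = 0 ∧ ∀ y ∈ Ioo z x, E y < 0 := by
    have hK : IsCompact (Icc s x ∩ E ⁻¹' {0}) := by
      refine isCompact_Icc.of_isClosed_subset ?_ inter_subset_left
      exact ContinuousOn.preimage_isClosed_of_isClosed
        (fun y hy => (hcont (hmem hy.1 (hy.2.trans_lt hx1))).continuousWithinAt) isClosed_Icc
        isClosed_singleton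
    have hcon : ∀ {y}, s ≤ y → y ≤ x → ContinuousOn E (Icc y x) := fun h1 _ z hz =>
      (hcont (hmem (h1.trans hz.1) (hz.2.trans_lt hx1))).continuousWithinAt
    have hne : (Icc s x ∩ E ⁻¹' {0}).Nonempty := by
      obtain ⟨z, hz, e⟩ := intermediate_value_Icc' hx.1 (hcon le_rfl hx.1)
        (⟨by linarith, hEs.le⟩ : (0 : ℝ) ∈ Icc (E x) (E s))
      exact ⟨z, hz, e⟩
    obtain ⟨z, ⟨hz1, hz2⟩, hz3⟩ := hK.exists_isGreatest hne
    have hz2 : E z = 0 := hz2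
    have hzs : s < z := by
      rcases hz1.1.eq_or_lt with h | h
      · rw [← h] at hz2; linarith
      · exact h
    have hzx : z < x := by
      rcases hz1.2.eq_or_lt with h | h
      · rw [h] at hz2; linarith
      · exact h
    refine ⟨z, ⟨hzs, hzx⟩, hz2, fun y hy => ?_⟩
    by_contra hcon2
    have hys : s ≤ y := (hzs.trans hy.1).le
    obtain ⟨w, hw, e⟩ := intermediate_value_Icc' hy.2.le (hcon hys hy.2.le)
      (⟨by linarith, not_lt.1 hcon2⟩ : (0 : ℝ) ∈ Icc (E x) (E y))
    have := hz3 ⟨⟨hys.trans hw.1, hw.2⟩, e⟩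
    linarith [hw.1, hy.1]
  obtain ⟨z, hz, hEz, hzneg⟩ := hz
  have hz1 : z < 1 := hz.2.trans hx1
  have hzm := hmem hz.1.le hz1
  -- E is negative to the right of its zero z, so its derivative at z is not positive.
  have hle : β z ≤ stationaryPoint j m z := by
    by_contra hcon2
    have hpos := mul_pos (hf hzm) (sub_pos.2 (not_le.1 hcon2))
    have hev := (hasDerivAt_iff_tendsto_slope.1 (hasDerivAt_excess j m hj hm hβ hzm)).eventually_const_lt hpos
    have hev2 : ∀ᶠ y in 𝓝[>] z, 0 < slope E z y := nhdsWithin_mono _ (fun y hy => ne_of_gt hy) hev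
    obtain ⟨y, hy1, hy2⟩ := (hev2.and (Ioo_mem_nhdsGT hz.2)).exists
    rw [slope_def_field, hEz, sub_zero, div_pos_iff_of_pos_right (by linarith [hy2.1])] at hy1
    linarith [hzneg y hy2]
  obtain ⟨hβx1, hβx2, -⟩ := hβ x hxm
  have hsz : stationaryPoint j m z ≤ stationaryPoint j m x := by
    unfold stationaryPoint
    have : (0 : ℝ) ≤ m - 1 := by linarith
    have := hz.2.le
    gcongr
  have hsx1 : stationaryPoint j m x < 1 := hstat ▸ hβx2
  have htz := htβ hz.1.le hz1
  have hlog := stationaryPoint_log_antitone j m hj hm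
    (hs.trans (mul_le_mul_of_nonneg_left hz.1.le (by positivity))) hz.2.le hx1 hsx1
  have hEx : E x < 0 := hxa.trans_lt hneg
  have h1 : (j + 1 : ℝ) ^ 2 * x ^ j * (1 - x) ^ (m + 1) <
      m ^ 2 * (stationaryPoint j m x) ^ (j + 2) * (1 - stationaryPoint j m x) ^ (m - 1) := by
    have := hEq hxm
    rw [hstat] at this
    by_contra hcon2
    have h2 : 0 ≤ ((j + m).choose j : ℝ) / (j + 1) * ((j + 1) ^ 2 * x ^ j * (1 - x) ^ (m + 1)
      - m ^ 2 * (stationaryPoint j m x) ^ (j + 2) * (1 - stationaryPoint j m x) ^ (m - 1)) :=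
      mul_nonneg hC.le (by linarith)
    rw [← this] at h2
    exact absurd h2 (not_le.2 (mul_neg_of_pos_of_neg hn1 hEx))
  -- At the zero z the monomials agree at β z, and the right one decreases beyond its mode. So along
  -- the stationary curve the log-ratio is at most 0 at z but positive at x > z, against its
  -- monotonicity.
  have h2 : (m : ℝ) ^ 2 * (stationaryPoint j m z) ^ (j + 2) * (1 - stationaryPoint j m z) ^ (m - 1) ≤
      (j + 1) ^ 2 * z ^ j * (1 - z) ^ (m + 1) := by
    have := hEq hzm
    rw [hEz, mul_zero, eq_comm, mul_eq_zero] at this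
    rcases this with h | h
    · exact absurd h hC.ne'
    · have := hmono htz hle (hsz.trans hsx1.le)
      linarith
  have hlogeq : ∀ {y b : ℝ}, 0 < y → y < 1 → 0 < b → b < 1 →
      Real.log (m ^ 2 * b ^ (j + 2) * (1 - b) ^ (m - 1)) -
        Real.log ((j + 1 : ℝ) ^ 2 * y ^ j * (1 - y) ^ (m + 1)) =
      (Real.log (m ^ 2) - Real.log ((j + 1) ^ 2)) + ((j + 2) * Real.log b + (m - 1) * Real.log (1 - b)
        - j * Real.log y - (m + 1) * Real.log (1 - y)) := fun {y b} hy hy1 hb hb1 => by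
    have h3 : 0 < 1 - y := by linarith
    have h4 : 0 < 1 - b := by linarith
    rw [Real.log_mul (by positivity) (by positivity), Real.log_mul (by positivity) (by positivity),
      Real.log_mul (by positivity) (by positivity), Real.log_mul (by positivity) (by positivity),
      Real.log_pow b, Real.log_pow (1 - b), Real.log_pow y, Real.log_pow (1 - y),
      Nat.cast_sub (by omega : 1 ≤ m)]
    push_cast
    ring
  have hzpos : 0 < stationaryPoint j m z := by linarith
  have hz1' : 0 < 1 - stationaryPoint j m z := by linarith
  have hx1' : 0 < 1 - x := by linarith
  have l1 := Real.log_lt_log (by have := hxm.1; positivity) h1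
  have l2 := Real.log_le_log (by positivity) h2
  have e1 := hlogeq hxm.1 hx1 (hstat ▸ by linarith [hxm.1] : 0 < stationaryPoint j m x) hsx1
  have e2 := hlogeq hzm.1 hz1 hzpos (by linarith)
  linarith

lemma lowTail_mul_le_of_anchor {a b : ℝ} (ha : s ≤ a) (hab : a < b) (hb : b < 1)
    (h : lowTail (j + m) (j + 2) b = lowTail (j + m) j a) :
    lowTail (j + m) j a * (b - a) ≤ lowInt (j + m) (j + 1) b - lowInt (j + m) (j + 1) a := by
  choose! β hβ using fun a => exists_matched (n := j + m) hj (by omega) (a := a)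
  have hs0 : 0 < s := by
    have hj0 : (1 : ℝ) ≤ j := by exact_mod_cast hj
    by_contra hcon
    have : 0 ≤ ((j : ℝ) + m) * -s := mul_nonneg (by positivity) (by linarith)
    linarith
  obtain ⟨h1, h2, h3⟩ := hβ a ⟨by linarith, by linarith⟩
  have e : β a = b := (lowTail_strictAntiOn (j + m) (j + 2) (by omega) (by omega)).injOn
    ⟨by linarith, h2.le⟩ ⟨by linarith, hb.le⟩ (h3.trans h.symm)
  have := excess_nonneg_of_matched hj hm hs1 hs ht ht1 hG hφ hβ ha (by linarith)
  rw [e] at this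
  linarith

end Anchor

end

/-! ### Consequences of the certificates -/

section

open Set Filter Topology

lemma pairCheck_of_range {j m : ℕ} (hj : 1 ≤ j) (hm : 2 ≤ m) (hn : j + m ≤ 200) :
    pairCheck j m = true := by
  have row : ∀ n i k, k < i → pairRow n i = true → pairCheck (k + 1) (n - (k + 1)) = true := by
    intro n i
    induction i with
    | zero => intro k hk; omega
    | succ i ih =>
      intro k hk h
      have h' : Bool.and (pairCheck (i + 1) (n - (i + 1))) (pairRow n i) = true := h
      rw [Bool.and_eq_true] at h'
      rcases Nat.lt_succ_iff_lt_or_eq.1 hk with h1 | rfl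
      · exact ih k h1 h'.2
      · exact h'.1
  have rows : ∀ i k, k < i → pairRange i = true → pairRow (k + 3) (k + 1) = true := by
    intro i
    induction i with
    | zero => intro k hk; omega
    | succ i ih =>
      intro k hk h
      have h' : Bool.and (pairRow (i + 3) (i + 1)) (pairRange i) = true := h
      rw [Bool.and_eq_true] at h'
      rcases Nat.lt_succ_iff_lt_or_eq.1 hk with h1 | rfl
      · exact ih k h1 h'.2
      · exact h'.1
  have h := row _ _ (j - 1) (by omega) (rows 198 (j + m - 3) (by omega) pairRange_true)
  rwa [show j - 1 + 1 = j by omega, show j + m - 3 + 3 - j = m by omega] at h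

lemma topCheck_of_range {n : ℕ} (hn : 4 ≤ n) (hn' : n ≤ 200) : topCheck n = true := by
  have key : ∀ i k, k < i → topRange i = true → topCheck (k + 4) = true := by
    intro i
    induction i with
    | zero => intro k hk; omega
    | succ i ih =>
      intro k hk h
      have h' : Bool.and (topCheck (i + 4)) (topRange i) = true := h
      rw [Bool.and_eq_true] at h'
      rcases Nat.lt_succ_iff_lt_or_eq.1 hk with h1 | rfl
      · exact ih k h1 h'.2
      · exact h'.1
  have h := key 197 (n - 4) (by omega) topRange_true
  rwa [show n - 4 + 4 = n by omega] at h

lemma cast_rightNum (j m : ℕ) (hm : 1 ≤ m) {t : ℕ} (ht : t ≤ gridDen) :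
    (rightNum j m t : ℝ) = (m ^ 2 * (t / gridDen : ℝ) ^ (j + 2) * (1 - t / gridDen) ^ (m - 1)) *
      (gridDen : ℝ) ^ (j + m + 1) := by
  have hD := gridDen_pos
  obtain ⟨k, rfl⟩ : ∃ k, m = k + 1 := ⟨m - 1, by omega⟩
  have e : rightNum j (k + 1) t = (k + 1) * (k + 1) * (t ^ (j + 2) * (gridDen - t) ^ k) := rfl
  have e1 : 1 - (t : ℝ) / gridDen = (gridDen - t) / gridDen := by field_simp
  rw [e, e1, div_pow, div_pow, show j + (k + 1) + 1 = (j + 2) + k by ring, pow_add (gridDen : ℝ) (j + 2)]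
  push_cast [Nat.cast_sub ht, Nat.add_sub_cancel]
  field_simp

lemma cast_leftNum (j m : ℕ) {t : ℕ} (ht : t ≤ gridDen) :
    (leftNum j m t : ℝ) = ((j + 1) ^ 2 * (t / gridDen : ℝ) ^ j * (1 - t / gridDen) ^ (m + 1)) *
      (gridDen : ℝ) ^ (j + m + 1) := by
  have hD := gridDen_pos
  have e : leftNum j m t = (j + 1) * (j + 1) * (t ^ j * (gridDen - t) ^ (m + 1)) := rfl
  have e1 : 1 - (t : ℝ) / gridDen = (gridDen - t) / gridDen := by field_simp
  rw [e, e1, div_pow, div_pow, show j + m + 1 = j + (m + 1) by ring, pow_add (gridDen : ℝ) j]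
  push_cast [Nat.cast_sub ht]
  field_simp

/-- Beyond some point at which `lowTail (j + m) j` is still at least `27 / 100`, the average of
`lowTail (j + m) (j + 1)` between two points with equal values of `lowTail (j + m) j` and
`lowTail (j + m) (j + 2)` is at least this value. -/
lemma exists_anchor {j m : ℕ} (hj : 1 ≤ j) (hm : 2 ≤ m) (hn : j + m ≤ 200) :
    ∃ s : ℝ, (34 ≤ j → s = largePoint j (j + m) / gridDen) ∧ 0 ≤ s ∧ s < 1 ∧
      27 / 100 ≤ lowTail (j + m) j s ∧ ∀ a b, s ≤ a → a < b → b < 1 →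
        lowTail (j + m) (j + 2) b = lowTail (j + m) j a →
        lowTail (j + m) j a * (b - a) ≤ lowInt (j + m) (j + 1) b - lowInt (j + m) (j + 1) a := by
  have hD := gridDen_pos
  obtain ⟨t, h⟩ : ∃ t, pairCheckAt j m (pairBase j m) t = true := ⟨_, pairCheck_of_range hj hm hn⟩
  have hbase : 34 ≤ j → pairBase j m = largePoint j (j + m) := fun h => by
    rw [pairBase, Nat.ble_eq_true_of_le h, cond_true]; rfl
  generalize pairBase j m = a at h hbase
  simp only [pairCheckAt, Bool.and_eq_true, Nat.ble_eq, Nat.succ_le_iff, rightLtLeft, Nat.mul_eq,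
    Nat.add_eq, Nat.succ_eq_add_one] at h
  obtain ⟨⟨h1, h2⟩, ⟨h3, h4⟩, h5, h6⟩ := h
  rw [tailCheck_iff (by omega)] at h5
  obtain ⟨h5, h7⟩ := h5
  have hs1 : (a : ℝ) / gridDen < 1 := by rw [div_lt_one hD]; exact_mod_cast h5
  have ht1 : (t : ℝ) / gridDen < 1 := by rw [div_lt_one hD]; exact_mod_cast h3
  refine ⟨a / gridDen, fun h => by rw [hbase h], natCast_grid_nonneg a, hs1, h7, ?_⟩
  intro x y hx hxy hy hxy'
  refine lowTail_mul_le_of_anchor hj (by omega) hs1 ?_ (t := t / gridDen) ?_ ht1 ?_ ?_ hx hxy hy hxy'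
  · rw [← mul_div_assoc, le_div_iff₀ hD]; exact_mod_cast h1
  · rw [← mul_div_assoc, le_div_iff₀ hD]; exact_mod_cast h2
  · rw [← Nat.cast_le (α := ℝ), cast_gridTail _ _ (by omega) h5, cast_gridTail _ _ (by omega) h3] at h6
    exact le_of_mul_le_mul_right h6 (by positivity)
  · rw [← Nat.cast_lt (α := ℝ), cast_rightNum _ _ (by omega) h3.le, cast_leftNum _ _ h5.le] at h4
    exact lt_of_mul_lt_mul_right h4 (by positivity)

/-- The first-order condition to the right of a member of a chain at the level `27 / 100`. -/
lemma IsLevelChain.isFirstOrderAt {j m : ℕ} (hj : 1 ≤ j) (hm : 1 ≤ m) (hn : j + m ≤ 200)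
    {u : ℕ → ℝ} (hu : IsLevelChain (j + m) j (27 / 100) u) {p : ℝ} (hp : u j ≤ p) (hp1 : p < 1) :
    IsFirstOrderAt j m p := by
  rcases Nat.lt_or_ge j 34 with hj34 | hj34
  · exact isFirstOrderAt_of_chain hj hm hn (by omega) hu hp hp1
  rcases hm.eq_or_lt with rfl | hm
  · have h : lowerCheck (j + 1) (j + 1) gridDen (largePoint j (j + 1)) = true :=
      topCheck_of_range (n := j + 1) (by omega) hn
    refine isFirstOrderAt_of_largePoint_le hj le_rfl (le_trans ?_ hp)
    refine le_left_of_lowerCheck (by omega) le_rfl h hu.nonneg (hu.lt j le_rfl (by omega)) ?_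
      (hu.avg j le_rfl (by omega))
    rw [div_self gridDen_pos.ne']
    exact hu.le_one
  · intro w v ℓ hw hwp hpv hv hℓ h1 h2
    obtain ⟨s, hs, hs0, hs1, hs2, -⟩ := exists_anchor hj hm hn
    have e1 := lt_lowAvg (j + m) j hj (by omega) hw hwp hp1.le
    -- Here G_j(p) < ℓ ≤ 27 / 100 ≤ G_j(s) with s given by `largePoint`, so p lies beyond s.
    refine isFirstOrderAt_of_largePoint_le hj (by omega) ?_ w v ℓ hw hwp hpv hv hℓ h1 h2
    rw [← hs hj34]
    by_contra hcon
    have := lowTail_strictAntiOn (j + m) j hj (by omega) ⟨hw.trans hwp.le, hp1.le⟩ ⟨hs0, hs1.le⟩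
      (not_le.1 hcon)
    linarith

end

/-! ### Room for a left neighbour -/

section

open Set Filter Topology

lemma lowTail_le_one (n j : ℕ) (hj : j ≤ n + 1) {p : ℝ} (h0 : 0 ≤ p) (h1 : p ≤ 1) :
    lowTail n j p ≤ 1 := by
  rw [← lowTail_full n p]
  exact monotone_nat_of_le_succ (f := fun j => lowTail n j p) (fun j => lowTail_le_succ n j h0 h1) hj

lemma lowInt_le_self (n j : ℕ) (hj : j ≤ n + 1) {p : ℝ} (h0 : 0 ≤ p) (h1 : p ≤ 1) :
    lowInt n j p ≤ p := by
  rcases h0.eq_or_lt with rfl | h0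
  · rw [lowInt_at_zero]
  obtain ⟨c, hc, h⟩ := exists_lowInt_sub n j hj h0
  rw [lowInt_at_zero] at h
  nlinarith [lowTail_le_one n j hj hc.1.le (hc.2.le.trans h1)]

/-- Markov's inequality for the binomial distribution. -/
lemma mul_one_sub_lowTail_le (n j : ℕ) (hj : j ≤ n) {p : ℝ} (h0 : 0 ≤ p) (h1 : p ≤ 1) :
    j * (1 - lowTail n j p) ≤ n * p := by
  rcases n with _ | n
  · obtain rfl : j = 0 := by omega
    simp
  have h : ((n : ℝ) + 1) * lowInt n j p = ∑ i ∈ Finset.range j, (1 - lowTail (n + 1) (i + 1) p) := by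
    rw [lowInt, mul_div_cancel₀ _ (by positivity)]
  have h2 : ∑ i ∈ Finset.range j, (1 - lowTail (n + 1) j p) ≤
      ∑ i ∈ Finset.range j, (1 - lowTail (n + 1) (i + 1) p) := by
    refine Finset.sum_le_sum fun i hi => ?_
    have := monotone_nat_of_le_succ (f := fun j => lowTail (n + 1) j p)
      (fun j => lowTail_le_succ (n + 1) j h0 h1) (Nat.succ_le_iff.2 (Finset.mem_range.1 hi))
    exact sub_le_sub_left this 1
  rw [Finset.sum_const, Finset.card_range, nsmul_eq_mul, ← h] at h2
  refine h2.trans ?_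
  push_cast
  exact mul_le_mul_of_nonneg_left (lowInt_le_self n j (by omega) h0 h1) (by positivity)

lemma lowAvg_zero_mul (n j : ℕ) {p : ℝ} (hp : 0 < p) : lowAvg n j 0 p * p = lowInt n j p := by
  have := lowInt_sub_eq n j hp
  rw [lowInt_at_zero] at this
  linarith

lemma bpmf_succ_mul (n j : ℕ) (hj : j < n) (p : ℝ) :
    (1 - p) * ((j + 1) * bpmf n (j + 1) p) = (n - j) * (p * bpmf n j p) := by
  have h1 := mul_tdens n (j + 1) p
  have h2 := one_sub_mul_tdens n j hj p
  push_cast at h1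
  rw [← h1]
  linear_combination p * h2

/-- By the closed form of `lowInt`, the claim is (m + 1) p P(X = j) ≤ j P(X > j). It is enough to
keep the probabilities of j + 1 and j + 2 on the right. -/
lemma lowTail_succ_le_lowAvg_zero (j m : ℕ) (hj : 1 ≤ j) (hm : 1 ≤ m) {p : ℝ} (hp1 : p < 1)
    (hp : (j : ℝ) + 2 ≤ (j * m + j + 2) * p) :
    lowTail (j + m) (j + 1) p ≤ lowAvg (j + m) j 0 p := by
  have hj0 : (1 : ℝ) ≤ j := by exact_mod_cast hj
  have hm0 : (1 : ℝ) ≤ m := by exact_mod_cast hm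
  have hp0 : 0 < p := by
    by_contra hcon
    have : ((j : ℝ) * m + j + 2) * p ≤ 0 := mul_nonpos_of_nonneg_of_nonpos (by positivity) (by linarith)
    linarith
  have hq : 0 < 1 - p := by linarith
  refine le_of_mul_le_mul_right ?_ hp0
  rw [lowAvg_zero_mul _ _ hp0]
  refine le_of_mul_le_mul_left ?_ (by positivity : (0 : ℝ) < (j + m : ℕ) + 1)
  rw [lowInt_eq (j + m) j hj (by omega), lowTail_succ]
  have hb := bpmf_pos (j + m) j (by omega) hp0 hp1
  have hb1 := bpmf_pos (j + m) (j + 1) (by omega) hp0 hp1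
  have e1 := bpmf_succ_mul (j + m) j (by omega) p
  push_cast at e1 ⊢
  have hT : bpmf (j + m) j p + bpmf (j + m) (j + 1) p +
      (m - 1) * p * bpmf (j + m) (j + 1) p / ((1 - p) * (j + 2)) ≤ 1 - lowTail (j + m) j p := by
    have h1 := lowTail_succ (j + m) j p
    have h2 := lowTail_succ (j + m) (j + 1) p
    rcases hm.eq_or_lt with rfl | hm
    · have := lowTail_full (j + 1) p
      simp only [Nat.cast_one, sub_self, zero_mul, zero_div]
      linarith
    · have h3 := lowTail_succ (j + m) (j + 2) p
      have h4 := lowTail_le_one (j + m) (j + 3) (by omega) hp0.le hp1.le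
      have e2 := bpmf_succ_mul (j + m) (j + 1) (by omega) p
      push_cast at e2
      have e3 : (m - 1) * p * bpmf (j + m) (j + 1) p / ((1 - p) * (j + 2)) = bpmf (j + m) (j + 2) p := by
        rw [div_eq_iff (by positivity)]
        linear_combination -e2
      rw [e3]
      linarith
  set b := bpmf (j + m) j p
  have e3 : bpmf (j + m) (j + 1) p = m * p * b / ((1 - p) * (j + 1)) := by
    rw [eq_div_iff (by positivity)]
    linear_combination e1
  rw [e3] at hT
  have key : (m + 1) * p * b ≤ j * (m * p * b / ((1 - p) * (j + 1)) +
      (m - 1) * p * (m * p * b / ((1 - p) * (j + 1))) / ((1 - p) * (j + 2))) := by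
    have e4 : j * (m * p * b / ((1 - p) * (j + 1)) +
      (m - 1) * p * (m * p * b / ((1 - p) * (j + 1))) / ((1 - p) * (j + 2))) =
        p * b * (j * m * ((1 - p) * (j + 2) + (m - 1) * p) / ((1 - p) ^ 2 * (j + 1) * (j + 2))) := by
      field_simp
    rw [e4, mul_assoc, mul_comm ((m : ℝ) + 1)]
    refine mul_le_mul_of_nonneg_left ?_ (by positivity)
    rw [le_div_iff₀ (by positivity)]
    have h1 : 0 ≤ (j * m * p - (j + 2) * (1 - p)) * (1 - p) * (j + 2 + (m - 1)) :=
      mul_nonneg (mul_nonneg (by linarith) hq.le) (by linarith)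
    have h2 : 0 ≤ j * m * (m - 1) * p ^ 2 := by
      have : (0 : ℝ) ≤ m - 1 := by linarith
      positivity
    linarith
  have := mul_le_mul_of_nonneg_left hT (by positivity : (0 : ℝ) ≤ j)
  linarith

lemma exp_neg_two_lt : Real.exp (-2) < 14 / 100 := by
  have h : Real.exp (-2) = (Real.exp 1)⁻¹ ^ 2 := by
    rw [← Real.exp_neg, ← Real.exp_nat_mul]; norm_num
  have h1 : (Real.exp 1)⁻¹ < 2.7⁻¹ := inv_strictAnti₀ (by norm_num) (by linarith [Real.exp_one_gt_d9])
  rw [h]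
  calc _ < (2.7⁻¹ : ℝ) ^ 2 := pow_lt_pow_left₀ h1 (by positivity) (by norm_num)
    _ ≤ _ := by norm_num

lemma lowInt_one (n : ℕ) (p : ℝ) : (n + 1) * lowInt n 1 p = 1 - (1 - p) ^ (n + 1) := by
  have h0 : (n : ℝ) + 1 ≠ 0 := by positivity
  rw [lowInt, mul_div_cancel₀ _ h0]
  simp [lowTail]

/-- Some point such that the average of `lowTail (j + m) j` is larger than `27 / 100` to the left
of it, and larger than `lowTail (j + m) (j + 1)` to the right of it. -/
lemma exists_avg_split (j m : ℕ) (hj : 1 ≤ j) (hm : 1 ≤ m) : ∃ p : ℝ, 0 < p ∧ p < 1 ∧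
    (j : ℝ) + 2 ≤ (j * m + j + 2) * p ∧ 27 / 100 ≤ lowAvg (j + m) j 0 p := by
  have hj0 : (1 : ℝ) ≤ j := by exact_mod_cast hj
  have hm0 : (1 : ℝ) ≤ m := by exact_mod_cast hm
  have hd : (0 : ℝ) < j * m + j + 2 := by positivity
  set p : ℝ := (j + 2) / (j * m + j + 2) with hp
  have hp0 : 0 < p := by positivity
  have hp1 : p < 1 := by rw [hp, div_lt_one hd]; nlinarith
  have hpe : (j : ℝ) + 2 = (j * m + j + 2) * p := by rw [hp, mul_div_cancel₀ _ hd.ne']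
  refine ⟨p, hp0, hp1, hpe.le, ?_⟩
  rcases hj.eq_or_lt with rfl | hj2
  -- For j = 1 Markov's inequality is too weak; the integral is explicit, and (1 - p)^(m + 2) ≤
  -- exp(-2) because (m + 2) p ≥ 2.
  · refine le_of_mul_le_mul_right ?_ hp0
    rw [lowAvg_zero_mul _ _ hp0]
    refine le_of_mul_le_mul_left ?_ (by positivity : (0 : ℝ) < (1 + m : ℕ) + 1)
    rw [lowInt_one]
    push_cast at hpe ⊢
    have h1 : (1 - p) ^ (1 + m + 1) ≤ Real.exp (-2) := by
      calc (1 - p) ^ (1 + m + 1) ≤ Real.exp (-p) ^ (1 + m + 1) :=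
            pow_le_pow_left₀ (by linarith) (Real.one_sub_le_exp_neg p) _
        _ = Real.exp ((1 + m + 1 : ℕ) * (-p)) := by rw [Real.exp_nat_mul]
        _ ≤ _ := by
          rw [Real.exp_le_exp]
          push_cast
          nlinarith
    have := exp_neg_two_lt
    nlinarith
  · refine le_trans ?_ (lowTail_succ_le_lowAvg_zero j m hj hm hp1 hpe.le)
    have hj2' : (2 : ℝ) ≤ j := by exact_mod_cast hj2
    have h := mul_one_sub_lowTail_le (j + m) (j + 1) (by omega) hp0.le hp1.le
    push_cast at h
    have h1 : (j + m) * p ≤ (j + 1) * (73 / 100) := by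
      rw [hp, ← mul_div_assoc, div_le_iff₀ hd]
      nlinarith [mul_nonneg (sub_nonneg.2 hj2') (sub_nonneg.2 hm0),
        mul_nonneg (mul_nonneg (sub_nonneg.2 hj2') (sub_nonneg.2 hj2')) (sub_nonneg.2 hm0)]
    have h2 := le_of_mul_le_mul_left (h.trans h1) (by positivity)
    linarith

/-- If a point has an admissible right neighbour at the level `α`, then there is room for a left
neighbour. -/
lemma lt_lowAvg_zero {n j : ℕ} (hj : 1 ≤ j) (hjn : j < n) {α p : ℝ} (hα : α ≤ 27 / 100)
    (hp0 : 0 < p) (hp1 : p < 1) (h : α < lowTail n (j + 1) p) : α < lowAvg n j 0 p := by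
  obtain ⟨m, rfl⟩ : ∃ m, n = j + m := ⟨n - j, by omega⟩
  obtain ⟨s, hs0, hs1, hs, h1⟩ := exists_avg_split j m hj (by omega)
  rcases lt_or_ge p s with hps | hps
  · have := lowAvg_lt_of_lt_right (j + m) j hj (by omega) le_rfl hp0 hps hs1.le
    linarith
  · refine h.trans_le (lowTail_succ_le_lowAvg_zero j m hj (by omega) hp1 (hs.trans ?_))
    gcongr

lemma lt_lowAvg_zero_top {n : ℕ} (hn : 1 ≤ n) {α p : ℝ} (hα : α ≤ 27 / 100)
    (hp0 : 0 < p) (hp1 : p ≤ 1) : α < lowAvg n n 0 p := by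
  have h1 : lowAvg n n 0 1 = n / (n + 1) := by
    rw [lowAvg, lowInt_at_one n n (by omega), lowInt_at_zero]; simp
  have h2 := lowAvg_le_lowAvg n n hn le_rfl le_rfl le_rfl one_pos hp0 hp1 le_rfl
  have hn0 : (1 : ℝ) ≤ n := by exact_mod_cast hn
  have h3 : (1 / 2 : ℝ) ≤ n / (n + 1) := by
    rw [div_le_div_iff₀ (by norm_num) (by positivity)]; linarith
  linarith

/-- With G_j(q) = α, the gain at p lies strictly between its values at 0 and at the peak q, so it is
also taken on (0, q). -/
lemma exists_left {n j : ℕ} (hj : 1 ≤ j) (hjn : j ≤ n) {α p : ℝ} (hα : α ≤ 1) (hp0 : 0 < p)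
    (hp1 : p ≤ 1) (h : lowTail n j p < α) (h' : α < lowAvg n j 0 p) :
    ∃ v, 0 < v ∧ v < p ∧ lowAvg n j v p = α := by
  obtain ⟨q, hq, hqα⟩ := intermediate_value_Icc' hp0.le (continuous_lowTail n j).continuousOn
    (⟨h.le, by rw [lowTail_at_zero n j hj]; exact hα⟩ : α ∈ Icc (lowTail n j p) (lowTail n j 0))
  have hqp : q < p := by
    rcases hq.2.eq_or_lt with e | e
    · rw [← e] at h; linarith
    · exact e
  have h1 := lowInt_sub_lt n j hj hjn hq.1 hqp hp1
  rw [hqα] at h1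
  have h2 := lowAvg_zero_mul n j hp0
  have h3 := mul_lt_mul_of_pos_right h' hp0
  obtain ⟨v, hv, hvα⟩ := intermediate_value_Ioo hq.1
    ((continuous_lowInt n j).sub (continuous_const.mul continuous_id)).continuousOn
    (show lowInt n j p - α * p ∈ Ioo (lowInt n j 0 - α * 0) (lowInt n j q - α * q) from
      ⟨by rw [lowInt_at_zero]; linarith, by linarith⟩)
  have hvp : v < p := hv.2.trans hqp
  refine ⟨v, hv.1, hvp, ?_⟩
  simp only [Pi.sub_apply, id, Pi.mul_apply] at hvα
  rw [lowAvg, div_eq_iff (by linarith)]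
  linarith

end

/-! ### Continuing a chain to the left -/

section

open Set Filter Topology

lemma lowTail_pred (n : ℕ) (p : ℝ) :
    lowTail (n + 1) n p = 1 - p ^ (n + 1) - (n + 1) * p ^ n * (1 - p) := by
  have h1 := lowTail_succ (n + 1) n p
  rw [lowTail_self] at h1
  have h2 : bpmf (n + 1) n p = (n + 1) * p ^ n * (1 - p) := by simp [bpmf]
  linarith

lemma mul_lowInt_self {n : ℕ} (hn : 1 ≤ n) (p : ℝ) :
    (n + 1) * lowInt n n p = (n + 1) * p - p ^ (n + 1) := by
  have h2 : bpmf n n p = p ^ n := by simp [bpmf]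
  rw [lowInt_eq n n hn le_rfl, lowTail_self, h2]
  ring

lemma succ_mul_pow_le {a : ℝ} (h0 : 0 ≤ a) (h1 : a ≤ 1) (n : ℕ) :
    (n + 1) * a ^ n ≤ n * a ^ (n + 1) + 1 := by
  induction n with
  | zero => simp
  | succ n ih =>
    have e1 := mul_le_mul_of_nonneg_right ih h0
    have e2 : 0 ≤ (1 - a) * (1 - a ^ (n + 1)) :=
      mul_nonneg (by linarith) (sub_nonneg.2 (pow_le_one₀ h0 h1))
    push_cast
    rw [pow_succ a (n + 1)]
    rw [pow_succ a n] at e1 e2 ⊢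
    linarith

/-- The trapezoidal rule for `k ↦ a ^ k`. -/
lemma one_sub_pow_le {a : ℝ} (h0 : 0 ≤ a) (h1 : a ≤ 1) (n : ℕ) :
    1 - a ^ (n + 1) ≤ (n + 1) * ((1 + a ^ n) / 2) * (1 - a) := by
  induction n with
  | zero => simp
  | succ n ih =>
    have e := mul_nonneg (sub_nonneg.2 (succ_mul_pow_le h0 h1 n)) (sub_nonneg.2 h1)
    push_cast
    rw [pow_succ a (n + 1)]
    linarith

lemma one_lt_pow_mul {x a : ℝ} {n : ℕ} (hn : 2 ≤ n) (hx : 0 < x) (ha : a * (1 + x / n) = 1)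
    (h : 73 / 100 ≤ a ^ n * (1 + x)) : 1 < a ^ n * (1 + 2 * x) := by
  have hn0 : (0 : ℝ) < n := by positivity
  have ha0 : 0 < a := by
    by_contra hcon
    have : a * (1 + x / n) ≤ 0 := mul_nonpos_of_nonpos_of_nonneg (not_lt.1 hcon) (by positivity)
    linarith
  -- Up to 3 / 5, a^n ≥ exp(-x) and exp x < 1 + 2 x suffice; beyond, the hypothesis suffices, as 73
  -- / 100 * (1 + 2 x) > 1 + x for x > 27 / 46.
  rcases le_or_gt x (3 / 5) with hx1 | hx1
  · have h1 : 1 ≤ a ^ n * Real.exp x := by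
      have e : a * Real.exp (x / n) ≥ 1 := by
        rw [← ha]
        have := Real.add_one_le_exp (x / n)
        exact mul_le_mul_of_nonneg_left (by linarith) ha0.le
      have e2 : Real.exp x = Real.exp (x / n) ^ n := by
        rw [← Real.exp_nat_mul, mul_div_cancel₀ _ hn0.ne']
      rw [e2, ← mul_pow]
      exact one_le_pow₀ e
    have h2 : Real.exp x < 1 + 2 * x := by
      have := (abs_le.1 (Real.abs_exp_sub_one_sub_id_le (x := x) (by rw [abs_of_pos hx]; linarith))).2
      nlinarith
    exact h1.trans_lt (mul_lt_mul_of_pos_left h2 (by positivity))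
  · have h1 : 73 / 100 * (1 + 2 * x) ≤ a ^ n * (1 + x) * (1 + 2 * x) :=
      mul_le_mul_of_nonneg_right h (by linarith)
    by_contra hcon
    have := mul_le_mul_of_nonneg_right (not_lt.1 hcon) (by linarith : 0 ≤ 1 + x)
    linarith

/-- The last link, where 1 takes the place of the matched point. The trapezoidal rule reduces it to
a^(n+1) (1 + 2x) > 1 with x = (n + 1)(1 - a) / a, while the hypothesis says a^(n+1) (1 + x) ≥ 73 /
100. -/
lemma lowTail_pred_mul_lt {n : ℕ} (hn : 1 ≤ n) {a : ℝ} (h0 : 0 < a) (h1 : a < 1)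
    (h : lowTail (n + 1) n a ≤ 27 / 100) :
    lowTail (n + 1) n a * (1 - a) < lowInt (n + 1) (n + 1) 1 - lowInt (n + 1) (n + 1) a := by
  have e := mul_lowInt_self (n := n + 1) (by omega) a
  have e1 := mul_lowInt_self (n := n + 1) (by omega) 1
  have e2 := one_sub_pow_le h0.le h1.le (n + 1)
  rw [lowTail_pred] at h ⊢
  have hx := one_lt_pow_mul (x := (n + 1) * ((1 - a) / a)) (a := a) (n := n + 1) (by omega)
    (by have : 0 < 1 - a := by linarith
        positivity) (by push_cast; field_simp; ring) (by
      have e3 : a ^ (n + 1) * (1 + (n + 1) * ((1 - a) / a)) = a ^ (n + 1) + (n + 1) * a ^ n * (1 - a) := by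
        rw [pow_succ]; field_simp
      rw [e3]; linarith)
  have e3 : a ^ (n + 1) * (1 + 2 * ((n + 1) * ((1 - a) / a))) =
      a ^ (n + 1) + 2 * ((n + 1) * a ^ n * (1 - a)) := by
    rw [pow_succ]; field_simp
  rw [e3] at hx
  refine lt_of_mul_lt_mul_left ?_ (by positivity : (0 : ℝ) ≤ (n + 1 : ℕ) + 1)
  rw [mul_sub (((n + 1 : ℕ) : ℝ) + 1) (lowInt _ _ _), e, e1]
  push_cast at e2 ⊢
  have e4 := mul_pos (mul_pos (sub_pos.2 hx) (by positivity : (0 : ℝ) < n + 1 + 1)) (sub_pos.2 h1)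
  rw [one_pow]
  linarith

/-- In a chain, the value of `lowTail n j` at the member with index `j` is below the level. -/
lemma IsLevelChain.lowTail_lt {n j : ℕ} (hj : 1 ≤ j) (hjn : j < n) (hn : n ≤ 200) {α : ℝ}
    (hα0 : 0 < α) (hα : α ≤ 27 / 100) {u : ℕ → ℝ} (hu : IsLevelChain n j α u) (hu0 : 0 < u j) :
    lowTail n j (u j) < α := by
  have hlt := hu.lt j le_rfl hjn
  have hav := hu.avg j le_rfl hjn
  have hu1 := hu.le_one' (i := j + 1) (by omega) (by omega)
  have hanti := lowTail_strictAntiOn n j hj hjn.le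
  have hanti' := lowTail_strictAntiOn n (j + 1) (by omega) hjn
  by_contra hcon
  obtain ⟨a, ha, haα⟩ := intermediate_value_Icc' (hlt.le.trans hu1) (continuous_lowTail n j).continuousOn
    (⟨by rw [lowTail_at_one n j hjn.le]; exact hα0.le, not_lt.1 hcon⟩ :
      α ∈ Icc (lowTail n j 1) (lowTail n j (u j)))
  have ha1 : a < 1 := by
    rcases ha.2.eq_or_lt with e | e
    · rw [e, lowTail_at_one n j hjn.le] at haα; linarith
    · exact e
  have ha0 : 0 < a := hu0.trans_le ha.1
  -- Otherwise G_{j+1} at u_{j+1} would be at least G_{j+1}(a) > G_j(a) = α, although it is below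
  -- the mean α.
  have hau : a < u (j + 1) := by
    by_contra hau
    have h1 := lowTail_lt_succ n j hjn.le ha0 ha1
    have h2 := lt_lowAvg n (j + 1) (by omega) hjn hu0.le hlt hu1
    have h3 := hanti'.antitoneOn ⟨(hu0.trans hlt).le, hu1⟩ ⟨ha0.le, ha1.le⟩ (not_lt.1 hau)
    linarith
  obtain ⟨b, hb1, hub, h⟩ : ∃ b ≤ 1, u (j + 1) ≤ b ∧
      (α < lowAvg n (j + 1) a b ∨ u (j + 1) < b ∧ α ≤ lowAvg n (j + 1) a b) := by
    rcases Nat.lt_or_ge (j + 1) n with hjn2 | hjn2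
    · obtain ⟨b, hab, hb1, hb⟩ := exists_matched hj hjn2 ⟨ha0, ha1⟩
      have hub : u (j + 1) < b := by
        by_contra hub
        have h1 := lowAvg_lt n (j + 2) (by omega) hjn2 (hu0.trans hlt).le
          (hu.lt (j + 1) (by omega) hjn2) (hu.le_one' (by omega) (by omega))
        rw [hu.avg (j + 1) (by omega) hjn2] at h1
        have h2 := (lowTail_strictAntiOn n (j + 2) (by omega) hjn2).antitoneOn
          ⟨(ha0.trans hab).le, hb1.le⟩ ⟨(hu0.trans hlt).le, hu1⟩ (not_lt.1 hub)
        linarith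
      refine ⟨b, hb1.le, hub.le, .inr ⟨hub, ?_⟩⟩
      obtain ⟨m, rfl⟩ : ∃ m, n = j + m := ⟨n - j, by omega⟩
      obtain ⟨s, -, hs0, hs1, hs, h⟩ := exists_anchor hj (by omega) hn
      have hsa : s ≤ a := by
        by_contra hsa
        have := hanti ⟨ha0.le, ha1.le⟩ ⟨hs0, hs1.le⟩ (not_le.1 hsa)
        linarith
      rw [lowAvg, le_div_iff₀ (by linarith), ← haα]
      exact h a b hsa hab hb1 hb
    · obtain rfl : n = j + 1 := by omega
      refine ⟨1, le_rfl, hu1, .inl ?_⟩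
      rw [lowAvg, lt_div_iff₀ (by linarith), ← haα]
      exact lowTail_pred_mul_lt hj ha0 ha1 (haα.trans_le hα)
  have h1 := lowAvg_le_lowAvg n (j + 1) (by omega) hjn hu0.le ha.1 hau hlt le_rfl hu1
  rcases h with h | ⟨hub, h⟩
  · have := lowAvg_le_lowAvg n (j + 1) (by omega) hjn ha0.le le_rfl (hau.trans_le hub) hau hub hb1
    linarith
  · have := lowAvg_lt_of_lt_right n (j + 1) (by omega) hjn ha0.le hau hub hb1
    linarith

/-- A chain can be continued to the left. -/
lemma IsLevelChain.exists_left {n j : ℕ} (hj : 1 ≤ j) (hjn : j ≤ n) (hn : n ≤ 200) {α : ℝ}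
    (hα0 : 0 < α) (hα : α ≤ 27 / 100) {u : ℕ → ℝ} (hu : IsLevelChain n j α u) (hu0 : 0 < u j)
    (htop : j = n → lowTail n n (u n) < α) : ∃ v, 0 < v ∧ v < u j ∧ lowAvg n j v (u j) = α := by
  rcases hjn.eq_or_lt with rfl | hjn
  · exact _root_.exists_left hj le_rfl (by linarith) hu0 hu.le_one (htop rfl)
      (lt_lowAvg_zero_top hj hα hu0 hu.le_one)
  · have hlt := hu.lt j le_rfl hjn
    have hu1 := hu.le_one' (i := j + 1) (by omega) (by omega)
    refine _root_.exists_left hj hjn.le (by linarith) hu0 (hlt.le.trans hu1)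
      (hu.lowTail_lt hj hjn hn hα0 hα hu0) (lt_lowAvg_zero hj hjn hα hu0 (hlt.trans_le hu1) ?_)
    rw [← hu.avg j le_rfl hjn]
    exact lowAvg_lt n (j + 1) (by omega) hjn hu0.le hlt hu1

lemma IsLevelChain.cons {n j : ℕ} {α : ℝ} {u : ℕ → ℝ} (hu : IsLevelChain n (j + 1) α u)
    (hjn : j + 1 ≤ n) {v : ℝ} (hv : 0 ≤ v) (hvu : v < u (j + 1))
    (h : lowAvg n (j + 1) v (u (j + 1)) = α) : IsLevelChain n j α (Function.update u j v) := by
  have e : ∀ i, j < i → Function.update u j v i = u i := fun i hi =>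
    Function.update_of_ne (by omega) _ _
  refine ⟨by simpa using hv, by rw [e n hjn]; exact hu.le_one, fun i hi hin => ?_, fun i hi hin => ?_⟩
  · rw [e (i + 1) (by omega)]
    rcases hi.eq_or_lt with rfl | hi
    · simpa using hvu
    · rw [e i hi]; exact hu.lt i hi hin
  · rw [e (i + 1) (by omega)]
    rcases hi.eq_or_lt with rfl | hi
    · simpa using h
    · rw [e i hi]; exact hu.avg i hi hin

/-- Provides, for any admissible last member, a chain at level 27 / 100 to compare with. -/
lemma exists_isLevelChain {n : ℕ} (hn : n ≤ 200) {α : ℝ} (hα0 : 0 < α) (hα : α ≤ 27 / 100) {c : ℝ}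
    (hc0 : 0 < c) (hc1 : c ≤ 1) (hc : lowTail n n c < α) {j : ℕ} (hjn : j ≤ n) :
    ∃ u, IsLevelChain n j α u ∧ u n = c ∧ 0 < u j := by
  induction hjn using Nat.decreasingInduction with
  | self => exact ⟨fun _ => c, ⟨hc0.le, hc1, fun i h1 h2 => by omega, fun i h1 h2 => by omega⟩, rfl, hc0⟩
  | of_succ j hjn ih =>
    obtain ⟨u, hu, huc, hu0⟩ := ih
    obtain ⟨v, hv0, hvu, h⟩ := hu.exists_left (by omega) hjn hn hα0 hα hu0 (fun _ => huc ▸ hc)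
    refine ⟨_, hu.cons hjn hv0.le hvu h, ?_, by simpa using hv0⟩
    rw [Function.update_of_ne (by omega), huc]

end

/-! ### Monotonicity in the level -/

section

open Set Filter Topology

/-- The computations concern the chain at level 27 / 100 only. If that chain with the same last
member lies to the left, as the induction supplies through `hle`, the condition carries over. -/
lemma IsLevelChain.isFirstOrderAt_of_le {n j m : ℕ} (hj : 1 ≤ j) (hm : 1 ≤ m) (e : j + m = n)
    (hn : n ≤ 200) {α : ℝ} (hα0 : 0 < α) (hα : α ≤ 27 / 100) {u : ℕ → ℝ} (hu : IsLevelChain n j α u)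
    (hle : ∀ u' : ℕ → ℝ, α < 27 / 100 → IsLevelChain n j (27 / 100) u' → u' n = u n → u' j ≤ u j)
    {p : ℝ} (hp : u j ≤ p) (hp1 : p < 1) : IsFirstOrderAt j m p := by
  subst e
  rcases hα.eq_or_lt with rfl | hα
  · exact hu.isFirstOrderAt hj hm hn hp hp1
  · have hc : 0 ≤ u (j + m - 1) := (hu.tail (by omega) (by omega)).nonneg
    have h1 := hu.lt (j + m - 1) (by omega) (by omega)
    have h2 := hu.avg (j + m - 1) (by omega) (by omega)
    rw [show j + m - 1 + 1 = j + m by omega] at h1 h2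
    have h3 := lt_lowAvg (j + m) (j + m) (by omega) le_rfl hc h1 hu.le_one
    obtain ⟨u', hu', he, -⟩ := exists_isLevelChain hn (by norm_num) le_rfl (hc.trans_lt h1)
      hu.le_one (by linarith) (by omega : j ≤ j + m)
    exact hu'.isFirstOrderAt hj hm hn ((hle u' hα hu' he).trans hp) hp1

/-- The members of a chain with a given last member decrease as the level grows. -/
lemma IsLevelChain.lt_of_level_lt {n : ℕ} (hn : n ≤ 200) (d : ℕ) : ∀ j, j + d = n →
    ∀ (α α' : ℝ) (u u' : ℕ → ℝ), 0 < α → α < α' → α' ≤ 27 / 100 → IsLevelChain n j α u →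
      IsLevelChain n j α' u' → u' n = u n → u' j ≤ u j ∧ (j < n → u' j < u j) := by
  induction d using Nat.strong_induction_on with
  | _ d ih =>
    intro j hjd α α' u u' hα0 hα hα' hu hu' huu
    rcases Nat.eq_zero_or_pos d with rfl | hd
    · obtain rfl : j = n := by omega
      exact ⟨huu.le, fun h => absurd h (lt_irrefl j)⟩
    suffices u' j < u j from ⟨this.le, fun _ => this⟩
    have h1 := hu.lt j le_rfl (by omega)
    have h2 := hu.avg j le_rfl (by omega)
    have h1' := hu'.lt j le_rfl (by omega)
    have h2' := hu'.avg j le_rfl (by omega)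
    rcases Nat.lt_or_ge (j + 1) n with hjn | hjn
    -- The inequality is not strict here, as j + 2 may be n, where both chains agree.
    · have hv : u' (j + 2) ≤ u (j + 2) := (ih (d - 2) (by omega) (j + 2) (by omega) α α' u u' hα0 hα hα'
        (hu.tail (by omega) hjn) (hu'.tail (by omega) hjn) huu).1
      have h3 := hu.lt (j + 1) (by omega) hjn
      have hv1 := hu.le_one' (i := j + 2) (by omega) hjn
      refine lt_of_two_steps n (j + 1) (by omega) hjn hα hu.nonneg h1 h3 hv1
        hu'.nonneg h1' (hu'.lt (j + 1) (by omega) hjn) hv h2 (hu.avg (j + 1) (by omega) hjn)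
        h2' (hu'.avg (j + 1) (by omega) hjn) ?_
      intro z hz hwz ℓ hℓ e1 e2
      have hzv : z < u (j + 2) := hz.2.trans_lt h3
      obtain ⟨m, rfl⟩ : ∃ m, n = j + 1 + m := ⟨n - (j + 1), by omega⟩
      have := (hu'.tail (i := j + 1) (by omega) (by omega)).isFirstOrderAt_of_le (m := m) (by omega)
        (by omega) rfl hn (hα0.trans hα) hα' (fun v hα2 hv he =>
          (ih (d - 1) (by omega) (j + 1) (by omega) α' (27 / 100) u' v (hα0.trans hα) hα2 le_rfl
            (hu'.tail (by omega) (by omega)) hv he).1) hz.1 (hzv.trans_le hv1)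
      exact this _ _ ℓ hu.nonneg hwz hzv hv1 (hℓ.trans hα') e1 e2
    -- Only one link remains: with a common right end, a larger mean forces a smaller left end.
    · obtain rfl : n = j + 1 := by omega
      by_contra hcon
      have := lowAvg_le_lowAvg (j + 1) (j + 1) (by omega) le_rfl hu.nonneg (not_lt.1 hcon) h1' h1
        huu.ge hu'.le_one
      linarith

lemma IsEndpointChain.isLevelChain {n j : ℕ} {α : ℝ} {u : ℕ → ℝ} (hu : IsEndpointChain n j α u) :
    IsLevelChain n j α u := by
  have hlt : ∀ i, j ≤ i → i < n → u i < u (i + 1) := fun i hi hin => by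
    simpa using hu.lt (i + 1) (Finset.mem_Icc.2 ⟨by omega, by omega⟩)
  refine ⟨hu.pos.le, hu.le_one, hlt, fun i hi hin => ?_⟩
  rw [← avgCoverage_eq_iff' n (i + 1) (by omega) (hlt i hi hin)]
  simpa using hu.avg_eq (i + 1) (Finset.mem_Icc.2 ⟨by omega, by omega⟩)

end

/-- First part: the backward step from `u j` to `u (j - 1)`, for `j = n, n - 1, …, 1`; for the
initial step `j = n`, where there is no equation yet, the starting value is `u n = 1`.
Second part: for a fixed value `c` of the last endpoint (for instance `c = 1`), every `u j` with
`j < n` is strictly decreasing in `α`, wherever `u j, …, u n` are defined. -/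
theorem proposition1 (n : ℕ) (hn : 1 ≤ n) (hn' : n ≤ 200) :
    (∀ α ∈ Set.Ioo (0.0001 : ℝ) 0.27, ∀ j ∈ Finset.Icc 1 n, ∀ u : ℕ → ℝ,
      IsEndpointChain n j α u → (j = n → u n = 1) →
        ∃! v : ℝ, (0 < v ∧ v < u j) ∧ avgCoverage n j v (u j) = 1 - α) ∧
    (∀ c : ℝ, ∀ u : ℝ → ℕ → ℝ, ∀ j < n,
      StrictAntiOn (fun α => u α j)
        {α | α ∈ Set.Ioo (0.0001 : ℝ) 0.27 ∧ IsEndpointChain n j α (u α) ∧ u α n = c}) := by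
  have hlo : ∀ {α : ℝ}, α ∈ Set.Ioo (0.0001 : ℝ) 0.27 → 0 < α := fun h =>
    lt_trans (by norm_num) h.1
  have hhi : ∀ {α : ℝ}, α ∈ Set.Ioo (0.0001 : ℝ) 0.27 → α ≤ 27 / 100 := fun h =>
    h.2.le.trans (by norm_num)
  refine ⟨fun α hα j hj u hu htop => ?_, fun c u j hj α hα α' hα' hlt => ?_⟩
  · obtain ⟨hj1, hjn⟩ := Finset.mem_Icc.1 hj
    have hu1 := hu.isLevelChain.le_one' le_rfl hjn
    obtain ⟨v, hv0, hvu, hv⟩ := hu.isLevelChain.exists_left hj1 hjn hn' (hlo hα) (hhi hα) hu.pos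
      (fun h => by rw [htop h, lowTail_at_one n n le_rfl]; exact hlo hα)
    refine ⟨v, ⟨⟨hv0, hvu⟩, (avgCoverage_eq_iff' n j (by omega) hvu α).2 hv⟩, ?_⟩
    rintro w ⟨⟨hw0, hwu⟩, hw⟩
    rw [avgCoverage_eq_iff' n j (by omega) hwu] at hw
    rcases lt_trichotomy w v with h | h | h
    · have := lowAvg_lt_of_left_lt n j hj1 hjn hw0.le h hvu hu1
      linarith
    · exact h
    · have := lowAvg_lt_of_left_lt n j hj1 hjn hv0.le h hwu hu1
      linarith
  · exact (IsLevelChain.lt_of_level_lt hn' (n - j) j (by omega) α α' (u α) (u α') (hlo hα.1) hlt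
      (hhi hα'.1) hα.2.1.isLevelChain hα'.2.1.isLevelChain (hα'.2.2.trans hα.2.2.symm)).2 hj
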